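/- Let $m,\hbar>0$, $V_\infty\neq 0$, $E>V_\infty$, and let $\mathbf k\in\mathbb R^3$ satisfy $k^2=|\mathbf k|^2=\frac{2m}{\hbar^2}(E-V_\infty)$. Put $k_0^2=\frac{2m}{\hbar^2}E$, with $k_0\ge 0$ if $E\ge 0$ and $k_0=i\sqrt{2m|E|/\hbar^2}$ if $E<0$. Let $V=v+V_\infty$ on $\mathbb R^3$, where $v$ is real and measurable, of Kato class (that is, $\sup_{\mathbf r}\int_{|\mathbf r-\mathbf r'|<\eta}\frac{|v(\mathbf r')|}{|\mathbf r-\mathbf r'|}d\mathbf r'\to 0$ as $\eta\downarrow 0$), and $v(\mathbf r)=O(|\mathbf r|^{-\beta})$ at infinity for some $\beta>3$. Write $G_\kappa(\rho)=-\frac{e^{i\kappa\rho}}{4\pi\rho}$, $\psi_{inc}(\mathbf r)=e^{i\mathbf k\cdot\mathbf r}$ and $F(g)(\mathbf K)=\frac1{(2\pi)^3}\int e^{-i\mathbf K\cdot\mathbf r}g(\mathbf r)\,d\mathbf r$, extended to bounded functions as tempered distributions. Let $\psi=\psi_{inc}+\psi_{scatt}$ be a bounded continuous complex function on $\mathbb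 R^3$, and put $S=F(v\psi_{scatt})$, $\tilde v=F(v)$, $\tilde\psi_{scatt}=F(\psi_{scatt})$. Call a function $w$ *outgoing* (at wave number $k$) if it satisfies Sommerfeld's radiation condition: $w(\mathbf r)\to 0$ as $|\mathbf r|\to\infty$, $w$ is differentiable outside some ball, and $|\mathbf r|\left(\frac{\partial w}{\partial |\mathbf r|}-ikw\right)\to 0$ as $|\mathbf r|\to\infty$, uniformly in the direction of $\mathbf r$. Then $\frac{2mV_\infty}{\hbar^2(k^2-k_0^2)}=-1$, and the following four statements are equivalent. (a) The inhomogeneous (Lippmann–Schwinger) equation $$\psi(\mathbf r)=\psi_{inc}(\mathbf r)+\frac{2m}{\hbar^2}\int G_k(|\mathbf r-\mathbf r'|)\,v(\mathbf r')\psi(\mathbf r')\,d\mathbf r'$$ holds for every $\mathbf r$, with absolutely convergent integrals. (b) Its momentum-space form $$\tilde\psi_{scatt}(\mathbf K)=-\frac{2m}{\hbar^2(K^2-k^2)}\left(\tilde v(\mathbf K-\mathbf k)+S(\mathbf K)\right)$$ holds in the sense of tempered distributions, where the right side is the limit as $\varepsilon\downarrow0$ of the expression with $K^2-k^2$ replaced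 by $K^2-(k+i\varepsilon)^2$. (c) $\psi_{scatt}$ is outgoing and the homogeneous equation $$\psi(\mathbf r)=\frac{2m}{\hbar^2}\int G_{k_0}(|\mathbf r-\mathbf r'|)\,V(\mathbf r')\psi(\mathbf r')\,d\mathbf r'$$ holds, where the right side is the limit as $\varepsilon\downarrow0$, locally uniform in $\mathbf r$, of the absolutely convergent integrals with $k_0$ replaced by $k_0+i\varepsilon$. (d) $\psi_{scatt}$ is outgoing and the Fourier transform of the homogeneous equation, $$\delta(\mathbf K-\mathbf k)+\tilde\psi_{scatt}(\mathbf K)=-\frac{2m}{\hbar^2(K^2-k_0^2)}\left(\tilde v(\mathbf K-\mathbf k)+S(\mathbf K)+V_\infty\{\delta(\mathbf K-\mathbf k)+\tilde\psi_{scatt}(\mathbf K)\}\right),$$ holds in the sense of tempered distributions, where the right side is the limit as $\varepsilon\downarrow0$ of the expression with $k_0$ replaced by $k_0+i\varepsilon$. Moreover, if $E<0$, the homogeneous equation in the limit sense of (c) is equivalent to the same equation with the absolutely convergent integral taken at $k_0$ itself, for every $\mathbf r$. -/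

import Mathlib

open Filter Topology MeasureTheory
open scoped SchwartzMap

/-- Configuration space (and momentum space): Euclidean three-space. -/
abbrev E3 : Type := EuclideanSpace ℝ (Fin 3)

noncomputable section

/-- The incident plane wave `exp (i k · r)`. -/
def incidentWave (k : E3) (r : E3) : ℂ :=
  Complex.exp (Complex.I * ((inner ℝ k r : ℝ) : ℂ))

/-- The outgoing Green's function `-exp (i κ ρ) / (4 π ρ)` of the Helmholtz equation, as a function
of the distance `ρ`; the wave number `κ` may be complex. -/
def greenFn (κ : ℂ) (ρ : ℝ) : ℂ :=
  -Complex.exp (Complex.I * κ * (ρ : ℂ)) / (4 * (Real.pi : ℂ) * (ρ : ℂ))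

/-- The wave number `k₀` with `k₀² = 2 m E / ħ²`: nonnegative for `E ≥ 0`, positive imaginary for
`E < 0`. -/
def waveNumberZero (m hbar E : ℝ) : ℂ :=
  if 0 ≤ E then ((Real.sqrt (2 * m * E / hbar ^ 2) : ℝ) : ℂ)
  else Complex.I * ((Real.sqrt (2 * m * |E| / hbar ^ 2) : ℝ) : ℂ)

/-- The Kato class in dimension three:
`sup_x ∫_{|x - y| < η} |v y| / |x - y| dy → 0` as `η ↓ 0`. -/
def IsKato (v : E3 → ℝ) : Prop :=
  Tendsto (fun η : ℝ => ⨆ x : E3, ∫⁻ y in Metric.ball x η, ENNReal.ofReal (|v y| / ‖x - y‖))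
    (𝓝[>] 0) (𝓝 0)

/-- Short-range potentials: measurable functions of Kato class (so bounded functions and Coulomb-type
local singularities are allowed) that are `O(|r|^(-β))` at infinity for some `β > 3`. -/
def IsShortRange (v : E3 → ℝ) : Prop :=
  Measurable v ∧ IsKato v ∧
    ∃ β C R : ℝ, 3 < β ∧ ∀ r : E3, R ≤ ‖r‖ → |v r| ≤ C * (1 + ‖r‖) ^ (-β)

/-- Outgoing functions at wave number `κ > 0` (Sommerfeld's radiation condition): `w` vanishes at
infinity, is differentiable outside some ball, and `|r| (∂w/∂|r| - i κ w) → 0` as `|r| → ∞`,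
uniformly with respect to the direction of `r`. -/
def IsOutgoing (κ : ℝ) (w : E3 → ℂ) : Prop :=
  Tendsto w (cocompact E3) (𝓝 0) ∧
  (∀ᶠ r in cocompact E3, DifferentiableAt ℝ w r) ∧
  Tendsto (fun r : E3 => (‖r‖ : ℂ) * (fderiv ℝ w r (‖r‖⁻¹ • r) - Complex.I * (κ : ℂ) * w r))
    (cocompact E3) (𝓝 0)

/-- The inhomogeneous (Lippmann–Schwinger) equation
`ψ r = exp (i k · r) + (2m/ħ²) ∫ G(|r - r'|) v(r') ψ(r') dr'` at every `r`, the integral being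
absolutely convergent. -/
def InhomogeneousEq (m hbar : ℝ) (k : E3) (v : E3 → ℝ) (ψ : E3 → ℂ) : Prop :=
  ∀ r : E3,
    Integrable (fun r' : E3 => greenFn (‖k‖ : ℂ) ‖r - r'‖ * ((v r' : ℂ) * ψ r')) ∧
    ψ r = incidentWave k r +
      ((2 * m / hbar ^ 2 : ℝ) : ℂ) *
        ∫ r' : E3, greenFn (‖k‖ : ℂ) ‖r - r'‖ * ((v r' : ℂ) * ψ r')

/-- The homogeneous equation `ψ r = (2m/ħ²) ∫ G_κ(|r - r'|) V(r') ψ(r') dr'` at every `r`, the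
integral being absolutely convergent (no regularization). -/
def HomogeneousEqAbs (m hbar : ℝ) (κ : ℂ) (V : E3 → ℝ) (ψ : E3 → ℂ) : Prop :=
  ∀ r : E3,
    Integrable (fun r' : E3 => greenFn κ ‖r - r'‖ * ((V r' : ℂ) * ψ r')) ∧
    ψ r = ((2 * m / hbar ^ 2 : ℝ) : ℂ) *
      ∫ r' : E3, greenFn κ ‖r - r'‖ * ((V r' : ℂ) * ψ r')

/-- The homogeneous equation `ψ = (2m/ħ²) G_κ * (V ψ)` with `κ` understood as the limit of
`κ + i ε` for `ε ↓ 0`: the integrals with `κ + i ε` converge absolutely, and the resulting functions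
converge to `ψ` locally uniformly. -/
def HomogeneousEq (m hbar : ℝ) (κ : ℂ) (V : E3 → ℝ) (ψ : E3 → ℂ) : Prop :=
  (∀ ε : ℝ, 0 < ε → ∀ r : E3,
    Integrable (fun r' : E3 =>
      greenFn (κ + Complex.I * (ε : ℂ)) ‖r - r'‖ * ((V r' : ℂ) * ψ r'))) ∧
  TendstoLocallyUniformly
    (fun (ε : ℝ) (r : E3) => ((2 * m / hbar ^ 2 : ℝ) : ℂ) *
      ∫ r' : E3, greenFn (κ + Complex.I * (ε : ℂ)) ‖r - r'‖ * ((V r' : ℂ) * ψ r'))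
    ψ (𝓝[>] 0)

/-- The Fourier transform `(2π)⁻³ ∫ exp (-i K · r) g(r) dr`. -/
def fourier3 (g : E3 → ℂ) (K : E3) : ℂ :=
  (((2 * Real.pi) ^ 3 : ℝ) : ℂ)⁻¹ *
    ∫ r : E3, Complex.exp (-Complex.I * ((inner ℝ K r : ℝ) : ℂ)) * g r

/-- The pairing of the Fourier transform of the bounded function `u`, a tempered distribution, with
a test function `φ`: `⟨F u, φ⟩ = ∫ u(r) (F φ)(r) dr`. -/
def fourierPairing (u : E3 → ℂ) (φ : E3 → ℂ) : ℂ :=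
  ∫ r : E3, u r * fourier3 φ r

/-- The multiplier `-2m / (ħ² (|K|² - κ²))`. -/
def propagator (m hbar : ℝ) (κ : ℂ) (K : E3) : ℂ :=
  -((2 * m : ℝ) : ℂ) / (((hbar ^ 2 : ℝ) : ℂ) * ((‖K‖ : ℂ) ^ 2 - κ ^ 2))

/-- `F(v)(K - k) + S(K)`, where `S = F(v ψ_scatt)`. -/
def sourceTransform (k : E3) (v : E3 → ℝ) (ψs : E3 → ℂ) (K : E3) : ℂ :=
  fourier3 (fun r => (v r : ℂ)) (K - k) + fourier3 (fun r => (v r : ℂ) * ψs r) K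

/-- The momentum-space Lippmann–Schwinger equation
`F(ψ_scatt)(K) = -2m / (ħ² (K² - k²)) (F(v)(K - k) + S(K))`, an equality of tempered distributions
in which `k = |k|` is understood as the limit of `k + i ε`, `ε ↓ 0`. -/
def MomentumInhomogeneousEq (m hbar : ℝ) (k : E3) (v : E3 → ℝ) (ψs : E3 → ℂ) : Prop :=
  ∀ φ : 𝓢(E3, ℂ),
    Tendsto (fun ε : ℝ => ∫ K : E3,
        propagator m hbar ((‖k‖ : ℂ) + Complex.I * (ε : ℂ)) K * sourceTransform k v ψs K * φ K)
      (𝓝[>] 0) (𝓝 (fourierPairing ψs φ))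

/-- The Fourier transform of the homogeneous equation,
`δ(K - k) + F(ψ_scatt)(K) =
  -2m / (ħ² (K² - κ²)) (F(v)(K - k) + S(K) + V∞ (δ(K - k) + F(ψ_scatt)(K)))`,
an equality of tempered distributions in which `κ` is understood as the limit of `κ + i ε`,
`ε ↓ 0`. -/
def MomentumHomogeneousEq (m hbar Vinf : ℝ) (κ : ℂ) (k : E3) (v : E3 → ℝ) (ψs : E3 → ℂ) : Prop :=
  ∀ φ : 𝓢(E3, ℂ),
    Tendsto (fun ε : ℝ =>
        (∫ K : E3, propagator m hbar (κ + Complex.I * (ε : ℂ)) K * sourceTransform k v ψs K * φ K)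
        + (Vinf : ℂ) *
          (propagator m hbar (κ + Complex.I * (ε : ℂ)) k * φ k
            + fourierPairing ψs
                (fun K => propagator m hbar (κ + Complex.I * (ε : ℂ)) K * φ K)))
      (𝓝[>] 0) (𝓝 (φ k + fourierPairing ψs φ))

end

noncomputable section
open scoped Laplacian FourierTransform ContDiff

/-! ### The Green's function and its Fourier transform -/

/-! Put `a = 2m/ħ²`, `f = a v ψ` and `c = a V∞`, so that `k₀² - k² = c ≠ 0`. Statements (a) and (b)
both say `ψ_scatt = G_k f`, once in position space and once after pairing with test functions.
Statements (c) and (d) both say that `G_κ (f + c ψ)` tends to `ψ` as `κ = k₀ + iε → k₀`, locally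
uniformly or as tempered distributions, with the radiation condition added. The pivot is the
differential equation `(Δ + k²) ψ = f` in the weak sense, which is the same as `(Δ + k₀²) ψ = f + c
ψ`.

From (a) to (c) and (d): a bounded solution of `(Δ + k²) ψ = f` satisfies `ψ = G_κ f + (κ² - k²) G_κ
ψ` for every `κ` in the upper half plane (`IsHelmholtzSolution.eq_greenPotential`). Eliminating `G_κ
ψ` gives `G_κ (f + c ψ) - ψ = (1 - c/(κ² - k²)) (G_κ f - ψ)`. The last factor is bounded uniformly
in `κ` and in position, and the scalar in front tends to zero as `κ → k₀`, because `c ≠ 0`. The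
convergence is therefore uniform on all of space, although for real `k₀` the integral `G_{k₀} ψ`
need not converge absolutely. That `ψ_scatt = G_k f` is outgoing is a direct estimate,
`IsShortRange.isOutgoing_greenPotential`, using `β > 3`.

From (c) or (d) to (a): for `ε > 0` the potential `G_κ (f + c ψ)` solves `(Δ + κ²) u = f + c ψ`
weakly, and the limit gives the equation for `ψ` at `k₀`, hence at `k`. Then `ψ_scatt - G_k f` is
bounded, outgoing and solves the homogeneous Helmholtz equation, so it vanishes by
`IsOutgoing.eq_zero`. This uniqueness is proved without surface integrals: such an `h` equals `(κ² -
k²) G_κ h` with `κ = k + iε`. The prefactor is `O(ε)`. Along each ray `r² G_κ h` oscillates like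
`exp (2ikr)`, so integrating it gives `O(1) + o(1)/ε` where the trivial bound is `o(1)/ε²`. -/

theorem norm_greenFn (κ : ℂ) {ρ : ℝ} (hρ : 0 ≤ ρ) :
    ‖greenFn κ ρ‖ = Real.exp (-κ.im * ρ) / (4 * Real.pi * ρ) := by
  have h : (Complex.I * κ * (ρ : ℂ)).re = -κ.im * ρ := by simp
  rw [greenFn, norm_div, norm_neg, Complex.norm_exp, h]
  simp [abs_of_nonneg Real.pi_pos.le, abs_of_nonneg hρ]

@[fun_prop]
theorem measurable_greenFn (κ : ℂ) : Measurable (greenFn κ) := by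
  unfold greenFn; fun_prop

theorem finrank_E3 : Module.finrank ℝ E3 = 3 := by simp

/-- In polar coordinates the weight `t ^ 2` absorbs the singularity, whence `j ≤ 2`. The case `j =
1` serves the Green's function and `j = 0` the difference of two of them. -/
theorem integrable_exp_neg_mul_norm_div_pow {b : ℝ} (hb : 0 < b) {j : ℕ} (hj : j ≤ 2) :
    Integrable (fun y : E3 => Real.exp (-b * ‖y‖) / ‖y‖ ^ j) := by
  rw [integrable_fun_norm_addHaar volume (f := fun t => Real.exp (-b * t) / t ^ j), finrank_E3]
  have h1 : IntegrableOn (fun t : ℝ => t ^ ((2 - j : ℕ) : ℝ) * Real.exp (-b * t ^ (1 : ℝ)))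
      (Set.Ioi 0) :=
    integrableOn_rpow_mul_exp_neg_mul_rpow (by have : (0 : ℝ) ≤ ((2 - j : ℕ) : ℝ) := by positivity
                                               linarith) one_pos hb
  refine h1.congr_fun (fun t ht => ?_) measurableSet_Ioi
  have ht' : (t : ℝ) ≠ 0 := (Set.mem_Ioi.1 ht).ne'
  simp only [Real.rpow_natCast, Real.rpow_one, smul_eq_mul]
  rw [pow_sub₀ t ht' hj]; field_simp

theorem integrable_greenFn_norm {κ : ℂ} (hκ : 0 < κ.im) :
    Integrable (fun y : E3 => greenFn κ ‖y‖) := by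
  have h := (integrable_exp_neg_mul_norm_div_pow hκ (j := 1) (by norm_num)).const_mul
    (1 / (4 * Real.pi))
  refine h.mono' (Measurable.aestronglyMeasurable (by fun_prop)) (Eventually.of_forall fun y => ?_)
  rw [norm_greenFn κ (norm_nonneg y), pow_one]
  apply le_of_eq; field_simp

/-- Splitting off the first coordinate of three-space. -/
def splitFirst : E3 ≃ᵐ ℝ × EuclideanSpace ℝ (Fin 2) :=
  ((MeasurableEquiv.toLp 2 (Fin 3 → ℝ)).symm.trans
    (MeasurableEquiv.piFinSuccAbove (fun _ : Fin 3 => ℝ) 0)).trans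
    (MeasurableEquiv.prodCongr (MeasurableEquiv.refl ℝ) (MeasurableEquiv.toLp 2 (Fin 2 → ℝ)))

theorem measurePreserving_splitFirst : MeasurePreserving splitFirst := by
  have h1 := EuclideanSpace.volume_preserving_symm_measurableEquiv_toLp (Fin 3)
  have h2 := volume_preserving_piFinSuccAbove (fun _ : Fin 3 => ℝ) 0
  have h3 := (MeasurePreserving.id (volume : Measure ℝ)).prod
    (EuclideanSpace.volume_preserving_symm_measurableEquiv_toLp (Fin 2)).symm
  exact h3.comp (h2.comp h1)

theorem splitFirst_fst (y : E3) : (splitFirst y).1 = y 0 := rfl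

theorem norm_eq_sqrt_splitFirst (y : E3) :
    ‖y‖ = Real.sqrt ((splitFirst y).1 ^ 2 + ‖(splitFirst y).2‖ ^ 2) := by
  rw [EuclideanSpace.norm_eq, EuclideanSpace.norm_sq_eq, Fin.sum_univ_three, Fin.sum_univ_two,
    splitFirst_fst]
  have h0 : (splitFirst y).2 0 = y 1 := rfl
  have h1 : (splitFirst y).2 1 = y 2 := rfl
  rw [h0, h1]; simp [add_assoc]

theorem integral_radial_plane (F : ℝ → ℂ) :
    ∫ p : EuclideanSpace ℝ (Fin 2), F ‖p‖ = (2 * Real.pi : ℝ) * ∫ t in Set.Ioi (0 : ℝ), t * F t := by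
  rw [integral_fun_norm_addHaar]
  have hb : (volume : Measure (EuclideanSpace ℝ (Fin 2))).real (Metric.ball 0 1) = Real.pi := by
    rw [measureReal_def, EuclideanSpace.volume_ball]
    rw [Fintype.card_fin, Nat.cast_ofNat, div_self two_ne_zero, Real.Gamma_add_one one_ne_zero,
      Real.Gamma_one, Real.sq_sqrt Real.pi_pos.le]
    simp [Real.pi_pos.le]
  rw [hb]
  simp only [finrank_euclideanSpace, Fintype.card_fin, Complex.real_smul]
  simp
  ring

/-- The polar weight `t` is `ρ dρ/dt` for `ρ = √(s² + t²)`, and it cancels the factor `1/ρ` of the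
Green's function. The integrand is then an exact derivative, and only its boundary value at `t = 0`
survives. -/
theorem integral_greenFn_plane {κ : ℂ} (hκ : 0 < κ.im) {s : ℝ} (hs : s ≠ 0) :
    ∫ p : EuclideanSpace ℝ (Fin 2), greenFn κ (Real.sqrt (s ^ 2 + ‖p‖ ^ 2)) =
      Complex.exp (Complex.I * κ * (|s| : ℝ)) / (2 * Complex.I * κ) := by
  have hκ0 : κ ≠ 0 := by rintro rfl; simp at hκ
  rw [integral_radial_plane (fun t => greenFn κ (Real.sqrt (s ^ 2 + t ^ 2)))]
  set A : ℝ → ℂ := fun t =>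
    -Complex.exp (Complex.I * κ * (Real.sqrt (s ^ 2 + t ^ 2) : ℝ)) / (4 * Real.pi * Complex.I * κ)
  have hpos : ∀ t : ℝ, 0 < s ^ 2 + t ^ 2 := fun t => by positivity
  have hderiv : ∀ t : ℝ, HasDerivAt A (t * greenFn κ (Real.sqrt (s ^ 2 + t ^ 2))) t := by
    intro t
    have h1 : HasDerivAt (fun t : ℝ => Real.sqrt (s ^ 2 + t ^ 2)) (t / Real.sqrt (s ^ 2 + t ^ 2)) t := by
      have h := (((hasDerivAt_id t).pow 2).const_add (s ^ 2)).sqrt (hpos t).ne'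
      refine h.congr_deriv ?_
      simp; field_simp
    have h2 := ((h1.ofReal_comp.const_mul (Complex.I * κ)).cexp.neg).div_const
      (4 * Real.pi * Complex.I * κ)
    refine h2.congr_deriv ?_
    have h3 : (Real.sqrt (s ^ 2 + t ^ 2) : ℂ) ≠ 0 := by
      exact_mod_cast (Real.sqrt_pos.2 (hpos t)).ne'
    have hpi : (Real.pi : ℂ) ≠ 0 := by exact_mod_cast Real.pi_pos.ne'
    rw [greenFn]
    push_cast
    field_simp
  have hle : ∀ t : ℝ, 0 ≤ t → t ≤ Real.sqrt (s ^ 2 + t ^ 2) := fun t ht =>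
    Real.le_sqrt_of_sq_le (by nlinarith [sq_nonneg s])
  have hexp : ∀ t : ℝ, 0 ≤ t →
      Real.exp (-κ.im * Real.sqrt (s ^ 2 + t ^ 2)) ≤ Real.exp (-κ.im * t) := fun t ht =>
    Real.exp_le_exp.2 (by nlinarith [hle t ht])
  have hint : IntegrableOn (fun t : ℝ => t * greenFn κ (Real.sqrt (s ^ 2 + t ^ 2))) (Set.Ioi 0) := by
    have h0 : IntegrableOn (fun t : ℝ => Real.exp (-κ.im * t)) (Set.Ioi 0) :=
      exp_neg_integrableOn_Ioi 0 hκ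
    refine Integrable.mono' h0 (Measurable.aestronglyMeasurable (by fun_prop)) ?_
    filter_upwards [ae_restrict_mem measurableSet_Ioi] with t ht
    have ht0 : 0 < t := ht
    rw [norm_mul, norm_greenFn κ (Real.sqrt_nonneg _), Complex.norm_real, Real.norm_of_nonneg ht0.le]
    have hq : 0 < Real.sqrt (s ^ 2 + t ^ 2) := Real.sqrt_pos.2 (hpos t)
    rw [mul_div_assoc', div_le_iff₀ (by positivity)]
    have h4 : (1 : ℝ) ≤ 4 * Real.pi := by linarith [Real.pi_gt_three]
    calc t * Real.exp (-κ.im * Real.sqrt (s ^ 2 + t ^ 2))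
        ≤ Real.sqrt (s ^ 2 + t ^ 2) * Real.exp (-κ.im * t) := by
          exact mul_le_mul (hle t ht0.le) (hexp t ht0.le) (Real.exp_pos _).le hq.le
      _ ≤ Real.exp (-κ.im * t) * (4 * Real.pi * Real.sqrt (s ^ 2 + t ^ 2)) := by
          have := mul_pos (Real.exp_pos (-κ.im * t)) hq
          nlinarith
  have hlim : Tendsto A atTop (𝓝 0) := by
    have h0 : Tendsto (fun t : ℝ => Real.exp (-κ.im * t) / ‖4 * Real.pi * Complex.I * κ‖) atTop
        (𝓝 0) := by
      have : Tendsto (fun t : ℝ => Real.exp (-κ.im * t)) atTop (𝓝 0) :=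
        Real.tendsto_exp_atBot.comp (tendsto_id.const_mul_atTop_of_neg (by linarith))
      simpa using this.div_const ‖4 * Real.pi * Complex.I * κ‖
    refine squeeze_zero_norm' ?_ h0
    filter_upwards [eventually_ge_atTop 0] with t ht
    have h : (Complex.I * κ * (Real.sqrt (s ^ 2 + t ^ 2) : ℂ)).re
      = -κ.im * Real.sqrt (s ^ 2 + t ^ 2) := by simp
    simp only [A]
    rw [norm_div, norm_neg, Complex.norm_exp, h]
    exact div_le_div_of_nonneg_right (hexp t ht) (norm_nonneg _)
  have hc : Continuous A := continuous_iff_continuousAt.2 fun t => (hderiv t).continuousAt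
  rw [integral_Ioi_of_hasDerivAt_of_tendsto hc.continuousWithinAt (fun t _ => hderiv t) hint hlim]
  have hs0 : Real.sqrt (s ^ 2 + 0 ^ 2) = |s| := by simp [Real.sqrt_sq_eq_abs]
  have hpi : (Real.pi : ℂ) ≠ 0 := by exact_mod_cast Real.pi_pos.ne'
  simp only [A, hs0]
  push_cast
  field_simp
  ring

theorem integral_exp_mul_exp_abs {κ : ℂ} (hκ : 0 < κ.im) (q : ℝ) :
    ∫ s : ℝ, Complex.exp (Complex.I * q * s) *
      (Complex.exp (Complex.I * κ * (|s| : ℝ)) / (2 * Complex.I * κ)) = 1 / (κ ^ 2 - (q : ℂ) ^ 2) := by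
  have hκ0 : κ ≠ 0 := by rintro rfl; simp at hκ
  have h1 : κ + q ≠ 0 := fun h => by
    have := congrArg Complex.im h; simp at this; linarith
  have h2 : κ - q ≠ 0 := fun h => by
    have := congrArg Complex.im h; simp at this; linarith
  have ha : (Complex.I * (κ + q)).re < 0 := by simp; exact hκ
  have hb : 0 < (Complex.I * (q - κ)).re := by simp; exact hκ
  have e1 : ∀ s ∈ Set.Ioi (0 : ℝ), Complex.exp (Complex.I * q * s) *
      (Complex.exp (Complex.I * κ * (|s| : ℝ)) / (2 * Complex.I * κ)) =
      Complex.exp (Complex.I * (κ + q) * s) * (2 * Complex.I * κ)⁻¹ := by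
    intro s hs
    rw [abs_of_pos hs, div_eq_mul_inv, ← mul_assoc, ← Complex.exp_add]; ring_nf
  have e2 : ∀ s ∈ Set.Iic (0 : ℝ), Complex.exp (Complex.I * q * s) *
      (Complex.exp (Complex.I * κ * (|s| : ℝ)) / (2 * Complex.I * κ)) =
      Complex.exp (Complex.I * (q - κ) * s) * (2 * Complex.I * κ)⁻¹ := by
    intro s hs
    rw [abs_of_nonpos hs, div_eq_mul_inv, ← mul_assoc, ← Complex.exp_add]; push_cast; ring_nf
  have i1 := (integrableOn_exp_mul_complex_Ioi ha 0).mul_const (2 * Complex.I * κ)⁻¹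
  have i2 := (integrableOn_exp_mul_complex_Iic hb 0).mul_const (2 * Complex.I * κ)⁻¹
  rw [← setIntegral_univ, ← Set.Iic_union_Ioi (a := (0 : ℝ)),
    setIntegral_union (Set.Iic_disjoint_Ioi le_rfl) measurableSet_Ioi
      (IntegrableOn.congr_fun i2 (fun s hs => (e2 s hs).symm) measurableSet_Iic)
      (IntegrableOn.congr_fun i1 (fun s hs => (e1 s hs).symm) measurableSet_Ioi),
    setIntegral_congr_fun measurableSet_Iic e2, setIntegral_congr_fun measurableSet_Ioi e1,
    integral_mul_const, integral_mul_const, integral_exp_mul_complex_Ioi ha,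
    integral_exp_mul_complex_Iic hb]
  have h3 : (q : ℂ) - κ ≠ 0 := fun h => h2 (by rw [← neg_eq_zero, ← h]; ring)
  have h4 : κ ^ 2 - (q : ℂ) ^ 2 ≠ 0 := by
    rw [sq_sub_sq]; exact mul_ne_zero h1 h2
  simp only [Complex.ofReal_zero, mul_zero, Complex.exp_zero]
  field_simp
  rw [Complex.I_sq]; ring

/-- By rotation invariance `K` may be moved onto the first axis, here by a reflection. The phase is
then constant on the planes orthogonal to that axis, so integrating over these planes first reduces
the transform to one dimension. -/
theorem integral_exp_inner_mul_greenFn {κ : ℂ} (hκ : 0 < κ.im) (K : E3) :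
    ∫ y : E3, Complex.exp (Complex.I * ((inner ℝ K y : ℝ) : ℂ)) * greenFn κ ‖y‖ =
      1 / (κ ^ 2 - (‖K‖ : ℂ) ^ 2) := by
  set e : E3 := EuclideanSpace.single 0 1
  have he : ‖‖K‖ • e‖ = ‖K‖ := by simp [e, norm_smul]
  set L : E3 ≃ₗᵢ[ℝ] E3 := (ℝ ∙ (K - ‖K‖ • e))ᗮ.reflection
  have hL : L K = ‖K‖ • e := Submodule.reflection_sub he.symm
  set g : ℝ × EuclideanSpace ℝ (Fin 2) → ℂ := fun z =>
    Complex.exp (Complex.I * ‖K‖ * z.1) * greenFn κ (Real.sqrt (z.1 ^ 2 + ‖z.2‖ ^ 2))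
  have hg : ∀ y : E3, Complex.exp (Complex.I * ((inner ℝ K y : ℝ) : ℂ)) * greenFn κ ‖y‖ =
      g (splitFirst (L y)) := by
    intro y
    have h1 : inner ℝ K y = ‖K‖ * (L y) 0 := by
      rw [← L.inner_map_map, hL, real_inner_smul_left]
      simp [e, EuclideanSpace.inner_single_left]
    simp only [g]
    rw [← norm_eq_sqrt_splitFirst, L.norm_map, h1, splitFirst_fst]
    push_cast; ring_nf
  have hmp : MeasurePreserving (fun y => splitFirst (L y)) :=
    measurePreserving_splitFirst.comp L.measurePreserving
  have hemb : MeasurableEmbedding (fun y => splitFirst (L y)) :=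
    splitFirst.measurableEmbedding.comp L.toHomeomorph.measurableEmbedding
  have hint : Integrable g := by
    rw [← hmp.integrable_comp_emb hemb]
    have h := (integrable_greenFn_norm hκ).bdd_mul (c := 1)
      (f := fun y : E3 => Complex.exp (Complex.I * ((inner ℝ K y : ℝ) : ℂ))) (by fun_prop)
      (Eventually.of_forall fun y => by rw [mul_comm, Complex.norm_exp_ofReal_mul_I])
    exact h.congr (Eventually.of_forall fun y => hg y)
  simp_rw [hg]
  rw [hmp.integral_comp hemb g, Measure.volume_eq_prod, integral_prod _ hint]
  simp only [g, integral_const_mul]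
  rw [← integral_exp_mul_exp_abs hκ]
  refine integral_congr_ae ?_
  have h0 : ∀ᵐ s : ℝ, s ≠ 0 := by simp [ae_iff, measure_singleton]
  filter_upwards [h0] with s hs
  rw [integral_greenFn_plane hκ hs]


/-! ### Potentials -/

/-- The potential `∫ G_κ(|x - y|) g(y) dy`. -/
def greenPotential (κ : ℂ) (g : E3 → ℂ) (x : E3) : ℂ :=
  ∫ y : E3, greenFn κ ‖x - y‖ * g y

/-- The density `g` has uniformly bounded potentials for the kernel `exp (-b ρ) / ρ`. -/
structure HasPotentialBound (b : ℝ) (g : E3 → ℂ) (C : ℝ) : Prop where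
  aestronglyMeasurable : AEStronglyMeasurable g
  integrable : ∀ x : E3, Integrable (fun y => Real.exp (-b * ‖x - y‖) / ‖x - y‖ * ‖g y‖)
  integral_le : ∀ x : E3, ∫ y : E3, Real.exp (-b * ‖x - y‖) / ‖x - y‖ * ‖g y‖ ≤ C

theorem aestronglyMeasurable_greenFn_mul {g : E3 → ℂ} (hg : AEStronglyMeasurable g) (κ : ℂ)
    (x : E3) : AEStronglyMeasurable (fun y => greenFn κ ‖x - y‖ * g y) :=
  (Measurable.aestronglyMeasurable (by fun_prop)).mul hg

namespace HasPotentialBound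

variable {b b' C : ℝ} {g : E3 → ℂ}

theorem mono (h : HasPotentialBound b g C) (hb : b ≤ b') : HasPotentialBound b' g C := by
  have hle : ∀ x y : E3, Real.exp (-b' * ‖x - y‖) / ‖x - y‖ * ‖g y‖ ≤
      Real.exp (-b * ‖x - y‖) / ‖x - y‖ * ‖g y‖ := fun x y =>
    mul_le_mul_of_nonneg_right (div_le_div_of_nonneg_right
      (Real.exp_le_exp.2 (by nlinarith [norm_nonneg (x - y)])) (norm_nonneg _)) (norm_nonneg _)
  have hint : ∀ x : E3, Integrable (fun y => Real.exp (-b' * ‖x - y‖) / ‖x - y‖ * ‖g y‖) := by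
    intro x
    refine (h.integrable x).mono' ((Measurable.aestronglyMeasurable (by fun_prop)).mul
      h.aestronglyMeasurable.norm) (Eventually.of_forall fun y => ?_)
    rw [Real.norm_of_nonneg (by positivity)]
    exact hle x y
  exact ⟨h.aestronglyMeasurable, hint, fun x =>
    (integral_mono (hint x) (h.integrable x) (hle x)).trans (h.integral_le x)⟩

theorem norm_greenFn_mul_le {κ : ℂ} (hb : b ≤ κ.im) (x y : E3) :
    ‖greenFn κ ‖x - y‖ * g y‖ ≤
      1 / (4 * Real.pi) * (Real.exp (-b * ‖x - y‖) / ‖x - y‖ * ‖g y‖) := by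
  rw [norm_mul, norm_greenFn κ (norm_nonneg _), ← mul_assoc]
  refine mul_le_mul_of_nonneg_right ?_ (norm_nonneg _)
  rw [div_mul_div_comm, one_mul]
  exact div_le_div_of_nonneg_right
    (Real.exp_le_exp.2 (by nlinarith [norm_nonneg (x - y)])) (by positivity)

theorem integrable_greenFn_mul (h : HasPotentialBound b g C) {κ : ℂ} (hb : b ≤ κ.im) (x : E3) :
    Integrable (fun y => greenFn κ ‖x - y‖ * g y) :=
  ((h.integrable x).const_mul (1 / (4 * Real.pi))).mono'
    (aestronglyMeasurable_greenFn_mul h.aestronglyMeasurable κ x)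
    (Eventually.of_forall fun y => norm_greenFn_mul_le hb x y)

theorem integral_norm_greenFn_mul_le (h : HasPotentialBound b g C) {κ : ℂ} (hb : b ≤ κ.im)
    (x : E3) : ∫ y, ‖greenFn κ ‖x - y‖ * g y‖ ≤ C / (4 * Real.pi) := by
  calc ∫ y, ‖greenFn κ ‖x - y‖ * g y‖
      ≤ ∫ y, 1 / (4 * Real.pi) * (Real.exp (-b * ‖x - y‖) / ‖x - y‖ * ‖g y‖) :=
        integral_mono (h.integrable_greenFn_mul hb x).norm
          ((h.integrable x).const_mul _) (fun y => norm_greenFn_mul_le hb x y)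
    _ ≤ C / (4 * Real.pi) := by
        rw [integral_const_mul, div_eq_mul_one_div C, mul_comm C]
        exact mul_le_mul_of_nonneg_left (h.integral_le x) (by positivity)

theorem norm_greenPotential_le (h : HasPotentialBound b g C) {κ : ℂ} (hb : b ≤ κ.im)
    (x : E3) : ‖greenPotential κ g x‖ ≤ C / (4 * Real.pi) :=
  (norm_integral_le_integral_norm _).trans (h.integral_norm_greenFn_mul_le hb x)

theorem const_mul (h : HasPotentialBound b g C) (c : ℂ) :
    HasPotentialBound b (fun y => c * g y) (‖c‖ * C) := by
  have e : ∀ x y : E3, Real.exp (-b * ‖x - y‖) / ‖x - y‖ * ‖c * g y‖ =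
      ‖c‖ * (Real.exp (-b * ‖x - y‖) / ‖x - y‖ * ‖g y‖) := fun x y => by rw [norm_mul]; ring
  refine ⟨h.aestronglyMeasurable.const_mul c, fun x => ?_, fun x => ?_⟩
  · simp_rw [e]; exact (h.integrable x).const_mul _
  · simp_rw [e]; rw [integral_const_mul]
    exact mul_le_mul_of_nonneg_left (h.integral_le x) (norm_nonneg _)

theorem add {g' : E3 → ℂ} {C' : ℝ} (h : HasPotentialBound b g C)
    (h' : HasPotentialBound b g' C') : HasPotentialBound b (fun y => g y + g' y) (C + C') := by
  have hle : ∀ x y : E3, Real.exp (-b * ‖x - y‖) / ‖x - y‖ * ‖g y + g' y‖ ≤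
      Real.exp (-b * ‖x - y‖) / ‖x - y‖ * ‖g y‖ +
        Real.exp (-b * ‖x - y‖) / ‖x - y‖ * ‖g' y‖ := fun x y => by
    rw [← mul_add]
    exact mul_le_mul_of_nonneg_left (norm_add_le _ _) (by positivity)
  have hint : ∀ x : E3,
      Integrable (fun y => Real.exp (-b * ‖x - y‖) / ‖x - y‖ * ‖g y + g' y‖) := by
    intro x
    refine ((h.integrable x).add (h'.integrable x)).mono'
      ((Measurable.aestronglyMeasurable (by fun_prop)).mul
        (h.aestronglyMeasurable.add h'.aestronglyMeasurable).norm)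
      (Eventually.of_forall fun y => ?_)
    rw [Real.norm_of_nonneg (by positivity)]
    exact hle x y
  refine ⟨h.aestronglyMeasurable.add h'.aestronglyMeasurable, hint, fun x => ?_⟩
  refine (integral_mono (hint x) ((h.integrable x).add (h'.integrable x)) (hle x)).trans ?_
  rw [integral_add' (h.integrable x) (h'.integrable x)]
  exact add_le_add (h.integral_le x) (h'.integral_le x)

theorem of_bounded (hb : 0 < b) (hg : AEStronglyMeasurable g) {M : ℝ} (hM : ∀ y, ‖g y‖ ≤ M) :
    ∃ C, HasPotentialBound b g C := by
  have hk : Integrable (fun y : E3 => Real.exp (-b * ‖y‖) / ‖y‖) := by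
    simpa using integrable_exp_neg_mul_norm_div_pow hb (j := 1) (by norm_num)
  have hk' : ∀ x : E3, Integrable (fun y : E3 => Real.exp (-b * ‖x - y‖) / ‖x - y‖) := fun x =>
    hk.comp_sub_left x
  have hle : ∀ x y : E3, Real.exp (-b * ‖x - y‖) / ‖x - y‖ * ‖g y‖ ≤
      Real.exp (-b * ‖x - y‖) / ‖x - y‖ * M := fun x y =>
    mul_le_mul_of_nonneg_left (hM y) (by positivity)
  have hint : ∀ x : E3, Integrable (fun y => Real.exp (-b * ‖x - y‖) / ‖x - y‖ * ‖g y‖) := by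
    intro x
    refine ((hk' x).mul_const M).mono' ((Measurable.aestronglyMeasurable (by fun_prop)).mul hg.norm)
      (Eventually.of_forall fun y => ?_)
    rw [Real.norm_of_nonneg (by positivity)]
    exact hle x y
  refine ⟨(∫ y : E3, Real.exp (-b * ‖y‖) / ‖y‖) * M, hg, hint, fun x => ?_⟩
  refine (integral_mono (hint x) ((hk' x).mul_const M) (hle x)).trans ?_
  rw [integral_mul_const,
    integral_sub_left_eq_self (fun y : E3 => Real.exp (-b * ‖y‖) / ‖y‖) volume x]

/-- The symmetry of the Green's operator. -/
theorem integral_greenPotential_mul (h : HasPotentialBound b g C) {κ : ℂ} (hb : b ≤ κ.im)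
    {χ : E3 → ℂ} (hχ : Integrable χ) :
    ∫ x, greenPotential κ g x * χ x = ∫ y, g y * greenPotential κ χ y := by
  set F : E3 → E3 → ℂ := fun x y => greenFn κ ‖x - y‖ * g y * χ x
  -- Integrating in `y` first, the bound `C` does not depend on `x`, so integrability of `χ` is all
  -- that Fubini still requires.
  have hF : Integrable (Function.uncurry F) (volume.prod volume) := by
    have hm : AEStronglyMeasurable (Function.uncurry F) (volume.prod volume) :=
      ((Measurable.aestronglyMeasurable (by fun_prop)).mul
        h.aestronglyMeasurable.comp_snd).mul hχ.aestronglyMeasurable.comp_fst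
    rw [integrable_prod_iff hm]
    refine ⟨Eventually.of_forall fun x => (h.integrable_greenFn_mul hb x).mul_const (χ x), ?_⟩
    refine (hχ.norm.const_mul (C / (4 * Real.pi))).mono' hm.norm.integral_prod_right'
      (Eventually.of_forall fun x => ?_)
    rw [Real.norm_of_nonneg (integral_nonneg fun _ => norm_nonneg _)]
    simp only [Function.uncurry, F, norm_mul _ (χ x)]
    rw [integral_mul_const]
    exact mul_le_mul_of_nonneg_right (h.integral_norm_greenFn_mul_le hb x) (norm_nonneg _)
  calc ∫ x, greenPotential κ g x * χ x = ∫ x, ∫ y, F x y := by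
        refine integral_congr_ae (Eventually.of_forall fun x => ?_)
        simp only [greenPotential, F]; rw [integral_mul_const]
    _ = ∫ y, ∫ x, F x y := integral_integral_swap hF
    _ = ∫ y, g y * greenPotential κ χ y := by
        refine integral_congr_ae (Eventually.of_forall fun y => ?_)
        simp only [greenPotential, F]
        rw [← integral_const_mul]
        refine integral_congr_ae (Eventually.of_forall fun x => ?_)
        simp only; rw [norm_sub_rev]; ring

end HasPotentialBound

theorem continuous_greenPotential_of_bounded {κ : ℂ} (hκ : 0 < κ.im) {u : E3 → ℂ}
    (hu : Continuous u) {M : ℝ} (hM : ∀ y, ‖u y‖ ≤ M) : Continuous (greenPotential κ u) := by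
  -- After this substitution the singular kernel no longer depends on `x`, and continuity is
  -- inherited from `u` by dominated convergence.
  have e : greenPotential κ u = fun x => ∫ y : E3, greenFn κ ‖y‖ * u (x - y) := by
    funext x
    rw [greenPotential,
      ← integral_sub_left_eq_self (fun y : E3 => greenFn κ ‖y‖ * u (x - y)) volume x]
    simp
  rw [e]
  refine continuous_of_dominated (bound := fun y : E3 => ‖greenFn κ ‖y‖‖ * M) (fun x => ?_)
    (fun x => Eventually.of_forall fun y => ?_) ((integrable_greenFn_norm hκ).norm.mul_const M)
    (Eventually.of_forall fun y => ?_)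
  · exact (Measurable.aestronglyMeasurable (by fun_prop)).mul
      (by fun_prop : Continuous fun y => u (x - y)).aestronglyMeasurable
  · rw [norm_mul]; exact mul_le_mul_of_nonneg_left (hM _) (norm_nonneg _)
  · fun_prop

/-! ### Short-range potentials -/

theorem IsKato.exists_lintegral_le {v : E3 → ℝ} (hv : IsKato v) {δ : ℝ} (hδ : 0 < δ) :
    ∃ η > 0, ∀ x : E3, ∫⁻ y in Metric.ball x η, ENNReal.ofReal (|v y| / ‖x - y‖) ≤
      ENNReal.ofReal δ := by
  have h1 := hv.eventually (ge_mem_nhds (ENNReal.ofReal_pos.2 hδ))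
  obtain ⟨η, hη, hη0⟩ := (h1.and self_mem_nhdsWithin).exists
  exact ⟨η, hη0, fun x => (le_iSup (fun x : E3 => ∫⁻ y in Metric.ball x η,
    ENNReal.ofReal (|v y| / ‖x - y‖)) x).trans hη⟩

theorem IsKato.exists_integral_le {v : E3 → ℝ} (hv : IsKato v) (hm : Measurable v) {δ : ℝ}
    (hδ : 0 < δ) : ∃ η > 0, ∀ x : E3,
      IntegrableOn (fun y => |v y| / ‖x - y‖) (Metric.ball x η) ∧
      ∫ y in Metric.ball x η, |v y| / ‖x - y‖ ≤ δ := by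
  obtain ⟨η, hη, h⟩ := hv.exists_lintegral_le hδ
  refine ⟨η, hη, fun x => ?_⟩
  have hmeas : AEStronglyMeasurable (fun y => |v y| / ‖x - y‖)
      (volume.restrict (Metric.ball x η)) := Measurable.aestronglyMeasurable (by fun_prop)
  have h0 : 0 ≤ᵐ[volume.restrict (Metric.ball x η)] fun y => |v y| / ‖x - y‖ :=
    Eventually.of_forall fun y => by positivity
  constructor
  · refine ⟨hmeas, ?_⟩
    rw [hasFiniteIntegral_iff_ofReal h0]
    exact (h x).trans_lt ENNReal.ofReal_lt_top
  · rw [integral_eq_lintegral_of_nonneg_ae h0 hmeas]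
    exact ENNReal.toReal_le_of_le_ofReal hδ.le (h x)

theorem ae_ne_point (x : E3) : ∀ᵐ y : E3, y ≠ x := by simp [ae_iff, measure_singleton]

/-- On the ball of radius `η` around `x` one has `1 ≤ η / ‖x - y‖`, so the Kato integral controls
the plain integral. -/
theorem IsKato.locallyIntegrable {v : E3 → ℝ} (hv : IsKato v) (hm : Measurable v) :
    LocallyIntegrable v := by
  obtain ⟨η, hη, h⟩ := hv.exists_integral_le hm one_pos
  intro x
  refine ⟨Metric.ball x η, Metric.ball_mem_nhds x hη, ?_⟩
  refine Integrable.mono' ((h x).1.const_mul η) hm.aestronglyMeasurable ?_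
  filter_upwards [ae_restrict_mem Metric.isOpen_ball.measurableSet,
    ae_restrict_of_ae (ae_ne_point x)] with y hy hyx
  have h1 : 0 < ‖x - y‖ := norm_pos_iff.2 (sub_ne_zero.2 hyx.symm)
  have h2 : ‖x - y‖ ≤ η := by rw [← dist_eq_norm, dist_comm]; exact (Metric.mem_ball.1 hy).le
  rw [Real.norm_eq_abs, mul_div_assoc', le_div_iff₀ h1, mul_comm η]
  exact mul_le_mul_of_nonneg_left h2 (abs_nonneg _)

/-- The Kato condition takes care of a ball, and the decay rate `β > 3` exceeds the dimension
outside it. -/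
theorem IsShortRange.integrable {v : E3 → ℝ} (hv : IsShortRange v) : Integrable v := by
  obtain ⟨hm, hK, β, C, R, hβ, hC⟩ := hv
  have h1 : IntegrableOn v (Metric.closedBall 0 R) :=
    (hK.locallyIntegrable hm).integrableOn_isCompact (isCompact_closedBall 0 R)
  have h2 : IntegrableOn v (Metric.closedBall 0 R)ᶜ := by
    have h3 : Integrable (fun x : E3 => C * (1 + ‖x‖) ^ (-β)) :=
      (integrable_one_add_norm (by rw [finrank_E3]; exact_mod_cast hβ)).const_mul C
    refine Integrable.mono' h3.integrableOn hm.aestronglyMeasurable ?_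
    filter_upwards [ae_restrict_mem (Metric.isClosed_closedBall.measurableSet.compl)] with y hy
    rw [Real.norm_eq_abs]
    refine hC y ?_
    simp only [Set.mem_compl_iff, Metric.mem_closedBall, dist_zero_right, not_le] at hy
    exact hy.le
  rw [← integrableOn_univ, ← Set.union_compl_self (Metric.closedBall (0 : E3) R)]
  exact h1.union h2

/-- Close to `x` the Kato condition gives a bound independent of `x`. Farther away the kernel is at
most `η⁻¹` and `v` is integrable. -/
theorem IsShortRange.exists_hasPotentialBound {v : E3 → ℝ} (hv : IsShortRange v) {g : E3 → ℂ}
    (hg : AEStronglyMeasurable g) {M : ℝ} (hM : ∀ y, ‖g y‖ ≤ M * |v y|) :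
    ∃ C, HasPotentialBound 0 g C := by
  obtain ⟨η, hη, h⟩ := hv.2.1.exists_integral_le hv.1 one_pos
  have hvi := hv.integrable.abs
  have hball : ∀ x : E3, MeasurableSet (Metric.ball x η) := fun x => Metric.isOpen_ball.measurableSet
  have hout : ∀ x : E3, ∀ y ∈ (Metric.ball x η)ᶜ, |v y| / ‖x - y‖ ≤ η⁻¹ * |v y| := by
    intro x y hy
    have h2 : η ≤ ‖x - y‖ := by
      rw [← dist_eq_norm, dist_comm]; simpa using hy
    rw [div_eq_inv_mul]
    exact mul_le_mul_of_nonneg_right (inv_anti₀ hη h2) (abs_nonneg _)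
  have hint2 : ∀ x : E3, IntegrableOn (fun y => |v y| / ‖x - y‖) (Metric.ball x η)ᶜ := by
    intro x
    have hmv := hv.1
    refine Integrable.mono' (hvi.const_mul η⁻¹).integrableOn
      (Measurable.aestronglyMeasurable (by fun_prop)) ?_
    filter_upwards [ae_restrict_mem (hball x).compl] with y hy
    rw [Real.norm_of_nonneg (by positivity)]
    exact hout x y hy
  have hint : ∀ x : E3, Integrable (fun y => |v y| / ‖x - y‖) := by
    intro x
    rw [← integrableOn_univ, ← Set.union_compl_self (Metric.ball x η)]
    exact (h x).1.union (hint2 x)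
  have hle : ∀ x y : E3, Real.exp (-0 * ‖x - y‖) / ‖x - y‖ * ‖g y‖ ≤ M * (|v y| / ‖x - y‖) := by
    intro x y
    have : Real.exp (-0 * ‖x - y‖) / ‖x - y‖ * ‖g y‖ = ‖g y‖ / ‖x - y‖ := by simp; ring
    rw [this, mul_div_assoc']
    exact div_le_div_of_nonneg_right (hM y) (norm_nonneg _)
  have hintg : ∀ x : E3, Integrable (fun y => Real.exp (-0 * ‖x - y‖) / ‖x - y‖ * ‖g y‖) := by
    intro x
    refine ((hint x).const_mul M).mono' ((Measurable.aestronglyMeasurable (by fun_prop)).mul hg.norm)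
      (Eventually.of_forall fun y => ?_)
    rw [Real.norm_of_nonneg (by positivity)]
    exact hle x y
  refine ⟨|M| * (1 + η⁻¹ * ∫ y, |v y|), hg, hintg, fun x => ?_⟩
  refine (integral_mono (hintg x) ((hint x).const_mul M) (hle x)).trans ?_
  rw [integral_const_mul]
  refine mul_le_mul (le_abs_self M) ?_ (integral_nonneg fun y => by positivity) (abs_nonneg M)
  rw [← integral_add_compl (hball x) (hint x)]
  refine add_le_add (h x).2 ?_
  rw [← integral_const_mul]
  refine (setIntegral_mono_on (hint2 x) (hvi.const_mul η⁻¹).integrableOn (hball x).compl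
    (hout x)).trans ?_
  exact setIntegral_le_integral (hvi.const_mul _) (Eventually.of_forall fun y => by positivity)

theorem continuousOn_greenFn (κ : ℂ) : ContinuousOn (greenFn κ) (Set.Ioi 0) := by
  unfold greenFn
  refine ContinuousOn.div (by fun_prop) (by fun_prop) fun ρ hρ => ?_
  have h1 : (ρ : ℂ) ≠ 0 := by exact_mod_cast (Set.mem_Ioi.1 hρ).ne'
  have hpi : (Real.pi : ℂ) ≠ 0 := by exact_mod_cast Real.pi_pos.ne'
  exact mul_ne_zero (mul_ne_zero (by norm_num) hpi) h1

theorem norm_greenFn_le {κ : ℂ} (hκ : 0 ≤ κ.im) {ρ : ℝ} (hρ : 0 ≤ ρ) :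
    ‖greenFn κ ρ‖ ≤ 1 / (4 * Real.pi * ρ) := by
  rw [norm_greenFn κ hρ]
  exact div_le_div_of_nonneg_right (Real.exp_le_one_iff.2 (by nlinarith)) (by positivity)

theorem IsShortRange.integrable_of_le {v : E3 → ℝ} (hv : IsShortRange v) {g : E3 → ℂ}
    (hg : AEStronglyMeasurable g) {M : ℝ} (hM : ∀ y, ‖g y‖ ≤ M * |v y|) : Integrable g :=
  (hv.integrable.abs.const_mul M).mono' hg (Eventually.of_forall hM)

/-- Replacing `‖x - y‖` by `max ‖x - y‖ η` makes the kernel bounded and continuous, so the truncated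
potential is continuous. By the Kato condition the truncation error is small uniformly in `x`, and
continuity passes to the uniform limit. -/
theorem IsShortRange.continuous_greenPotential {v : E3 → ℝ} (hv : IsShortRange v) {g : E3 → ℂ}
    (hg : AEStronglyMeasurable g) {M : ℝ} (hM : ∀ y, ‖g y‖ ≤ M * |v y|) {κ : ℂ} (hκ : 0 ≤ κ.im) :
    Continuous (greenPotential κ g) := by
  have hgi := hv.integrable_of_le hg hM
  obtain ⟨C, hC⟩ := hv.exists_hasPotentialBound hg hM
  refine continuous_of_uniform_approx_of_continuous fun s hs => ?_
  obtain ⟨ε, hε, hεs⟩ := Metric.mem_uniformity_dist.1 hs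
  -- The two kernels differ by at most `1 / ‖x - y‖`, so the error is at most `|M|` times the Kato
  -- integral; adding 1 to the denominator makes the final inequality strict and covers `M = 0`.
  obtain ⟨η, hη, h⟩ := hv.2.1.exists_integral_le hv.1 (δ := ε / (|M| + 1)) (by positivity)
  have hmax : ∀ x y : E3, 0 < max ‖x - y‖ η := fun x y => lt_max_of_lt_right hη
  have hbd : ∀ x y : E3, ‖greenFn κ (max ‖x - y‖ η)‖ ≤ 1 / (4 * Real.pi * η) := by
    intro x y
    refine (norm_greenFn_le hκ (hmax x y).le).trans ?_
    exact one_div_le_one_div_of_le (by positivity)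
      (mul_le_mul_of_nonneg_left (le_max_right _ _) (by positivity))
  have hTi : ∀ x : E3, Integrable (fun y => greenFn κ (max ‖x - y‖ η) * g y) := fun x =>
    hgi.bdd_mul (Measurable.aestronglyMeasurable (by fun_prop))
      (Eventually.of_forall fun y => hbd x y)
  refine ⟨fun x => ∫ y, greenFn κ (max ‖x - y‖ η) * g y, ?_, fun x => hεs ?_⟩
  · refine continuous_of_dominated (bound := fun y => 1 / (4 * Real.pi * η) * ‖g y‖)
      (fun x => (hTi x).aestronglyMeasurable)
      (fun x => Eventually.of_forall fun y => ?_) (hgi.norm.const_mul _)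
      (Eventually.of_forall fun y => ?_)
    · rw [norm_mul]; exact mul_le_mul_of_nonneg_right (hbd x y) (norm_nonneg _)
    · exact ((continuousOn_greenFn κ).comp_continuous (by fun_prop) (fun x => hmax x y)).mul
        continuous_const
  · have hi := hC.integrable_greenFn_mul hκ x
    rw [dist_eq_norm, greenPotential, ← integral_sub hi (hTi x)]
    have hsupp : ∀ y, y ∉ Metric.ball x η →
        greenFn κ ‖x - y‖ * g y - greenFn κ (max ‖x - y‖ η) * g y = 0 := by
      intro y hy
      have h2 : η ≤ ‖x - y‖ := by
        rw [← dist_eq_norm, dist_comm]; simpa using hy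
      rw [max_eq_left h2, sub_self]
    rw [← setIntegral_eq_integral_of_forall_compl_eq_zero hsupp]
    have hpt : ∀ y ∈ Metric.ball x η, y ≠ x →
        ‖greenFn κ ‖x - y‖ * g y - greenFn κ (max ‖x - y‖ η) * g y‖ ≤ |M| * (|v y| / ‖x - y‖) := by
      intro y hy hyx
      have h1 : 0 < ‖x - y‖ := norm_pos_iff.2 (sub_ne_zero.2 hyx.symm)
      have h3 : ‖greenFn κ (max ‖x - y‖ η)‖ ≤ 1 / (4 * Real.pi * ‖x - y‖) :=
        (norm_greenFn_le hκ (hmax x y).le).trans (one_div_le_one_div_of_le (by positivity)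
          (mul_le_mul_of_nonneg_left (le_max_left _ _) (by positivity)))
      have h4 := norm_greenFn_le hκ h1.le
      have h5 : 1 / (4 * Real.pi * ‖x - y‖) ≤ 1 / 2 * (1 / ‖x - y‖) := by
        rw [div_mul_div_comm, one_mul]
        exact one_div_le_one_div_of_le (by positivity)
          (mul_le_mul_of_nonneg_right (by linarith [Real.pi_gt_three]) h1.le)
      have h6 : ‖greenFn κ ‖x - y‖ - greenFn κ (max ‖x - y‖ η)‖ ≤ 1 / ‖x - y‖ :=
        (norm_sub_le _ _).trans (by linarith)
      rw [← sub_mul, norm_mul]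
      calc _ ≤ 1 / ‖x - y‖ * (|M| * |v y|) :=
            mul_le_mul h6 ((hM y).trans (mul_le_mul_of_nonneg_right (le_abs_self M)
              (abs_nonneg _))) (norm_nonneg _) (by positivity)
        _ = _ := by ring
    have hle := norm_integral_le_of_norm_le ((h x).1.const_mul |M|)
      (f := fun y => greenFn κ ‖x - y‖ * g y - greenFn κ (max ‖x - y‖ η) * g y) (by
        filter_upwards [ae_restrict_mem Metric.isOpen_ball.measurableSet,
          ae_restrict_of_ae (ae_ne_point x)] with y hy hyx
        exact hpt y hy hyx)
    refine hle.trans_lt ?_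
    rw [integral_const_mul]
    calc |M| * ∫ y in Metric.ball x η, |v y| / ‖x - y‖ ≤ |M| * (ε / (|M| + 1)) :=
          mul_le_mul_of_nonneg_left (h x).2 (abs_nonneg M)
      _ < ε := by
          rw [mul_div_assoc', div_lt_iff₀ (by positivity)]
          nlinarith [abs_nonneg M]


/-! ### The resolvent on Schwartz functions -/

/-- In the factorization `(κ + t) (κ - t)` both factors have imaginary part `κ.im`, since `t` is
real. -/
theorem im_sq_le_norm_sq_sub {κ : ℂ} (hκ : 0 < κ.im) (t : ℝ) :
    κ.im ^ 2 ≤ ‖κ ^ 2 - (t : ℂ) ^ 2‖ := by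
  have h1 : κ.im ≤ ‖κ + t‖ := by
    have := Complex.abs_im_le_norm (κ + t)
    simp only [Complex.add_im, Complex.ofReal_im, add_zero] at this
    exact (le_abs_self _).trans this
  have h2 : κ.im ≤ ‖κ - t‖ := by
    have := Complex.abs_im_le_norm (κ - t)
    simp only [Complex.sub_im, Complex.ofReal_im, sub_zero] at this
    exact (le_abs_self _).trans this
  rw [sq_sub_sq, norm_mul, sq]
  exact mul_le_mul h1 h2 hκ.le (norm_nonneg _)

theorem sq_sub_sq_ofReal_ne_zero {κ : ℂ} (hκ : 0 < κ.im) (t : ℝ) : κ ^ 2 - (t : ℂ) ^ 2 ≠ 0 := by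
  rw [← norm_pos_iff]
  exact (pow_pos hκ 2).trans_le (im_sq_le_norm_sq_sub hκ t)

theorem iterate_deriv_inv_affine (w c : ℂ) (n : ℕ) (s : ℝ) (hs : w - c * s ≠ 0) :
    deriv^[n] (fun s : ℝ => (w - c * s)⁻¹) s = n.factorial * c ^ n * ((w - c * s)⁻¹) ^ (n + 1) := by
  induction n generalizing s with
  | zero => simp
  | succ n ih =>
    rw [Function.iterate_succ_apply']
    have hev : ∀ᶠ s' : ℝ in 𝓝 s, w - c * s' ≠ 0 :=
      (by fun_prop : ContinuousAt (fun s' : ℝ => w - c * (s' : ℂ)) s).eventually_ne hs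
    have he : deriv^[n] (fun s : ℝ => (w - c * s)⁻¹) =ᶠ[𝓝 s]
        fun s : ℝ => n.factorial * c ^ n * ((w - c * s)⁻¹) ^ (n + 1) :=
      hev.mono fun s' hs' => ih s' hs'
    rw [he.deriv_eq]
    have h1 : HasDerivAt (fun s : ℝ => w - c * (s : ℂ)) (-c) s := by
      simpa using ((hasDerivAt_id s).ofReal_comp.const_mul c).const_sub w
    have h2 := ((h1.fun_inv hs).fun_pow (n + 1)).const_mul ((n.factorial : ℂ) * c ^ n)
    rw [h2.deriv, Nat.factorial_succ]
    push_cast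
    simp only [inv_pow]
    field_simp
    ring

/-- As a function of `s = ‖ξ‖ ^ 2` the symbol is the inverse of an affine function, with explicit
derivatives that are bounded for `s ≥ 0`. For negative `s` the denominator can vanish, so the
composition is taken relative to `Set.Ici 0`. -/
theorem hasTemperateGrowth_resolvent {κ : ℂ} (hκ : 0 < κ.im) (a : ℝ) :
    (fun ξ : E3 => (κ ^ 2 - ((a * ‖ξ‖ : ℝ) : ℂ) ^ 2)⁻¹).HasTemperateGrowth := by
  set w : ℂ := κ ^ 2
  set c : ℂ := (a : ℂ) ^ 2
  have hlow : ∀ s : ℝ, 0 ≤ s → κ.im ^ 2 ≤ ‖w - c * s‖ := by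
    intro s hs
    have h := im_sq_le_norm_sq_sub hκ (a * Real.sqrt s)
    have e : ((a * Real.sqrt s : ℝ) : ℂ) ^ 2 = c * s := by
      simp only [c]; push_cast; rw [mul_pow]; norm_cast; rw [Real.sq_sqrt hs]
    rwa [e] at h
  have hne : ∀ s : ℝ, 0 ≤ s → w - c * s ≠ 0 := fun s hs =>
    norm_pos_iff.1 ((pow_pos hκ 2).trans_le (hlow s hs))
  have he : (fun ξ : E3 => (κ ^ 2 - ((a * ‖ξ‖ : ℝ) : ℂ) ^ 2)⁻¹) =
      (fun s : ℝ => (w - c * s)⁻¹) ∘ (fun ξ : E3 => ‖ξ‖ ^ 2) := by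
    funext ξ; simp [w, c, mul_pow]
  have hcd : ∀ s : ℝ, 0 ≤ s → ContDiffAt ℝ ⊤ (fun s : ℝ => (w - c * s)⁻¹) s := fun s hs => by
    refine ContDiffAt.inv ?_ (hne s hs)
    exact contDiffAt_const.sub (contDiffAt_const.mul Complex.ofRealCLM.contDiff.contDiffAt)
  rw [he]
  clear_value c w
  refine Function.HasTemperateGrowth.comp' (t := Set.Ici (0 : ℝ)) ?_ (uniqueDiffOn_Ici 0) ?_ ?_
    (Function.hasTemperateGrowth_norm_sq E3)
  · rintro _ ⟨ξ, rfl⟩; exact sq_nonneg ‖ξ‖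
  · exact fun s hs => ((hcd s hs).of_le le_top).contDiffWithinAt
  · intro N
    refine ⟨0, ∑ n ∈ Finset.range (N + 1),
      (n.factorial * ‖c‖ ^ n * ((κ.im ^ 2)⁻¹) ^ (n + 1)), by positivity, fun n hn s hs => ?_⟩
    rw [norm_iteratedFDerivWithin_eq_norm_iteratedDerivWithin,
      iteratedDerivWithin_eq_iteratedDeriv (uniqueDiffOn_Ici 0) ((hcd s hs).of_le le_top) hs,
      iteratedDeriv_eq_iterate, iterate_deriv_inv_affine w c n s (hne s hs), pow_zero, mul_one]
    have hle : ‖(n.factorial : ℂ) * c ^ n * ((w - c * s)⁻¹) ^ (n + 1)‖ ≤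
        n.factorial * ‖c‖ ^ n * ((κ.im ^ 2)⁻¹) ^ (n + 1) := by
      rw [norm_mul, norm_mul, norm_pow, norm_pow, norm_inv, Complex.norm_natCast]
      have := inv_anti₀ (pow_pos hκ 2) (hlow s hs)
      gcongr
    refine hle.trans ?_
    exact Finset.single_le_sum
      (f := fun n : ℕ => (n.factorial : ℝ) * ‖c‖ ^ n * ((κ.im ^ 2)⁻¹) ^ (n + 1))
      (fun _ _ => by positivity) (Finset.mem_range.2 (by omega))

theorem hasTemperateGrowth_symbol (z : ℂ) (a : ℝ) :
    (fun ξ : E3 => z - ((a * ‖ξ‖ : ℝ) : ℂ) ^ 2).HasTemperateGrowth := by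
  have e : (fun ξ : E3 => z - ((a * ‖ξ‖ : ℝ) : ℂ) ^ 2) =
      fun ξ : E3 => z - (a : ℂ) ^ 2 * Complex.ofReal (‖ξ‖ ^ 2) := by
    funext ξ; push_cast; ring
  rw [e]
  exact (Function.HasTemperateGrowth.const z).sub ((Function.HasTemperateGrowth.const _).mul
    (Function.HasTemperateGrowth.comp
      Function.Complex.hasTemperateGrowth_ofReal (Function.hasTemperateGrowth_norm_sq E3)))

theorem norm_exp_I_mul_ofReal (t : ℝ) : ‖Complex.exp (Complex.I * (t : ℂ))‖ = 1 := by
  rw [mul_comm, Complex.norm_exp_ofReal_mul_I]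

/-- The Green's operator acts on superpositions of plane waves by the resolvent multiplier. -/
theorem greenPotential_superposition {κ : ℂ} (hκ : 0 < κ.im) (a : ℝ) {φ : E3 → ℂ}
    (hφ : Integrable φ) (x : E3) :
    greenPotential κ
      (fun y => ∫ ξ : E3, Complex.exp (Complex.I * ((a * inner ℝ ξ y : ℝ) : ℂ)) * φ ξ) x =
    ∫ ξ : E3, Complex.exp (Complex.I * ((a * inner ℝ ξ x : ℝ) : ℂ)) *
      ((κ ^ 2 - ((a * ‖ξ‖ : ℝ) : ℂ) ^ 2)⁻¹ * φ ξ) := by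
  set F : E3 → E3 → ℂ := fun y ξ =>
    greenFn κ ‖x - y‖ * (Complex.exp (Complex.I * ((a * inner ℝ ξ y : ℝ) : ℂ)) * φ ξ)
  have hG : Integrable (fun y : E3 => greenFn κ ‖x - y‖) :=
    (integrable_greenFn_norm hκ).comp_sub_left x
  have hF : Integrable (Function.uncurry F) (volume.prod volume) := by
    have h := (hG.mul_prod hφ).bdd_mul (c := 1)
      (f := fun p : E3 × E3 => Complex.exp (Complex.I * ((a * inner ℝ p.2 p.1 : ℝ) : ℂ)))
      (Continuous.aestronglyMeasurable (by fun_prop))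
      (Eventually.of_forall fun p => (norm_exp_I_mul_ofReal _).le)
    refine h.congr (Eventually.of_forall fun p => ?_)
    simp only [Function.uncurry, F]; ring
  calc _ = ∫ y, ∫ ξ, F y ξ := by
        simp only [greenPotential, F]
        refine integral_congr_ae (Eventually.of_forall fun y => ?_)
        simp only
        rw [← integral_const_mul]
    _ = ∫ ξ, ∫ y, F y ξ := integral_integral_swap hF
    _ = _ := by
        refine integral_congr_ae (Eventually.of_forall fun ξ => ?_)
        simp only
        have h1 := integral_exp_inner_mul_greenFn hκ (-(a • ξ))
        -- The plane wave at `y` factors into the one at `x` and one in the variable `x - y`; the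
        -- latter produces the Fourier transform of the Green's function.
        have e : ∀ y : E3, F y ξ = (fun z : E3 =>
            (Complex.exp (Complex.I * ((inner ℝ (-(a • ξ)) z : ℝ) : ℂ)) * greenFn κ ‖z‖) *
            (Complex.exp (Complex.I * ((a * inner ℝ ξ x : ℝ) : ℂ)) * φ ξ)) (x - y) := by
          intro y
          simp only [F]
          have e2 : Complex.exp (Complex.I * ((a * inner ℝ ξ y : ℝ) : ℂ)) =
              Complex.exp (Complex.I * ((inner ℝ (-(a • ξ)) (x - y) : ℝ) : ℂ)) *
              Complex.exp (Complex.I * ((a * inner ℝ ξ x : ℝ) : ℂ)) := by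
            rw [← Complex.exp_add, ← mul_add, ← Complex.ofReal_add]
            congr 3
            rw [inner_neg_left, real_inner_smul_left, inner_sub_right]; ring
          rw [e2]; ring
        simp_rw [e]
        rw [integral_sub_left_eq_self (fun z : E3 =>
            (Complex.exp (Complex.I * ((inner ℝ (-(a • ξ)) z : ℝ) : ℂ)) * greenFn κ ‖z‖) *
            (Complex.exp (Complex.I * ((a * inner ℝ ξ x : ℝ) : ℂ)) * φ ξ)) volume x,
          integral_mul_const, h1, norm_neg, norm_smul]
        have e3 : ((‖a‖ * ‖ξ‖ : ℝ) : ℂ) ^ 2 = ((a * ‖ξ‖ : ℝ) : ℂ) ^ 2 := by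
          norm_cast; rw [mul_pow, mul_pow, Real.norm_eq_abs, sq_abs]
        rw [e3, one_div]; ring

/-- The scale `a = -1` in `greenPotential_superposition` matches the normalization of `fourier3`,
while `a = 2π` matches that of `𝓕⁻`. -/
theorem greenPotential_fourier3 {κ : ℂ} (hκ : 0 < κ.im) {φ : E3 → ℂ} (hφ : Integrable φ) (x : E3) :
    greenPotential κ (fourier3 φ) x = fourier3 (fun K => (κ ^ 2 - (‖K‖ : ℂ) ^ 2)⁻¹ * φ K) x := by
  have h := greenPotential_superposition hκ (-1) hφ x
  have e : ∀ (y : E3) (g : E3 → ℂ), fourier3 g y = (((2 * Real.pi) ^ 3 : ℝ) : ℂ)⁻¹ *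
      ∫ ξ : E3, Complex.exp (Complex.I * ((-1 * inner ℝ ξ y : ℝ) : ℂ)) * g ξ := by
    intro y g
    rw [fourier3]
    congr 2; funext ξ; congr 2
    rw [real_inner_comm]; push_cast; ring
  have e1 : greenPotential κ (fourier3 φ) x = (((2 * Real.pi) ^ 3 : ℝ) : ℂ)⁻¹ *
      greenPotential κ (fun y => ∫ ξ : E3, Complex.exp
        (Complex.I * ((-1 * inner ℝ ξ y : ℝ) : ℂ)) * φ ξ) x := by
    simp only [greenPotential]
    rw [← integral_const_mul]
    congr 1; funext y; rw [e]; ring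
  rw [e1, h, e]
  congr 3; funext ξ
  simp

theorem greenPotential_fourierInv {κ : ℂ} (hκ : 0 < κ.im) (g : 𝓢(E3, ℂ)) (x : E3) :
    greenPotential κ (𝓕⁻ g : 𝓢(E3, ℂ)) x =
      (𝓕⁻ (SchwartzMap.smulLeftCLM ℂ
        (fun ξ : E3 => (κ ^ 2 - ((2 * Real.pi * ‖ξ‖ : ℝ) : ℂ) ^ 2)⁻¹) g) : 𝓢(E3, ℂ)) x := by
  have h := greenPotential_superposition hκ (2 * Real.pi) g.integrable x
  have e : ∀ (f : 𝓢(E3, ℂ)) (y : E3), (𝓕⁻ f : 𝓢(E3, ℂ)) y =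
      ∫ ξ : E3, Complex.exp (Complex.I * ((2 * Real.pi * inner ℝ ξ y : ℝ) : ℂ)) * f ξ := by
    intro f y
    rw [SchwartzMap.fourierInv_coe, Real.fourierInv_eq']
    congr 1; funext ξ; rw [smul_eq_mul, mul_comm Complex.I]
  have e1 : ((𝓕⁻ g : 𝓢(E3, ℂ)) : E3 → ℂ) = fun y => ∫ ξ : E3, Complex.exp
        (Complex.I * ((2 * Real.pi * inner ℝ ξ y : ℝ) : ℂ)) * g ξ := funext (e g)
  rw [e1, h, e]
  congr 1; funext ξ
  rw [SchwartzMap.smulLeftCLM_apply_apply (hasTemperateGrowth_resolvent hκ _), smul_eq_mul]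

/-- The Helmholtz operator `Δ + z` on Schwartz functions. -/
def helmholtz (z : ℂ) (χ : 𝓢(E3, ℂ)) : 𝓢(E3, ℂ) := Δ χ + z • χ

theorem helmholtz_apply (z : ℂ) (χ : 𝓢(E3, ℂ)) (x : E3) :
    helmholtz z χ x = (Δ χ : 𝓢(E3, ℂ)) x + z * χ x := rfl

theorem helmholtz_eq_fourierInv (z : ℂ) (χ : 𝓢(E3, ℂ)) :
    helmholtz z χ = 𝓕⁻ (SchwartzMap.smulLeftCLM ℂ
      (fun ξ : E3 => z - ((2 * Real.pi * ‖ξ‖ : ℝ) : ℂ) ^ 2) (𝓕 χ)) := by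
  have h1 : (𝓕 (helmholtz z χ) : 𝓢(E3, ℂ)) = SchwartzMap.smulLeftCLM ℂ
      (fun ξ : E3 => z - ((2 * Real.pi * ‖ξ‖ : ℝ) : ℂ) ^ 2) (𝓕 χ) := by
    rw [helmholtz, SchwartzMap.laplacian_eq_fourierMultiplierCLM,
      SchwartzMap.fourierMultiplierCLM_apply, FourierTransform.fourier_add,
      FourierTransform.fourier_smul, FourierTransform.fourier_smul,
      FourierTransform.fourier_fourierInv_eq]
    ext ξ
    rw [SchwartzMap.smulLeftCLM_apply_apply (hasTemperateGrowth_symbol z _)]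
    change -(2 * Real.pi) ^ 2 • (SchwartzMap.smulLeftCLM ℂ (fun x : E3 => ‖x‖ ^ 2) (𝓕 χ)) ξ
      + z • (𝓕 χ) ξ = _
    rw [SchwartzMap.smulLeftCLM_apply_apply (Function.hasTemperateGrowth_norm_sq E3)]
    simp only [smul_eq_mul, Complex.real_smul]
    push_cast; ring
  rw [← h1, FourierTransform.fourierInv_fourier_eq]

theorem greenPotential_helmholtz {κ : ℂ} (hκ : 0 < κ.im) (χ : 𝓢(E3, ℂ)) (x : E3) :
    greenPotential κ (helmholtz (κ ^ 2) χ) x = χ x := by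
  rw [helmholtz_eq_fourierInv, greenPotential_fourierInv hκ]
  have h : SchwartzMap.smulLeftCLM ℂ
      (fun ξ : E3 => (κ ^ 2 - ((2 * Real.pi * ‖ξ‖ : ℝ) : ℂ) ^ 2)⁻¹)
      (SchwartzMap.smulLeftCLM ℂ (fun ξ : E3 => κ ^ 2 - ((2 * Real.pi * ‖ξ‖ : ℝ) : ℂ) ^ 2)
        (𝓕 χ)) = 𝓕 χ := by
    ext ξ
    rw [SchwartzMap.smulLeftCLM_apply_apply (hasTemperateGrowth_resolvent hκ _),
      SchwartzMap.smulLeftCLM_apply_apply (hasTemperateGrowth_symbol _ _), smul_smul,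
      inv_mul_cancel₀ (sq_sub_sq_ofReal_ne_zero hκ _), one_smul]
  rw [h, FourierTransform.fourierInv_fourier_eq]

/-- Dividing the Fourier transform by the nowhere vanishing symbol stays inside Schwartz space. Thus
testing against images of the Helmholtz operator is as good as testing against all Schwartz
functions. -/
theorem exists_helmholtz_eq {κ : ℂ} (hκ : 0 < κ.im) (χ : 𝓢(E3, ℂ)) :
    ∃ χ' : 𝓢(E3, ℂ), helmholtz (κ ^ 2) χ' = χ := by
  refine ⟨𝓕⁻ (SchwartzMap.smulLeftCLM ℂ
      (fun ξ : E3 => (κ ^ 2 - ((2 * Real.pi * ‖ξ‖ : ℝ) : ℂ) ^ 2)⁻¹) (𝓕 χ)), ?_⟩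
  rw [helmholtz_eq_fourierInv, FourierTransform.fourier_fourierInv_eq]
  have h : SchwartzMap.smulLeftCLM ℂ
      (fun ξ : E3 => κ ^ 2 - ((2 * Real.pi * ‖ξ‖ : ℝ) : ℂ) ^ 2)
      (SchwartzMap.smulLeftCLM ℂ (fun ξ : E3 => (κ ^ 2 - ((2 * Real.pi * ‖ξ‖ : ℝ) : ℂ) ^ 2)⁻¹)
        (𝓕 χ)) = 𝓕 χ := by
    ext ξ
    rw [SchwartzMap.smulLeftCLM_apply_apply (hasTemperateGrowth_symbol _ _),
      SchwartzMap.smulLeftCLM_apply_apply (hasTemperateGrowth_resolvent hκ _), smul_smul,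
      mul_inv_cancel₀ (sq_sub_sq_ofReal_ne_zero hκ _), one_smul]
  rw [h, FourierTransform.fourierInv_fourier_eq]


/-! ### Weak solutions of the Helmholtz equation -/

theorem Continuous.eq_zero_of_integral_schwartz {u : E3 → ℂ} (hu : Continuous u)
    (h : ∀ χ : 𝓢(E3, ℂ), ∫ x, u x * χ x = 0) : u = 0 := by
  have h0 : ∀ᵐ x : E3, u x = 0 := by
    refine ae_eq_zero_of_integral_contDiff_smul_eq_zero hu.locallyIntegrable fun g hg hgs => ?_
    have hgs' : HasCompactSupport (fun x => (g x : ℂ)) := hgs.comp_left (g := fun t : ℝ => (t : ℂ)) rfl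
    have hg' : ContDiff ℝ ∞ (fun x => (g x : ℂ)) := Complex.ofRealCLM.contDiff.comp hg
    rw [← h (hgs'.toSchwartzMap hg')]
    congr 1; funext x
    rw [Complex.real_smul, mul_comm]; rfl
  exact Continuous.ae_eq_iff_eq volume hu continuous_zero |>.1 h0

theorem integrable_mul_schwartz {u : E3 → ℂ} (hu : AEStronglyMeasurable u) {M : ℝ}
    (hM : ∀ x, ‖u x‖ ≤ M) (χ : 𝓢(E3, ℂ)) : Integrable (fun x => u x * χ x) :=
  χ.integrable.bdd_mul hu (Eventually.of_forall hM)

theorem MeasureTheory.Integrable.mul_schwartz {g : E3 → ℂ} (hg : Integrable g) (χ : 𝓢(E3, ℂ)) :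
    Integrable (fun x => g x * χ x) :=
  hg.mul_bdd (c := SchwartzMap.seminorm ℝ 0 0 χ) χ.continuous.aestronglyMeasurable
    (Eventually.of_forall fun x => χ.norm_le_seminorm ℝ x)

theorem HasPotentialBound.aestronglyMeasurable_greenPotential {b C : ℝ} {g : E3 → ℂ}
    (h : HasPotentialBound b g C) (κ : ℂ) : AEStronglyMeasurable (greenPotential κ g) := by
  have hm : AEStronglyMeasurable (fun p : E3 × E3 => greenFn κ ‖p.1 - p.2‖ * g p.2)
      (volume.prod volume) :=
    (Measurable.aestronglyMeasurable (by fun_prop)).mul h.aestronglyMeasurable.comp_snd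
  exact hm.integral_prod_right'

/-- The equation `Δ u + z u = g` in the sense of tempered distributions. -/
def IsHelmholtzSolution (z : ℂ) (u g : E3 → ℂ) : Prop :=
  ∀ χ : 𝓢(E3, ℂ), ∫ x, u x * helmholtz z χ x = ∫ x, g x * χ x

theorem integral_mul_helmholtz {u : E3 → ℂ} (hu : AEStronglyMeasurable u) {M : ℝ}
    (hM : ∀ x, ‖u x‖ ≤ M) (z : ℂ) (χ : 𝓢(E3, ℂ)) :
    ∫ x, u x * helmholtz z χ x = (∫ x, u x * (Δ χ : 𝓢(E3, ℂ)) x) + z * ∫ x, u x * χ x := by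
  rw [← integral_const_mul, ← integral_add (integrable_mul_schwartz hu hM _)
    ((integrable_mul_schwartz hu hM χ).const_mul z)]
  congr 1; funext x
  rw [helmholtz_apply]; ring

/-- Symmetry moves the Green's operator onto the test function, where it inverts `Δ + κ²`. -/
theorem HasPotentialBound.isHelmholtzSolution {b C : ℝ} {g : E3 → ℂ}
    (h : HasPotentialBound b g C) {κ : ℂ} (hb : b ≤ κ.im) (hκ : 0 < κ.im) :
    IsHelmholtzSolution (κ ^ 2) (greenPotential κ g) g := by
  intro χ
  rw [h.integral_greenPotential_mul hb (helmholtz (κ ^ 2) χ).integrable]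
  simp_rw [greenPotential_helmholtz hκ]

/-- A bounded weak solution is recovered by the Green's function at any other wave number. -/
theorem IsHelmholtzSolution.eq_greenPotential {z : ℂ} {u g : E3 → ℂ} (h : IsHelmholtzSolution z u g)
    (hu : Continuous u) {M : ℝ} (hM : ∀ x, ‖u x‖ ≤ M) {b C : ℝ} (hg : HasPotentialBound b g C)
    {κ : ℂ} (hb : b ≤ κ.im) (hκ : 0 < κ.im) (hc : Continuous (greenPotential κ g)) (x : E3) :
    u x = greenPotential κ g x + (κ ^ 2 - z) * greenPotential κ u x := by
  obtain ⟨C', hC'⟩ := HasPotentialBound.of_bounded hκ hu.aestronglyMeasurable hM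
  have hcu := continuous_greenPotential_of_bounded hκ hu hM
  -- Both sides are continuous, so it suffices to test them. Writing the test function as `(Δ + κ²)
  -- χ'` turns each potential into its density paired with `χ'`, and the weak equation at `z`
  -- cancels what is left.
  have key : (fun x => u x - (greenPotential κ g x + (κ ^ 2 - z) * greenPotential κ u x)) = 0 := by
    refine Continuous.eq_zero_of_integral_schwartz (by fun_prop) fun χ => ?_
    obtain ⟨χ', rfl⟩ := exists_helmholtz_eq hκ χ
    set χ := helmholtz (κ ^ 2) χ' with hχ
    have e1 : ∫ x, greenPotential κ g x * χ x = ∫ x, g x * χ' x := by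
      rw [hg.integral_greenPotential_mul hb χ.integrable]
      simp_rw [hχ, greenPotential_helmholtz hκ]
    have e2 : ∫ x, greenPotential κ u x * χ x = ∫ x, u x * χ' x := by
      rw [hC'.integral_greenPotential_mul le_rfl χ.integrable]
      simp_rw [hχ, greenPotential_helmholtz hκ]
    have e3 := h χ'
    have e4 : ∫ x, u x * helmholtz z χ' x =
        (∫ x, u x * χ x) + (z - κ ^ 2) * ∫ x, u x * χ' x := by
      rw [hχ, integral_mul_helmholtz hu.aestronglyMeasurable hM,
        integral_mul_helmholtz hu.aestronglyMeasurable hM]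
      ring
    have i1 := integrable_mul_schwartz hu.aestronglyMeasurable hM χ
    have i2 := integrable_mul_schwartz hc.aestronglyMeasurable (hg.norm_greenPotential_le hb) χ
    have i3 := integrable_mul_schwartz hcu.aestronglyMeasurable
      (hC'.norm_greenPotential_le le_rfl) χ
    have e5 : ∀ x, (u x - (greenPotential κ g x + (κ ^ 2 - z) * greenPotential κ u x)) * χ x =
        u x * χ x - (greenPotential κ g x * χ x +
          (κ ^ 2 - z) * (greenPotential κ u x * χ x)) := fun x => by ring
    simp_rw [e5]
    have i4 := i3.const_mul (κ ^ 2 - z)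
    have i5 : Integrable (fun x => greenPotential κ g x * χ x +
      (κ ^ 2 - z) * (greenPotential κ u x * χ x)) := i2.add i4
    rw [integral_sub i1 i5, integral_add i2 i4, integral_const_mul, e1, e2, ← e3, e4]
    ring
  have := congrFun key x
  simpa [sub_eq_zero] using this

/-- The weak equation passes to the limit for a single test function. -/
theorem integral_mul_helmholtz_eq_of_tendsto {ι : Type*} {l : Filter ι} [l.NeBot]
    {u : ι → E3 → ℂ} {u₀ g : E3 → ℂ} {z : ι → ℂ} {z₀ : ℂ} {χ : 𝓢(E3, ℂ)}
    (hum : ∀ᶠ i in l, AEStronglyMeasurable (u i) ∧ ∃ M : ℝ, ∀ x, ‖u i x‖ ≤ M)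
    (hum₀ : AEStronglyMeasurable u₀) {M : ℝ} (hM : ∀ x, ‖u₀ x‖ ≤ M)
    (hz : Tendsto z l (𝓝 z₀))
    (heq : ∀ᶠ i in l, ∫ x, u i x * helmholtz (z i) χ x = ∫ x, g x * χ x)
    (h1 : Tendsto (fun i => ∫ x, u i x * (Δ χ : 𝓢(E3, ℂ)) x) l
      (𝓝 (∫ x, u₀ x * (Δ χ : 𝓢(E3, ℂ)) x)))
    (h2 : Tendsto (fun i => ∫ x, u i x * χ x) l (𝓝 (∫ x, u₀ x * χ x))) :
    ∫ x, u₀ x * helmholtz z₀ χ x = ∫ x, g x * χ x := by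
  rw [integral_mul_helmholtz hum₀ hM]
  refine tendsto_nhds_unique_of_eventuallyEq (h1.add (hz.mul h2)) tendsto_const_nhds ?_
  filter_upwards [hum, heq] with i hi hi'
  obtain ⟨hm, M', hM'⟩ := hi
  rw [← hi', integral_mul_helmholtz hm hM']

theorem norm_incidentWave (k r : E3) : ‖incidentWave k r‖ = 1 := norm_exp_I_mul_ofReal _

theorem continuous_incidentWave (k : E3) : Continuous (incidentWave k) := by
  unfold incidentWave; fun_prop

/-- Pairing with a plane wave evaluates the Fourier transform at one point, and the symbol `k² -
4π²‖ξ‖²` vanishes there. -/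
theorem isHelmholtzSolution_incidentWave (k : E3) :
    IsHelmholtzSolution ((‖k‖ : ℂ) ^ 2) (incidentWave k) 0 := by
  intro χ
  have h : ∀ f : 𝓢(E3, ℂ), (𝓕 f : 𝓢(E3, ℂ)) (-(2 * Real.pi)⁻¹ • k) = ∫ x, incidentWave k x * f x := by
    intro f
    rw [SchwartzMap.fourier_coe, Real.fourier_eq']
    congr 1; funext x
    rw [smul_eq_mul, incidentWave, mul_comm Complex.I]
    congr 4
    rw [real_inner_smul_right, real_inner_comm]
    have := Real.pi_pos.ne'
    field_simp
  rw [← h, helmholtz_eq_fourierInv, FourierTransform.fourier_fourierInv_eq,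
    SchwartzMap.smulLeftCLM_apply_apply (hasTemperateGrowth_symbol _ _)]
  have hn : 2 * Real.pi * ‖-(2 * Real.pi)⁻¹ • k‖ = ‖k‖ := by
    rw [norm_smul, norm_neg, Real.norm_of_nonneg (by positivity)]
    have := Real.pi_pos.ne'
    field_simp
  rw [hn]
  simp

/-! ### Reduction to compactly supported test functions -/

theorem norm_laplacian_le (χ : 𝓢(E3, ℂ)) (x : E3) :
    ‖(Δ χ : 𝓢(E3, ℂ)) x‖ ≤ 3 * ‖iteratedFDeriv ℝ 2 χ x‖ := by
  rw [SchwartzMap.laplacian_apply,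
    InnerProductSpace.laplacian_eq_iteratedFDeriv_orthonormalBasis χ (EuclideanSpace.basisFun (Fin 3) ℝ)]
  refine (norm_sum_le _ _).trans ?_
  have h : ∀ i : Fin 3, ‖iteratedFDeriv ℝ 2 χ x ![EuclideanSpace.basisFun (Fin 3) ℝ i,
      EuclideanSpace.basisFun (Fin 3) ℝ i]‖ ≤ ‖iteratedFDeriv ℝ 2 χ x‖ := by
    intro i
    refine (ContinuousMultilinearMap.le_opNorm _ _).trans ?_
    rw [Fin.prod_univ_two]
    simp
  refine (Finset.sum_le_sum fun i _ => h i).trans ?_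
  simp

/-- The cutoffs are one bump function evaluated at `x / (n + 1)`. This rescaling is a contraction,
so the derivative bounds are uniform in `n`. -/
theorem exists_cutoff : ∃ (θ : ℕ → E3 → ℂ) (B : ℝ), (∀ n, ContDiff ℝ ∞ (θ n)) ∧
    (∀ n, HasCompactSupport (θ n)) ∧ (∀ (n : ℕ) (x : E3), ‖x‖ ≤ n → θ n x = 1) ∧
    ∀ i ≤ 2, ∀ n x, ‖iteratedFDeriv ℝ i (θ n) x‖ ≤ B := by
  let β : ContDiffBump (0 : E3) := ⟨1, 2, one_pos, one_lt_two⟩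
  set β' : E3 → ℂ := fun x => (β x : ℂ)
  have hβ : ContDiff ℝ ∞ β' := Complex.ofRealCLM.contDiff.comp β.contDiff
  have hβs : HasCompactSupport β' :=
    β.hasCompactSupport.comp_left (g := fun t : ℝ => (t : ℂ)) rfl
  have hb : ∀ i : ℕ, ∃ B, ∀ x, ‖iteratedFDeriv ℝ i β' x‖ ≤ B := fun i =>
    (hβs.iteratedFDeriv i).exists_bound_of_continuous (hβ.continuous_iteratedFDeriv (by exact_mod_cast le_top))
  choose B hB using hb
  let L : ℕ → E3 →L[ℝ] E3 := fun n => ((n : ℝ) + 1)⁻¹ • ContinuousLinearMap.id ℝ E3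
  have hL : ∀ n, ‖L n‖ ≤ 1 := by
    intro n
    simp only [L]
    rw [norm_smul, Real.norm_of_nonneg (by positivity)]
    refine mul_le_one₀ (inv_le_one_of_one_le₀ (by linarith [(Nat.cast_nonneg n : (0 : ℝ) ≤ n)]))
      (norm_nonneg _) ContinuousLinearMap.norm_id_le
  refine ⟨fun n => β' ∘ L n, max (max (B 0) (B 1)) (B 2), fun n => hβ.comp (L n).contDiff,
    fun n => ?_, fun n x hx => ?_, fun i hi n x => ?_⟩
  · have h0 : ((n : ℝ) + 1)⁻¹ ≠ 0 := by positivity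
    exact hβs.comp_homeomorph (Homeomorph.smulOfNeZero _ h0)
  · have h1 : β (L n x) = 1 := by
      refine β.one_of_mem_closedBall ?_
      rw [mem_closedBall_zero_iff]
      change ‖((n : ℝ) + 1)⁻¹ • x‖ ≤ 1
      rw [norm_smul, Real.norm_of_nonneg (by positivity), inv_mul_le_iff₀ (by positivity)]
      linarith
    simp [β', h1]
  · rw [(L n).iteratedFDeriv_comp_right hβ x (by exact_mod_cast le_top)]
    refine (ContinuousMultilinearMap.norm_compContinuousLinearMap_le _ _).trans ?_
    have h1 : ∏ _j : Fin i, ‖L n‖ ≤ 1 := Finset.prod_le_one (fun _ _ => norm_nonneg _) fun _ _ => hL n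
    have h2 := hB i (L n x)
    have h3 : B i ≤ max (max (B 0) (B 1)) (B 2) := by interval_cases i <;> simp
    exact (mul_le_of_le_one_right (norm_nonneg _) h1).trans (h2.trans h3)

/-- The homogeneous equation is only a locally uniform limit, so it can be tested directly only on
compact sets. The general test function is reached by cutoffs, with the uniform derivative bounds
allowing dominated convergence. -/
theorem IsHelmholtzSolution.of_hasCompactSupport {z : ℂ} {u g : E3 → ℂ}
    (hu : AEStronglyMeasurable u) {M : ℝ} (hM : ∀ x, ‖u x‖ ≤ M)
    (hg : ∀ χ : 𝓢(E3, ℂ), Integrable (fun x => g x * χ x))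
    (h : ∀ χ : 𝓢(E3, ℂ), HasCompactSupport χ →
      ∫ x, u x * helmholtz z χ x = ∫ x, g x * χ x) : IsHelmholtzSolution z u g := by
  intro χ
  obtain ⟨θ, B, hθ, hθs, hθ1, hθB⟩ := exists_cutoff
  have hcs : ∀ n, HasCompactSupport (fun x => θ n x * χ x) := fun n => (hθs n).mul_right
  have hcd : ∀ n, ContDiff ℝ ∞ (fun x => θ n x * χ x) := fun n => (hθ n).mul (χ.smooth ⊤)
  set χn : ℕ → 𝓢(E3, ℂ) := fun n => (hcs n).toSchwartzMap (hcd n)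
  have hχn : ∀ n x, χn n x = θ n x * χ x := fun n x => rfl
  have hev : ∀ x, ∀ᶠ n in atTop, ((χn n : E3 → ℂ) =ᶠ[𝓝 x] χ) := by
    intro x
    obtain ⟨N, hN⟩ := exists_nat_gt (‖x‖)
    filter_upwards [eventually_ge_atTop N] with n hn
    have hlt : ‖x‖ < n := hN.trans_le (by exact_mod_cast hn)
    filter_upwards [(continuous_norm.continuousAt (x := x)).eventually_lt continuousAt_const hlt]
      with y hy
    rw [hχn, hθ1 n y hy.le, one_mul]
  have hθn : ∀ n x, ‖θ n x‖ ≤ B := fun n x => by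
    simpa using hθB 0 (by norm_num) n x
  have hB0 : 0 ≤ B := (norm_nonneg _).trans (hθn 0 0)
  -- The Leibniz rule bounds the second derivative of the product by the sum, and the factor 3 is
  -- the number of terms in the Laplacian.
  set bd : E3 → ℝ := fun x => 3 * ∑ i ∈ Finset.range 3, (Nat.choose 2 i : ℝ) * B *
    ‖iteratedFDeriv ℝ (2 - i) χ x‖
  have hbd : ∀ n x, ‖(Δ (χn n) : 𝓢(E3, ℂ)) x‖ ≤ bd x := by
    intro n x
    refine (norm_laplacian_le _ x).trans ?_
    refine mul_le_mul_of_nonneg_left ?_ (by norm_num)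
    refine (norm_iteratedFDeriv_mul_le (N := ∞) (n := 2) (hθ n) (χ.smooth ⊤) x
      (by exact WithTop.coe_le_coe.2 le_top)).trans ?_
    refine Finset.sum_le_sum fun i hi => ?_
    have hi' : i ≤ 2 := by have := Finset.mem_range.1 hi; omega
    have := hθB i hi' n x
    gcongr
  have hbdi : Integrable bd := by
    refine Integrable.const_mul (integrable_finsetSum _ fun i _ => Integrable.const_mul ?_ _) 3
    simpa using χ.integrable_pow_mul_iteratedFDeriv (μ := volume) 0 (2 - i)
  have hlim1 : Tendsto (fun n => ∫ x, u x * helmholtz z (χn n) x) atTop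
      (𝓝 (∫ x, u x * helmholtz z χ x)) := by
    refine tendsto_integral_of_dominated_convergence
      (fun x => M * (bd x + ‖z‖ * (B * ‖χ x‖))) (fun n => ?_)
      ((hbdi.add ((χ.integrable.norm.const_mul B).const_mul ‖z‖)).const_mul M) (fun n => ?_) ?_
    · exact hu.mul (helmholtz z (χn n)).continuous.aestronglyMeasurable
    · refine Eventually.of_forall fun x => ?_
      rw [norm_mul]
      refine mul_le_mul (hM x) ?_ (norm_nonneg _) ((norm_nonneg _).trans (hM x))
      rw [helmholtz_apply]
      refine (norm_add_le _ _).trans (add_le_add (hbd n x) ?_)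
      rw [norm_mul, hχn, norm_mul]
      exact mul_le_mul_of_nonneg_left (mul_le_mul_of_nonneg_right (hθn n x) (norm_nonneg _))
        (norm_nonneg _)
    · refine Eventually.of_forall fun x => ?_
      refine tendsto_const_nhds.congr' ?_
      filter_upwards [hev x] with n hn
      rw [helmholtz_apply, helmholtz_apply, hn.self_of_nhds, SchwartzMap.laplacian_apply,
        SchwartzMap.laplacian_apply, (InnerProductSpace.laplacian_congr_nhds hn).self_of_nhds]
  have hlim2 : Tendsto (fun n => ∫ x, g x * χn n x) atTop (𝓝 (∫ x, g x * χ x)) := by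
    refine tendsto_integral_of_dominated_convergence (fun x => B * ‖g x * χ x‖) (fun n => ?_)
      ((hg χ).norm.const_mul B) (fun n => ?_) ?_
    · exact (hg (χn n)).aestronglyMeasurable
    · refine Eventually.of_forall fun x => ?_
      rw [hχn, mul_left_comm, norm_mul]
      exact mul_le_mul_of_nonneg_right (hθn n x) (norm_nonneg _)
    · refine Eventually.of_forall fun x => ?_
      refine tendsto_const_nhds.congr' ?_
      filter_upwards [hev x] with n hn
      rw [hn.self_of_nhds]
  refine tendsto_nhds_unique hlim1 (hlim2.congr fun n => (h (χn n) (hcs n)).symm)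

/-! ### Dependence on the wave number -/

theorem tendsto_greenPotential {b C : ℝ} {g : E3 → ℂ} (hg : HasPotentialBound b g C)
    {ι : Type*} {l : Filter ι} [l.IsCountablyGenerated] {κ : ι → ℂ} {κ₀ : ℂ}
    (hκ : Tendsto κ l (𝓝 κ₀)) (hb : ∀ᶠ i in l, b ≤ (κ i).im) (x : E3) :
    Tendsto (fun i => greenPotential (κ i) g x) l (𝓝 (greenPotential κ₀ g x)) := by
  refine tendsto_integral_filter_of_dominated_convergence _
    (Eventually.of_forall fun i => aestronglyMeasurable_greenFn_mul hg.aestronglyMeasurable _ _)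
    (hb.mono fun i hi => Eventually.of_forall fun y => HasPotentialBound.norm_greenFn_mul_le hi x y)
    ((hg.integrable x).const_mul _) (Eventually.of_forall fun y => ?_)
  have hc : Continuous (fun κ : ℂ => greenFn κ ‖x - y‖ * g y) := by unfold greenFn; fun_prop
  exact (hc.tendsto κ₀).comp hκ

theorem tendsto_integral_greenPotential_mul {b C : ℝ} {g : E3 → ℂ} (hg : HasPotentialBound b g C)
    {ι : Type*} {l : Filter ι} [l.IsCountablyGenerated] {κ : ι → ℂ} {κ₀ : ℂ}
    (hκ : Tendsto κ l (𝓝 κ₀)) (hb : ∀ᶠ i in l, b ≤ (κ i).im) {χ : E3 → ℂ} (hχ : Integrable χ) :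
    Tendsto (fun i => ∫ x, greenPotential (κ i) g x * χ x) l
      (𝓝 (∫ x, greenPotential κ₀ g x * χ x)) := by
  refine tendsto_integral_filter_of_dominated_convergence (fun x => C / (4 * Real.pi) * ‖χ x‖)
    (Eventually.of_forall fun i => (hg.aestronglyMeasurable_greenPotential _).mul
      hχ.aestronglyMeasurable)
    (hb.mono fun i hi => Eventually.of_forall fun x => ?_) (hχ.norm.const_mul _)
    (Eventually.of_forall fun x => (tendsto_greenPotential hg hκ hb x).mul_const _)
  rw [norm_mul]
  exact mul_le_mul_of_nonneg_right (hg.norm_greenPotential_le hi x) (norm_nonneg _)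

theorem tendsto_add_I_mul (κ : ℂ) :
    Tendsto (fun ε : ℝ => κ + Complex.I * (ε : ℂ)) (𝓝[>] 0) (𝓝 κ) := by
  have : Tendsto (fun ε : ℝ => κ + Complex.I * (ε : ℂ)) (𝓝 0) (𝓝 (κ + Complex.I * ((0 : ℝ) : ℂ))) :=
    (by fun_prop : Continuous fun ε : ℝ => κ + Complex.I * (ε : ℂ)).tendsto 0
  simpa using this.mono_left nhdsWithin_le_nhds

/-- This is limiting absorption: the equation holds at `κ + iε`, and the bound with `b = 0`
dominates all these potentials down to real `κ`. -/
theorem HasPotentialBound.isHelmholtzSolution_of_nonneg {C : ℝ} {g : E3 → ℂ}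
    (h : HasPotentialBound 0 g C) {κ : ℂ} (hκ : 0 ≤ κ.im) :
    IsHelmholtzSolution (κ ^ 2) (greenPotential κ g) g := by
  intro χ
  have him : ∀ᶠ ε : ℝ in 𝓝[>] 0, 0 < (κ + Complex.I * (ε : ℂ)).im := by
    filter_upwards [self_mem_nhdsWithin] with ε hε
    simpa using add_pos_of_nonneg_of_pos hκ hε
  refine integral_mul_helmholtz_eq_of_tendsto (l := 𝓝[>] (0 : ℝ))
    (u := fun ε : ℝ => greenPotential (κ + Complex.I * (ε : ℂ)) g)
    (z := fun ε : ℝ => (κ + Complex.I * (ε : ℂ)) ^ 2) ?_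
    (h.aestronglyMeasurable_greenPotential κ) (h.norm_greenPotential_le hκ)
    ((tendsto_add_I_mul κ).pow 2) ?_
    (tendsto_integral_greenPotential_mul h (tendsto_add_I_mul κ) (him.mono fun _ => le_of_lt)
      (SchwartzMap.integrable _))
    (tendsto_integral_greenPotential_mul h (tendsto_add_I_mul κ) (him.mono fun _ => le_of_lt)
      χ.integrable)
  · exact him.mono fun ε hε => ⟨h.aestronglyMeasurable_greenPotential _,
      ⟨_, h.norm_greenPotential_le hε.le⟩⟩
  · exact him.mono fun ε hε => h.isHelmholtzSolution hε.le hε χ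


/-! ### The gradient of the Green's function -/

/-- The gradient of `z ↦ G_κ(|z|)`. -/
def greenGrad (κ : ℂ) (z : E3) : E3 →L[ℝ] ℂ :=
  ((Complex.I * κ - (‖z‖⁻¹ : ℝ)) * greenFn κ ‖z‖ * (‖z‖⁻¹ : ℝ)) •
    (Complex.ofRealCLM.comp (innerSL ℝ z))

theorem greenGrad_apply (κ : ℂ) (z h : E3) : greenGrad κ z h =
    (Complex.I * κ - (‖z‖⁻¹ : ℝ)) * greenFn κ ‖z‖ * (‖z‖⁻¹ : ℝ) * (inner ℝ z h : ℝ) := rfl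

theorem hasDerivAt_greenFn (κ : ℂ) {ρ : ℝ} (hρ : ρ ≠ 0) :
    HasDerivAt (greenFn κ) ((Complex.I * κ - (ρ⁻¹ : ℝ)) * greenFn κ ρ) ρ := by
  have hρ' : (ρ : ℂ) ≠ 0 := by exact_mod_cast hρ
  have hpi : (Real.pi : ℂ) ≠ 0 := by exact_mod_cast Real.pi_pos.ne'
  have h1 : HasDerivAt (fun ρ : ℝ => (ρ : ℂ)) 1 ρ := (hasDerivAt_id ρ).ofReal_comp
  have h2 := ((h1.const_mul (Complex.I * κ)).cexp.neg).fun_div (h1.const_mul (4 * (Real.pi : ℂ)))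
    (by simp [hρ', hpi])
  refine h2.congr_deriv ?_
  rw [greenFn]
  push_cast
  simp only [Pi.neg_apply]
  field_simp
  ring

theorem hasFDerivAt_greenFn_norm (κ : ℂ) {z : E3} (hz : z ≠ 0) :
    HasFDerivAt (fun z : E3 => greenFn κ ‖z‖) (greenGrad κ z) z := by
  have hn : ‖z‖ ≠ 0 := norm_ne_zero_iff.2 hz
  have h1 : HasFDerivAt (fun z : E3 => ‖z‖) (‖z‖⁻¹ • innerSL ℝ z) z := by
    have h := (hasStrictFDerivAt_norm_sq z).hasFDerivAt.sqrt
      (by simpa using hz)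
    refine (h.congr_of_eventuallyEq (Eventually.of_forall fun y => ?_)).congr_fderiv ?_
    · simp [Real.sqrt_sq (norm_nonneg y)]
    · ext y
      simp [Real.sqrt_sq (norm_nonneg z)]
      field_simp
  have h2 := (hasDerivAt_greenFn κ hn).hasFDerivAt.comp z h1
  refine h2.congr_fderiv ?_
  ext y
  rw [greenGrad_apply]
  simp
  ring

theorem norm_greenGrad_le {κ : ℂ} (hκ : 0 ≤ κ.im) (z : E3) :
    ‖greenGrad κ z‖ ≤ ‖κ‖ * ‖z‖⁻¹ + (‖z‖ ^ 2)⁻¹ := by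
  refine ContinuousLinearMap.opNorm_le_bound _ (by positivity) fun h => ?_
  rw [greenGrad_apply, norm_mul, norm_mul, norm_mul, Complex.norm_real, Complex.norm_real,
    norm_inv, norm_norm]
  rcases eq_or_ne z 0 with rfl | hz
  · simp
  have hn : 0 < ‖z‖ := norm_pos_iff.2 hz
  have h1 : ‖Complex.I * κ - ((‖z‖⁻¹ : ℝ) : ℂ)‖ ≤ ‖κ‖ + ‖z‖⁻¹ := by
    refine (norm_sub_le _ _).trans ?_
    rw [norm_mul, Complex.norm_I, one_mul, Complex.norm_real, norm_inv, norm_norm]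
  have h2 : ‖greenFn κ ‖z‖‖ ≤ ‖z‖⁻¹ := by
    refine (norm_greenFn_le hκ hn.le).trans ?_
    rw [one_div]
    exact inv_anti₀ hn (le_mul_of_one_le_left hn.le (by linarith [Real.pi_gt_three]))
  have h3 : ‖inner ℝ z h‖ ≤ ‖z‖ * ‖h‖ := norm_inner_le_norm z h
  calc _ ≤ (‖κ‖ + ‖z‖⁻¹) * ‖z‖⁻¹ * ‖z‖⁻¹ * (‖z‖ * ‖h‖) := by gcongr
    _ = _ := by field_simp

theorem measurable_greenGrad (κ : ℂ) : Measurable (greenGrad κ) := by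
  have h : Continuous fun z : E3 => Complex.ofRealCLM.comp (innerSL ℝ z) := by fun_prop
  have h' : Measurable fun z : E3 =>
      (Complex.I * κ - (‖z‖⁻¹ : ℝ)) * greenFn κ ‖z‖ * ((‖z‖⁻¹ : ℝ) : ℂ) := by fun_prop
  exact h'.smul h.measurable

/-! ### Weakly singular kernels on balls -/

/-- Polar coordinates leave `∫ t ^ (2 - j)` over `(0, a)`, estimated crudely by `a ^ (3 - j)`; the
constant is the area of the unit sphere. -/
theorem exists_integral_norm_pow_inv_le : ∃ c : ℝ, 0 ≤ c ∧ ∀ (x : E3) (a : ℝ), 0 < a →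
    ∀ j : ℕ, j ≤ 2 → IntegrableOn (fun y : E3 => (‖x - y‖ ^ j)⁻¹) (Metric.ball x a) ∧
      ∫ y in Metric.ball x a, (‖x - y‖ ^ j)⁻¹ ≤ c * a ^ (3 - j) := by
  refine ⟨3 * volume.real (Metric.ball (0 : E3) 1), by positivity, fun x a ha j hj => ?_⟩
  set φ : ℝ → ℝ := (Set.Iio a).indicator fun t => (t ^ j)⁻¹
  have hφ : ∀ y : E3, (Metric.ball x a).indicator (fun y : E3 => (‖x - y‖ ^ j)⁻¹) y =
      (fun z : E3 => φ ‖z‖) (x - y) := by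
    intro y
    have : y ∈ Metric.ball x a ↔ ‖x - y‖ ∈ Set.Iio a := by
      rw [Metric.mem_ball, dist_comm, dist_eq_norm, Set.mem_Iio]
    by_cases hy : y ∈ Metric.ball x a
    · simp only [φ]
      rw [Set.indicator_of_mem hy, Set.indicator_of_mem (this.1 hy)]
    · simp only [φ]
      rw [Set.indicator_of_notMem hy, Set.indicator_of_notMem (fun h => hy (this.2 h))]
  have he : ∀ t ∈ Set.Ioi (0 : ℝ), t ^ (3 - 1) • φ t =
      (Set.Iio a).indicator (fun t => t ^ (2 - j)) t := by
    intro t ht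
    by_cases hta : t ∈ Set.Iio a
    · simp only [φ]
      rw [Set.indicator_of_mem hta, Set.indicator_of_mem hta, smul_eq_mul,
        pow_sub₀ t (Set.mem_Ioi.1 ht).ne' hj]
    · simp only [φ]
      rw [Set.indicator_of_notMem hta, Set.indicator_of_notMem hta, smul_zero]
  have hle : ∀ t ∈ Set.Ioi (0 : ℝ), ‖(Set.Iio a).indicator (fun t => t ^ (2 - j)) t‖ ≤
      (Set.Iio a).indicator (fun _ => a ^ (2 - j)) t := by
    intro t ht
    by_cases hta : t ∈ Set.Iio a
    · rw [Set.indicator_of_mem hta, Set.indicator_of_mem hta, Real.norm_of_nonneg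
        (pow_nonneg (Set.mem_Ioi.1 ht).le _)]
      exact pow_le_pow_left₀ (Set.mem_Ioi.1 ht).le (Set.mem_Iio.1 hta).le _
    · rw [Set.indicator_of_notMem hta, Set.indicator_of_notMem hta, norm_zero]
  have hci : IntegrableOn ((Set.Iio a).indicator (fun _ => a ^ (2 - j))) (Set.Ioi (0 : ℝ)) := by
    rw [integrableOn_indicator_iff measurableSet_Iio]
    exact integrableOn_const (by rw [Set.Iio_inter_Ioi]; simp)
  have hi1 : IntegrableOn ((Set.Iio a).indicator (fun t => t ^ (2 - j))) (Set.Ioi (0 : ℝ)) := by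
    refine Integrable.mono' hci (Measurable.aestronglyMeasurable
      ((by fun_prop : Measurable fun t : ℝ => t ^ (2 - j)).indicator measurableSet_Iio)) ?_
    filter_upwards [ae_restrict_mem measurableSet_Ioi] with t ht using hle t ht
  have hi2 : Integrable (fun z : E3 => φ ‖z‖) := by
    rw [integrable_fun_norm_addHaar volume (f := φ), finrank_E3]
    exact hi1.congr_fun (fun t ht => (he t ht).symm) measurableSet_Ioi
  constructor
  · rw [← integrable_indicator_iff Metric.isOpen_ball.measurableSet, funext hφ]
    exact hi2.comp_sub_left x
  · rw [← integral_indicator Metric.isOpen_ball.measurableSet, funext hφ,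
      integral_sub_left_eq_self (fun z : E3 => φ ‖z‖) volume x, integral_fun_norm_addHaar,
      finrank_E3, setIntegral_congr_fun measurableSet_Ioi he, nsmul_eq_mul, smul_eq_mul, ← mul_assoc]
    refine mul_le_mul_of_nonneg_left ?_ (by positivity)
    calc ∫ t in Set.Ioi (0 : ℝ), (Set.Iio a).indicator (fun t => t ^ (2 - j)) t
        ≤ ∫ t in Set.Ioi (0 : ℝ), (Set.Iio a).indicator (fun _ => a ^ (2 - j)) t :=
          setIntegral_mono_on hi1 hci measurableSet_Ioi fun t ht =>
            (le_abs_self _).trans (hle t ht)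
      _ = a ^ (3 - j) := by
          rw [setIntegral_indicator measurableSet_Iio, setIntegral_const, Set.Ioi_inter_Iio]
          simp only [Real.volume_real_Ioo, sub_zero, smul_eq_mul, max_eq_left ha.le]
          rw [← pow_succ']; congr 1; omega

theorem integrable_norm_pow_inv_mul {f : E3 → ℂ} (hf : Integrable f) {x : E3} {r M : ℝ} (hr : 0 < r)
    (hM : ∀ y ∈ Metric.ball x r, ‖f y‖ ≤ M) {j : ℕ} (hj : j ≤ 2) :
    Integrable (fun y => (‖x - y‖ ^ j)⁻¹ * ‖f y‖) := by
  obtain ⟨c, -, hc⟩ := exists_integral_norm_pow_inv_le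
  have hm : AEStronglyMeasurable (fun y => (‖x - y‖ ^ j)⁻¹ * ‖f y‖) :=
    (Measurable.aestronglyMeasurable (by fun_prop)).mul hf.aestronglyMeasurable.norm
  rw [← integrableOn_univ, ← Set.union_compl_self (Metric.ball x r)]
  refine IntegrableOn.union ?_ ?_
  · refine Integrable.mono' ((hc x r hr j hj).1.mul_const M) hm.restrict ?_
    filter_upwards [ae_restrict_mem Metric.isOpen_ball.measurableSet] with y hy
    rw [Real.norm_of_nonneg (by positivity)]
    exact mul_le_mul_of_nonneg_left (hM y hy) (by positivity)
  · refine Integrable.mono' (hf.norm.const_mul (r ^ j)⁻¹).integrableOn hm.restrict ?_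
    filter_upwards [ae_restrict_mem Metric.isOpen_ball.measurableSet.compl] with y hy
    rw [Real.norm_of_nonneg (by positivity)]
    have h2 : r ≤ ‖x - y‖ := by rw [← dist_eq_norm, dist_comm]; simpa using hy
    exact mul_le_mul_of_nonneg_right (inv_anti₀ (pow_pos hr j) (pow_le_pow_left₀ hr.le h2 j))
      (norm_nonneg _)

/-! ### Differentiability of potentials -/

/-- The quotient of the increment, away from the singularity. -/
theorem norm_greenFn_increment_le {κ : ℂ} (hκ : 0 ≤ κ.im) {z h : E3} (hz : z ≠ 0)
    (hh : 2 * ‖h‖ ≤ ‖z‖) : ‖greenFn κ ‖z + h‖ - greenFn κ ‖z‖‖ ≤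
      (2 * (‖κ‖ * ‖z‖⁻¹) + 4 * (‖z‖ ^ 2)⁻¹) * ‖h‖ := by
  have hzp : 0 < ‖z‖ := norm_pos_iff.2 hz
  -- The whole segment keeps distance `‖z‖ / 2` from the singularity, so the mean value inequality
  -- applies with a gradient bound in terms of `‖z‖`.
  have hlow : ∀ w ∈ segment ℝ z (z + h), ‖z‖ / 2 ≤ ‖w‖ := by
    intro w hw
    have h1 : ‖w - z‖ ≤ ‖h‖ := by
      rw [segment_eq_image'] at hw
      obtain ⟨θ, hθ, rfl⟩ := hw
      simp only [add_sub_cancel_left, norm_smul, Real.norm_of_nonneg hθ.1]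
      exact mul_le_of_le_one_left (norm_nonneg _) hθ.2
    have h2 : ‖z‖ - ‖w‖ ≤ ‖w - z‖ := by rw [norm_sub_rev]; exact norm_sub_norm_le z w
    linarith
  have hne : ∀ w ∈ segment ℝ z (z + h), w ≠ 0 := fun w hw h0 => by
    have := hlow w hw
    rw [h0, norm_zero] at this; linarith
  have h := (convex_segment z (z + h)).norm_image_sub_le_of_norm_hasFDerivWithin_le
    (f := fun z : E3 => greenFn κ ‖z‖) (f' := greenGrad κ)
    (C := 2 * (‖κ‖ * ‖z‖⁻¹) + 4 * (‖z‖ ^ 2)⁻¹)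
    (fun w hw => (hasFDerivAt_greenFn_norm κ (hne w hw)).hasFDerivWithinAt) (fun w hw => ?_)
    (left_mem_segment ℝ z (z + h)) (right_mem_segment ℝ z (z + h))
  · simpa using h
  · refine (norm_greenGrad_le hκ w).trans ?_
    have hw := hlow w hw
    have e1 : ‖w‖⁻¹ ≤ 2 * ‖z‖⁻¹ := by
      refine (inv_anti₀ (by positivity) hw).trans (le_of_eq ?_)
      field_simp
    have e2 : (‖w‖ ^ 2)⁻¹ ≤ 4 * (‖z‖ ^ 2)⁻¹ := by
      rw [← inv_pow, ← inv_pow]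
      calc ‖w‖⁻¹ ^ 2 ≤ (2 * ‖z‖⁻¹) ^ 2 := pow_le_pow_left₀ (by positivity) e1 2
        _ = _ := by ring
    calc ‖κ‖ * ‖w‖⁻¹ + (‖w‖ ^ 2)⁻¹ ≤ ‖κ‖ * (2 * ‖z‖⁻¹) + 4 * (‖z‖ ^ 2)⁻¹ := by gcongr
      _ = _ := by ring

/-- The kernel at `x` has a moving singularity, which no single integrable function dominates in the
difference quotient. Its part over the ball of radius `2 ‖x - x₀‖` about `x₀` is therefore split off
as `D₁`; local boundedness of `f` makes it `O(‖x - x₀‖²)`. What remains is singular only at `x₀` and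
is handled by dominated convergence. -/
theorem hasFDerivAt_greenPotential {κ : ℂ} (hκ : 0 ≤ κ.im) {f : E3 → ℂ} (hf : Integrable f)
    {C : ℝ} (hC : HasPotentialBound 0 f C) {x₀ : E3} {r M : ℝ} (hr : 0 < r)
    (hM : ∀ y ∈ Metric.ball x₀ r, ‖f y‖ ≤ M) :
    Integrable (fun y => f y • greenGrad κ (x₀ - y)) ∧
    HasFDerivAt (greenPotential κ f) (∫ y, f y • greenGrad κ (x₀ - y)) x₀ := by
  have hi1 := integrable_norm_pow_inv_mul hf hr hM (j := 1) (by norm_num)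
  have hi2 := integrable_norm_pow_inv_mul hf hr hM (j := 2) le_rfl
  -- Outside the moving ball the increment contributes 2 and 4 and the gradient term contributes 1
  -- and 1 to the two coefficients; inside it the bound is smaller.
  set bd : E3 → ℝ := fun y => (3 * ‖κ‖) * ((‖x₀ - y‖ ^ 1)⁻¹ * ‖f y‖) +
    5 * ((‖x₀ - y‖ ^ 2)⁻¹ * ‖f y‖)
  have hbd : Integrable bd := (hi1.const_mul _).add (hi2.const_mul _)
  have hgm : AEStronglyMeasurable (fun y => f y • greenGrad κ (x₀ - y)) :=
    hf.aestronglyMeasurable.smul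
      ((measurable_greenGrad κ).comp (measurable_const.sub measurable_id)).aestronglyMeasurable
  have hgle : ∀ y, ‖f y • greenGrad κ (x₀ - y)‖ ≤
      ‖κ‖ * ((‖x₀ - y‖ ^ 1)⁻¹ * ‖f y‖) + (‖x₀ - y‖ ^ 2)⁻¹ * ‖f y‖ := by
    intro y
    rw [norm_smul, mul_comm]
    refine (mul_le_mul_of_nonneg_right (norm_greenGrad_le hκ _) (norm_nonneg _)).trans
      (le_of_eq ?_)
    rw [pow_one]; ring
  have hgi : Integrable (fun y => f y • greenGrad κ (x₀ - y)) :=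
    ((hi1.const_mul ‖κ‖).add hi2).mono' hgm (Eventually.of_forall hgle)
  refine ⟨hgi, ?_⟩
  have hNi : ∀ x, Integrable (fun y => greenFn κ ‖x - y‖ * f y) := hC.integrable_greenFn_mul hκ
  set D : E3 → E3 → ℂ := fun x y => greenFn κ ‖x - y‖ * f y - greenFn κ ‖x₀ - y‖ * f y -
    f y * greenGrad κ (x₀ - y) (x - x₀)
  have hgi' : ∀ h : E3, Integrable (fun y => f y * greenGrad κ (x₀ - y) h) := fun h =>
    (ContinuousLinearMap.apply ℝ ℂ h).integrable_comp hgi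
  have hDi : ∀ x, Integrable (D x) := fun x => ((hNi x).sub (hNi x₀)).sub (hgi' _)
  have hDint : ∀ x, greenPotential κ f x - greenPotential κ f x₀ -
      (∫ y, f y • greenGrad κ (x₀ - y)) (x - x₀) = ∫ y, D x y := by
    intro x
    have e1 : (∫ y, f y • greenGrad κ (x₀ - y)) (x - x₀) =
        ∫ y, f y * greenGrad κ (x₀ - y) (x - x₀) :=
      ContinuousLinearMap.integral_apply hgi (x - x₀)
    have h2 : Integrable (fun y => greenFn κ ‖x - y‖ * f y - greenFn κ ‖x₀ - y‖ * f y) :=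
      (hNi x).sub (hNi x₀)
    rw [e1, greenPotential, greenPotential, ← integral_sub (hNi x) (hNi x₀),
      ← integral_sub h2 (hgi' _)]
  set S : E3 → Set E3 := fun x => Metric.ball x₀ (2 * ‖x - x₀‖)
  have hS : ∀ x, MeasurableSet (S x) := fun x => Metric.isOpen_ball.measurableSet
  set D₁ : E3 → E3 → ℂ := fun x => (S x).indicator fun y => greenFn κ ‖x - y‖ * f y
  have hD₁i : ∀ x, Integrable (D₁ x) := fun x => (hNi x).indicator (hS x)
  obtain ⟨c, hc0, hc⟩ := exists_integral_norm_pow_inv_le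
  -- the singular part
  have hlim1 : Tendsto (fun x => ‖x - x₀‖⁻¹ * ‖∫ y, D₁ x y‖) (𝓝 x₀) (𝓝 0) := by
    have hb : ∀ᶠ x in 𝓝 x₀, ‖x - x₀‖⁻¹ * ‖∫ y, D₁ x y‖ ≤ |M| * c * 9 * ‖x - x₀‖ := by
      filter_upwards [Metric.ball_mem_nhds x₀ (half_pos hr)] with x hx
      rw [mem_ball_iff_norm] at hx
      rcases eq_or_ne x x₀ with rfl | hne
      · simp
      have hpos : 0 < ‖x - x₀‖ := norm_pos_iff.2 (sub_ne_zero.2 hne)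
      rw [inv_mul_le_iff₀ hpos]
      simp only [D₁]
      rw [integral_indicator (hS x)]
      have hball := hc x (3 * ‖x - x₀‖) (by positivity) 1 (by norm_num)
      have hsub : S x ⊆ Metric.ball x (3 * ‖x - x₀‖) := by
        intro y hy
        rw [Metric.mem_ball] at hy ⊢
        have := dist_triangle y x₀ x
        rw [dist_comm x₀ x, dist_eq_norm x x₀] at this
        linarith
      have hle : ‖∫ y in S x, greenFn κ ‖x - y‖ * f y‖ ≤ ∫ y in S x, (‖x - y‖ ^ 1)⁻¹ * |M| := by
        refine norm_integral_le_of_norm_le ((hball.1.mono_set hsub).mul_const |M|) ?_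
        filter_upwards [ae_restrict_mem (hS x), ae_restrict_of_ae (ae_ne_point x)] with y hy hyx
        have hxy : 0 < ‖x - y‖ := norm_pos_iff.2 (sub_ne_zero.2 hyx.symm)
        rw [norm_mul]
        have hyr : y ∈ Metric.ball x₀ r := Metric.ball_subset_ball (by linarith) hy
        refine mul_le_mul ?_ ((hM y hyr).trans (le_abs_self M)) (norm_nonneg _) (by positivity)
        refine (norm_greenFn_le hκ hxy.le).trans ?_
        rw [one_div, pow_one]
        exact inv_anti₀ hxy (le_mul_of_one_le_left hxy.le (by linarith [Real.pi_gt_three]))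
      refine hle.trans ?_
      rw [integral_mul_const]
      have hmono : ∫ y in S x, (‖x - y‖ ^ 1)⁻¹ ≤
          ∫ y in Metric.ball x (3 * ‖x - x₀‖), (‖x - y‖ ^ 1)⁻¹ :=
        setIntegral_mono_set hball.1 (Eventually.of_forall fun y => by positivity)
          (Eventually.of_forall fun y hy => hsub hy)
      calc _ ≤ c * (3 * ‖x - x₀‖) ^ (3 - 1) * |M| :=
            mul_le_mul_of_nonneg_right (hmono.trans hball.2) (abs_nonneg M)
        _ = _ := by norm_num; ring
    have h0 : Tendsto (fun x => |M| * c * 9 * ‖x - x₀‖) (𝓝 x₀) (𝓝 0) := by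
      have : Continuous fun x => |M| * c * 9 * ‖x - x₀‖ := by fun_prop
      simpa using this.tendsto x₀
    exact squeeze_zero' (Eventually.of_forall fun x => by positivity) hb h0
  -- the regular part
  have hlim2 : Tendsto (fun x => ∫ y, ((‖x - x₀‖⁻¹ : ℝ) : ℂ) * (D x y - D₁ x y)) (𝓝 x₀) (𝓝 0) := by
    rw [← integral_zero E3 ℂ (μ := volume)]
    refine tendsto_integral_filter_of_dominated_convergence bd
      (Eventually.of_forall fun x => ((hDi x).sub (hD₁i x)).aestronglyMeasurable.const_mul _)
      (Eventually.of_forall fun x => ?_) hbd ?_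
    · filter_upwards [ae_ne_point x₀] with y hy
      have hz : x₀ - y ≠ 0 := sub_ne_zero.2 hy.symm
      have hρ : 0 < ‖x₀ - y‖ := norm_pos_iff.2 hz
      rw [norm_mul, Complex.norm_real, norm_inv, norm_norm]
      rcases eq_or_ne x x₀ with rfl | hne
      · simp only [sub_self, norm_zero, inv_zero, zero_mul, bd]; positivity
      have hpos : 0 < ‖x - x₀‖ := norm_pos_iff.2 (sub_ne_zero.2 hne)
      rw [inv_mul_le_iff₀ hpos]
      have hg : ‖f y * greenGrad κ (x₀ - y) (x - x₀)‖ ≤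
          ‖x - x₀‖ * (‖κ‖ * ((‖x₀ - y‖ ^ 1)⁻¹ * ‖f y‖) + (‖x₀ - y‖ ^ 2)⁻¹ * ‖f y‖) := by
        have h1 := (f y • greenGrad κ (x₀ - y)).le_opNorm (x - x₀)
        rw [mul_comm] at h1
        exact h1.trans (mul_le_mul_of_nonneg_left (hgle y) (norm_nonneg _))
      by_cases hy2 : y ∈ S x
      -- Here a missing factor `‖x - x₀‖` is bought with one more power of the singularity, as `1 ≤
      -- 2 ‖x - x₀‖ / ‖x₀ - y‖`.
      · have hlt : ‖x₀ - y‖ < 2 * ‖x - x₀‖ := by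
          rw [← dist_eq_norm, dist_comm]; exact hy2
        have hG : ‖greenFn κ ‖x₀ - y‖ * f y‖ ≤ ‖x - x₀‖ * (2 * ((‖x₀ - y‖ ^ 2)⁻¹ * ‖f y‖)) := by
          rw [norm_mul, ← mul_assoc, ← mul_assoc]
          refine mul_le_mul_of_nonneg_right ?_ (norm_nonneg _)
          refine (norm_greenFn_le hκ hρ.le).trans ?_
          rw [div_le_iff₀ (by positivity)]
          have e : ‖x - x₀‖ * 2 * (‖x₀ - y‖ ^ 2)⁻¹ * (4 * Real.pi * ‖x₀ - y‖) =
            4 * Real.pi * (2 * ‖x - x₀‖ / ‖x₀ - y‖) := by field_simp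
          rw [e]
          have h1 : 1 ≤ 2 * ‖x - x₀‖ / ‖x₀ - y‖ := by rw [le_div_iff₀ hρ]; linarith
          nlinarith [Real.pi_gt_three]
        have e : D x y - D₁ x y =
            -(greenFn κ ‖x₀ - y‖ * f y) - f y * greenGrad κ (x₀ - y) (x - x₀) := by
          simp only [D, D₁]; rw [Set.indicator_of_mem hy2]; ring
        rw [e]
        refine (norm_sub_le _ _).trans ?_
        rw [norm_neg]
        refine (add_le_add hG hg).trans ?_
        rw [← mul_add]
        refine mul_le_mul_of_nonneg_left ?_ hpos.le
        simp only [bd]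
        have p1 : 0 ≤ ‖κ‖ * ((‖x₀ - y‖ ^ 1)⁻¹ * ‖f y‖) := by positivity
        have p2 : 0 ≤ (‖x₀ - y‖ ^ 2)⁻¹ * ‖f y‖ := by positivity
        linarith
      · have hge : 2 * ‖x - x₀‖ ≤ ‖x₀ - y‖ := by
          rw [← dist_eq_norm x₀ y, dist_comm]; simpa [S] using hy2
        have hG := norm_greenFn_increment_le hκ hz hge
        have e0 : x₀ - y + (x - x₀) = x - y := by abel
        rw [e0] at hG
        have e : D x y - D₁ x y = (greenFn κ ‖x - y‖ - greenFn κ ‖x₀ - y‖) * f y -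
            f y * greenGrad κ (x₀ - y) (x - x₀) := by
          simp only [D, D₁]; rw [Set.indicator_of_notMem hy2]; ring
        rw [e]
        refine (norm_sub_le _ _).trans ?_
        rw [norm_mul]
        refine (add_le_add (mul_le_mul_of_nonneg_right hG (norm_nonneg _)) hg).trans (le_of_eq ?_)
        simp only [bd]
        rw [pow_one]; ring
    · filter_upwards [ae_ne_point x₀] with y hy
      have hz : x₀ - y ≠ 0 := sub_ne_zero.2 hy.symm
      have hρ : 0 < ‖x₀ - y‖ := norm_pos_iff.2 hz
      have hd : HasFDerivAt (fun x : E3 => greenFn κ ‖x - y‖ * f y) (f y • greenGrad κ (x₀ - y)) x₀ := by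
        have h1 := (hasFDerivAt_greenFn_norm κ hz).comp x₀ ((hasFDerivAt_id x₀).sub_const y)
        have h2 := h1.mul_const (f y)
        simpa using! h2
      have h0 := hasFDerivAt_iff_tendsto.1 hd
      have hev : ∀ᶠ x in 𝓝 x₀, y ∉ S x := by
        have hc' : ContinuousAt (fun x : E3 => 2 * ‖x - x₀‖) x₀ := by fun_prop
        have h1 : (fun x : E3 => 2 * ‖x - x₀‖) x₀ < dist y x₀ := by simpa using hy
        filter_upwards [hc'.eventually_lt continuousAt_const h1] with x hx
        simp only [S, Metric.mem_ball, not_lt]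
        exact hx.le
      rw [tendsto_zero_iff_norm_tendsto_zero]
      refine h0.congr' ?_
      filter_upwards [hev] with x hx
      rw [norm_mul, Complex.norm_real, norm_inv, norm_norm]
      congr 2
      simp only [D, D₁]
      rw [Set.indicator_of_notMem hx, sub_zero]
      rfl
  rw [hasFDerivAt_iff_tendsto]
  have hsum := hlim1.add (tendsto_zero_iff_norm_tendsto_zero.1 hlim2)
  rw [add_zero] at hsum
  refine squeeze_zero (fun x => by positivity) (fun x => ?_) hsum
  rw [hDint, integral_const_mul, norm_mul, Complex.norm_real, norm_inv, norm_norm, ← mul_add,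
    integral_sub (hDi x) (hD₁i x)]
  refine mul_le_mul_of_nonneg_left ?_ (by positivity)
  have := norm_add_le (∫ y, D₁ x y) ((∫ y, D x y) - ∫ y, D₁ x y)
  simpa using this


/-! ### The radiation condition for potentials of short-range densities -/

/-- Dominated convergence along a filter requires the filter to be countably generated. -/
instance isCountablyGenerated_cocompact_E3 : (cocompact E3).IsCountablyGenerated := by
  rw [← Metric.cobounded_eq_cocompact, ← comap_norm_atTop]; infer_instance

theorem eventually_le_norm_cocompact (R : ℝ) : ∀ᶠ x in cocompact E3, R ≤ ‖x‖ :=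
  (tendsto_norm_cocompact_atTop (E := E3)).eventually_ge_atTop R

theorem IsShortRange.exists_decay {v : E3 → ℝ} (hv : IsShortRange v) :
    ∃ β C R : ℝ, 3 < β ∧ 0 ≤ C ∧ 1 ≤ R ∧
      ∀ r y : E3, R ≤ ‖r‖ → ‖r‖ ≤ 2 * ‖y‖ → |v y| ≤ C * ‖r‖ ^ (-β) := by
  obtain ⟨-, -, β, C, R, hβ, hC⟩ := hv
  refine ⟨β, |C| * 2 ^ β, max 1 (2 * R), hβ, by positivity, le_max_left _ _, fun r y hr hy => ?_⟩
  have hr1 : 1 ≤ ‖r‖ := (le_max_left _ _).trans hr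
  have hyR : R ≤ ‖y‖ := by
    have := (le_max_right 1 (2 * R)).trans hr
    linarith
  have hr0 : 0 < ‖r‖ := by linarith
  refine (hC y hyR).trans ?_
  have h1 : (1 + ‖y‖) ^ (-β) ≤ (‖r‖ / 2) ^ (-β) :=
    Real.rpow_le_rpow_of_nonpos (by positivity) (by linarith) (by linarith)
  have h2 : (‖r‖ / 2) ^ (-β) = 2 ^ β * ‖r‖ ^ (-β) := by
    rw [Real.div_rpow hr0.le (by norm_num), Real.rpow_neg (by norm_num : (0 : ℝ) ≤ 2)]
    field_simp
  calc C * (1 + ‖y‖) ^ (-β) ≤ |C| * (1 + ‖y‖) ^ (-β) :=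
        mul_le_mul_of_nonneg_right (le_abs_self C) (Real.rpow_nonneg (by positivity) _)
    _ ≤ |C| * (‖r‖ / 2) ^ (-β) := mul_le_mul_of_nonneg_left h1 (abs_nonneg C)
    _ = _ := by rw [h2]; ring

/-- Where `‖x - y‖ < ‖x‖ / 2`, the point `y` is itself far out and the density is `O(‖x‖ ^ (-β))`,
while the kernel bound integrates to `O(‖x‖ ^ 3)`; this is where `β > 3` enters. On the rest the
integrand is dominated and tends to zero pointwise. The lemma serves both the potential and its
radiation defect. -/
theorem tendsto_integral_of_near_far {v : E3 → ℝ} (hv : IsShortRange v) {f : E3 → ℂ}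
    (hfm : AEStronglyMeasurable f) {M : ℝ} (hM : ∀ y, ‖f y‖ ≤ M * |v y|) {Q : E3 → E3 → ℂ} {B : ℝ}
    (hB : 0 ≤ B) (hQm : ∀ x, AEStronglyMeasurable (Q x))
    (hnear : ∀ x y, 1 ≤ ‖x‖ → x ≠ y → ‖x - y‖ < ‖x‖ / 2 →
      ‖Q x y‖ ≤ B * ‖x‖ * ((‖x - y‖ ^ 1)⁻¹ + (‖x - y‖ ^ 2)⁻¹) * ‖f y‖)
    (hfar : ∀ x y, 1 ≤ ‖x‖ → ‖x‖ / 2 ≤ ‖x - y‖ → ‖Q x y‖ ≤ B * ‖f y‖)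
    (hlim : ∀ x y, 1 ≤ ‖x‖ → ‖x‖ / 2 ≤ ‖x - y‖ → ‖Q x y‖ ≤ B * (1 + ‖y‖) * ‖f y‖ * ‖x‖⁻¹) :
    Tendsto (fun x => ∫ y, Q x y) (cocompact E3) (𝓝 0) := by
  have hf := hv.integrable_of_le hfm hM
  obtain ⟨β, C, R, hβ, hC, hR, hdecay⟩ := hv.exists_decay
  obtain ⟨c, hc0, hc⟩ := exists_integral_norm_pow_inv_le
  set S : E3 → Set E3 := fun x => Metric.ball x (‖x‖ / 2)
  have hS : ∀ x, MeasurableSet (S x) := fun x => Metric.isOpen_ball.measurableSet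
  have hmemS : ∀ x y, y ∈ S x ↔ ‖x - y‖ < ‖x‖ / 2 := fun x y => by
    rw [Metric.mem_ball, dist_comm, dist_eq_norm]
  set A : ℝ := B * (|M| * C) * (c + c)
  have hnear' : ∀ x : E3, R ≤ ‖x‖ → IntegrableOn (Q x) (S x) ∧
      ‖∫ y in S x, Q x y‖ ≤ A * ‖x‖ ^ (3 - β) := by
    intro x hx
    have hx1 : 1 ≤ ‖x‖ := hR.trans hx
    have hx0 : 0 < ‖x‖ := by linarith
    have h1 := hc x (‖x‖ / 2) (by positivity) 1 (by norm_num)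
    have h2 := hc x (‖x‖ / 2) (by positivity) 2 le_rfl
    set K : ℝ := B * ‖x‖ * (|M| * (C * ‖x‖ ^ (-β)))
    have hK : 0 ≤ K := by positivity
    have hbi : IntegrableOn (fun y => K * ((‖x - y‖ ^ 1)⁻¹ + (‖x - y‖ ^ 2)⁻¹)) (S x) :=
      (h1.1.add h2.1).const_mul K
    have hle : ∀ᵐ y ∂volume.restrict (S x),
        ‖Q x y‖ ≤ K * ((‖x - y‖ ^ 1)⁻¹ + (‖x - y‖ ^ 2)⁻¹) := by
      filter_upwards [ae_restrict_mem (hS x), ae_restrict_of_ae (ae_ne_point x)] with y hy hyx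
      have hy' := (hmemS x y).1 hy
      refine (hnear x y hx1 hyx.symm hy').trans ?_
      have hny : ‖x‖ ≤ 2 * ‖y‖ := by
        have := norm_sub_norm_le x y; linarith
      have hfy : ‖f y‖ ≤ |M| * (C * ‖x‖ ^ (-β)) :=
        (hM y).trans (mul_le_mul (le_abs_self M) (hdecay x y hx hny) (abs_nonneg _) (abs_nonneg _))
      calc _ ≤ B * ‖x‖ * ((‖x - y‖ ^ 1)⁻¹ + (‖x - y‖ ^ 2)⁻¹) * (|M| * (C * ‖x‖ ^ (-β))) :=
            mul_le_mul_of_nonneg_left hfy (by positivity)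
        _ = _ := by simp only [K]; ring
    refine ⟨Integrable.mono' hbi (hQm x).restrict hle, ?_⟩
    refine (norm_integral_le_of_norm_le hbi hle).trans ?_
    rw [integral_const_mul, integral_add h1.1 h2.1]
    have h3 : (∫ y in S x, (‖x - y‖ ^ 1)⁻¹) + (∫ y in S x, (‖x - y‖ ^ 2)⁻¹) ≤
        (c + c) * ‖x‖ ^ 2 := by
      have e1 : c * (‖x‖ / 2) ^ (3 - 1) ≤ c * ‖x‖ ^ 2 := by norm_num; gcongr; linarith
      have e2 : c * (‖x‖ / 2) ^ (3 - 2) ≤ c * ‖x‖ ^ 2 := by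
        norm_num
        gcongr
        nlinarith
      linarith [h1.2, h2.2]
    refine (mul_le_mul_of_nonneg_left h3 hK).trans (le_of_eq ?_)
    have e : ‖x‖ ^ (3 - β) = ‖x‖ ^ 3 * ‖x‖ ^ (-β) := by
      rw [sub_eq_add_neg, Real.rpow_add hx0]
      norm_cast
    rw [e]; simp only [K, A]; ring
  have hlim1 : Tendsto (fun x => ∫ y in S x, Q x y) (cocompact E3) (𝓝 0) := by
    have h0 : Tendsto (fun x : E3 => A * ‖x‖ ^ (3 - β)) (cocompact E3) (𝓝 0) := by
      have h1 : Tendsto (fun t : ℝ => t ^ (-(β - 3))) atTop (𝓝 0) :=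
        tendsto_rpow_neg_atTop (by linarith)
      have h2 := (h1.comp (tendsto_norm_cocompact_atTop (E := E3))).const_mul A
      simpa using h2
    refine squeeze_zero_norm' ?_ h0
    filter_upwards [eventually_le_norm_cocompact R] with x hx using (hnear' x hx).2
  have hfar' : ∀ x : E3, 1 ≤ ‖x‖ → ∀ y, ‖(S x)ᶜ.indicator (Q x) y‖ ≤ B * ‖f y‖ := by
    intro x hx y
    by_cases hy : y ∈ S x
    · rw [Set.indicator_of_notMem (fun h : y ∈ (S x)ᶜ => h hy), norm_zero]; positivity
    · rw [Set.indicator_of_mem (show y ∈ (S x)ᶜ from hy)]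
      exact hfar x y hx (not_lt.1 fun h => hy ((hmemS x y).2 h))
  have hlim2 : Tendsto (fun x => ∫ y, (S x)ᶜ.indicator (Q x) y) (cocompact E3) (𝓝 0) := by
    rw [← integral_zero E3 ℂ (μ := volume)]
    refine tendsto_integral_filter_of_dominated_convergence (fun y => B * ‖f y‖)
      (Eventually.of_forall fun x => (hQm x).indicator (hS x).compl) ?_ (hf.norm.const_mul B)
      (Eventually.of_forall fun y => ?_)
    · filter_upwards [eventually_le_norm_cocompact 1] with x hx
      exact Eventually.of_forall (hfar' x hx)
    · have h0 : Tendsto (fun x : E3 => B * (1 + ‖y‖) * ‖f y‖ * ‖x‖⁻¹) (cocompact E3) (𝓝 0) := by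
        have := (tendsto_inv_atTop_zero.comp (tendsto_norm_cocompact_atTop (E := E3))).const_mul
          (B * (1 + ‖y‖) * ‖f y‖)
        simpa using this
      refine squeeze_zero_norm' ?_ h0
      filter_upwards [eventually_le_norm_cocompact 1] with x hx
      by_cases hy : y ∈ S x
      · rw [Set.indicator_of_notMem (fun h : y ∈ (S x)ᶜ => h hy), norm_zero]; positivity
      · rw [Set.indicator_of_mem (show y ∈ (S x)ᶜ from hy)]
        exact hlim x y hx (not_lt.1 fun h => hy ((hmemS x y).2 h))
  have hsum := hlim1.add hlim2
  rw [add_zero] at hsum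
  refine hsum.congr' ?_
  filter_upwards [eventually_le_norm_cocompact R] with x hx
  have hi2 : Integrable ((S x)ᶜ.indicator (Q x)) :=
    (hf.norm.const_mul B).mono' ((hQm x).indicator (hS x).compl)
      (Eventually.of_forall (hfar' x (hR.trans hx)))
  have hi2' : IntegrableOn (Q x) (S x)ᶜ := (integrable_indicator_iff (hS x).compl).1 hi2
  have hi : Integrable (Q x) := by
    rw [← integrableOn_univ, ← Set.union_compl_self (S x)]
    exact (hnear' x hx).1.union hi2'
  rw [integral_indicator (hS x).compl, integral_add_compl (hS x) hi]

theorem norm_greenFn_le_inv {κ : ℂ} (hκ : 0 ≤ κ.im) {ρ : ℝ} (hρ : 0 < ρ) :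
    ‖greenFn κ ρ‖ ≤ ρ⁻¹ := by
  refine (norm_greenFn_le hκ hρ.le).trans ?_
  rw [one_div]
  exact inv_anti₀ hρ (le_mul_of_one_le_left hρ.le (by linarith [Real.pi_gt_three]))

/-- Far out the density is locally bounded, so the potential is differentiable under the integral.
The radiation defect of the Green's function centred at `y` consists of a term in `‖x - y‖⁻²` and
one proportional to `1 - cos θ`, where `θ` is the angle between `x` and `x - y`. -/
theorem IsShortRange.isOutgoing_greenPotential {v : E3 → ℝ} (hv : IsShortRange v) {f : E3 → ℂ}
    (hfm : AEStronglyMeasurable f) {M : ℝ} (hM : ∀ y, ‖f y‖ ≤ M * |v y|) {k : ℝ} (hk : 0 ≤ k) :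
    IsOutgoing k (greenPotential (k : ℂ) f) := by
  have hf := hv.integrable_of_le hfm hM
  obtain ⟨C₀, hC₀⟩ := hv.exists_hasPotentialBound hfm hM
  have him : (0 : ℝ) ≤ (k : ℂ).im := by simp
  obtain ⟨β, C, R, hβ, hC, hR, hdecay⟩ := hv.exists_decay
  have hderiv : ∀ x : E3, max R 2 ≤ ‖x‖ →
      Integrable (fun y => f y • greenGrad (k : ℂ) (x - y)) ∧
      HasFDerivAt (greenPotential (k : ℂ) f) (∫ y, f y • greenGrad (k : ℂ) (x - y)) x := by
    intro x hx
    refine hasFDerivAt_greenPotential him hf hC₀ (r := 1) (M := |M| * (C * ‖x‖ ^ (-β)))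
      one_pos fun y hy => ?_
    have h1 : ‖x - y‖ < 1 := by rw [← dist_eq_norm, dist_comm]; exact hy
    have h2 := norm_sub_norm_le x y
    have h3 := (le_max_right R 2).trans hx
    exact (hM y).trans (mul_le_mul (le_abs_self M)
      (hdecay x y ((le_max_left R 2).trans hx) (by linarith)) (abs_nonneg _) (abs_nonneg _))
  refine ⟨?_, ?_, ?_⟩
  · refine tendsto_integral_of_near_far hv hfm hM (B := 2) (by norm_num)
      (fun x => aestronglyMeasurable_greenFn_mul hfm _ x) (fun x y hx hxy _ => ?_)
      (fun x y hx hy => ?_) (fun x y hx hy => ?_)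
    · have hp : 0 < ‖x - y‖ := norm_pos_iff.2 (sub_ne_zero.2 hxy)
      rw [norm_mul]
      refine mul_le_mul_of_nonneg_right ((norm_greenFn_le_inv him hp).trans ?_) (norm_nonneg _)
      have h1 : 0 < (‖x - y‖ ^ 2)⁻¹ := by positivity
      have h2 : 0 < ‖x - y‖⁻¹ := by positivity
      rw [pow_one]
      nlinarith
    · have hp : 0 < ‖x - y‖ := by linarith
      rw [norm_mul]
      refine mul_le_mul_of_nonneg_right ((norm_greenFn_le_inv him hp).trans ?_) (norm_nonneg _)
      rw [inv_le_comm₀ hp (by norm_num)]; linarith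
    · have hp : 0 < ‖x - y‖ := by linarith
      have hx0 : 0 < ‖x‖ := by linarith
      have h1 : ‖greenFn (k : ℂ) ‖x - y‖‖ ≤ 2 * ‖x‖⁻¹ := by
        refine (norm_greenFn_le_inv him hp).trans ?_
        rw [← div_eq_mul_inv, inv_le_comm₀ hp (by positivity), inv_div]; exact hy
      rw [norm_mul]
      calc _ ≤ 2 * ‖x‖⁻¹ * ‖f y‖ := mul_le_mul_of_nonneg_right h1 (norm_nonneg _)
        _ ≤ 2 * ‖x‖⁻¹ * ‖f y‖ * (1 + ‖y‖) :=
            le_mul_of_one_le_right (by positivity) (by linarith [norm_nonneg y])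
        _ = _ := by ring
  · filter_upwards [eventually_le_norm_cocompact (max R 2)] with x hx
    exact (hderiv x hx).2.differentiableAt
  · set Q : E3 → E3 → ℂ := fun x y => (‖x‖ : ℂ) * (f y * greenGrad (k : ℂ) (x - y) (‖x‖⁻¹ • x) -
      Complex.I * k * (greenFn (k : ℂ) ‖x - y‖ * f y))
    have hQm : ∀ x, AEStronglyMeasurable (Q x) := by
      intro x
      have h1 : Measurable fun y => greenGrad (k : ℂ) (x - y) (‖x‖⁻¹ • x) :=
        (ContinuousLinearMap.apply ℝ ℂ (‖x‖⁻¹ • x)).continuous.measurable.comp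
          ((measurable_greenGrad _).comp (measurable_const.sub measurable_id))
      exact ((hfm.mul h1.aestronglyMeasurable).sub
        ((aestronglyMeasurable_greenFn_mul hfm _ x).const_mul _)).const_mul _
    have hQle : ∀ x y, 1 ≤ ‖x‖ → x ≠ y → ‖Q x y‖ ≤
        ‖x‖ * ‖x - y‖⁻¹ * (k * min 2 (2 * ‖y‖ * ‖x - y‖⁻¹) + ‖x - y‖⁻¹) * ‖f y‖ := by
      intro x y hx hxy
      have hp : 0 < ‖x - y‖ := norm_pos_iff.2 (sub_ne_zero.2 hxy)
      have hx0 : 0 < ‖x‖ := by linarith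
      -- This is `cos θ`. The bound `1 - ct ≤ 2` is used near `x` and for domination, and `1 - ct ≤
      -- 2 ‖y‖ / ‖x - y‖` for the pointwise limit.
      set ct : ℝ := ‖x - y‖⁻¹ * inner ℝ (x - y) (‖x‖⁻¹ • x)
      have hct : |ct| ≤ 1 := by
        simp only [ct]
        rw [abs_mul, abs_of_pos (inv_pos.2 hp), inv_mul_le_iff₀ hp]
        refine (abs_real_inner_le_norm _ _).trans ?_
        rw [norm_smul, norm_inv, norm_norm, inv_mul_cancel₀ hx0.ne']
      have hct2 : 1 - ct ≤ 2 * ‖y‖ * ‖x - y‖⁻¹ := by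
        have e1 : ct = ‖x - y‖⁻¹ * (‖x‖ - ‖x‖⁻¹ * inner ℝ y x) := by
          simp only [ct]
          rw [real_inner_smul_right, inner_sub_left, real_inner_self_eq_norm_sq]
          field_simp
        have e2 : ‖x‖⁻¹ * inner ℝ y x ≤ ‖y‖ := by
          rw [inv_mul_le_iff₀ hx0]
          exact (real_inner_le_norm y x).trans (le_of_eq (mul_comm _ _))
        have e3 : ‖x - y‖ ≤ ‖x‖ + ‖y‖ := norm_sub_le x y
        have e4 : 1 - ct = (‖x - y‖ - ‖x‖ + ‖x‖⁻¹ * inner ℝ y x) * ‖x - y‖⁻¹ := by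
          rw [e1]; field_simp; ring
        rw [e4]
        exact mul_le_mul_of_nonneg_right (by linarith) (by positivity)
      have e : Q x y = (‖x‖ : ℂ) * greenFn (k : ℂ) ‖x - y‖ *
          (-(Complex.I * k * ((1 - ct : ℝ) : ℂ)) - ((‖x - y‖⁻¹ * ct : ℝ) : ℂ)) * f y := by
        simp only [Q, ct]
        rw [greenGrad_apply]
        push_cast; ring
      rw [e, norm_mul, norm_mul, norm_mul, Complex.norm_real, norm_norm]
      have h1 : ‖-(Complex.I * k * ((1 - ct : ℝ) : ℂ)) - ((‖x - y‖⁻¹ * ct : ℝ) : ℂ)‖ ≤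
          k * min 2 (2 * ‖y‖ * ‖x - y‖⁻¹) + ‖x - y‖⁻¹ := by
        refine (norm_sub_le _ _).trans (add_le_add ?_ ?_)
        · rw [norm_neg, norm_mul, norm_mul, Complex.norm_I, one_mul, Complex.norm_real,
            Complex.norm_real, Real.norm_of_nonneg hk,
            Real.norm_of_nonneg (by linarith [(abs_le.1 hct).2])]
          refine mul_le_mul_of_nonneg_left (le_min ?_ hct2) hk
          linarith [(abs_le.1 hct).1]
        · rw [Complex.norm_real, norm_mul, norm_inv, norm_norm]
          exact mul_le_of_le_one_right (by positivity) hct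
      have h2 := norm_greenFn_le_inv him hp (κ := (k : ℂ))
      have h0 : 0 ≤ min 2 (2 * ‖y‖ * ‖x - y‖⁻¹) := le_min (by norm_num) (by positivity)
      gcongr
    have key : Tendsto (fun x => ∫ y, Q x y) (cocompact E3) (𝓝 0) := by
      refine tendsto_integral_of_near_far hv hfm hM (B := 8 * k + 8) (by positivity) hQm
        (fun x y hx hxy _ => ?_) (fun x y hx hy => ?_) (fun x y hx hy => ?_)
      · have hp : 0 < ‖x - y‖ := norm_pos_iff.2 (sub_ne_zero.2 hxy)
        refine (hQle x y hx hxy).trans (mul_le_mul_of_nonneg_right ?_ (norm_nonneg _))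
        have h1 : k * min 2 (2 * ‖y‖ * ‖x - y‖⁻¹) ≤ k * 2 :=
          mul_le_mul_of_nonneg_left (min_le_left _ _) hk
        calc _ ≤ ‖x‖ * ‖x - y‖⁻¹ * (k * 2 + ‖x - y‖⁻¹) := by gcongr
          _ = 2 * k * (‖x‖ * ‖x - y‖⁻¹) + 1 * (‖x‖ * (‖x - y‖ ^ 2)⁻¹) := by
            field_simp
          _ ≤ (8 * k + 8) * (‖x‖ * ‖x - y‖⁻¹) + (8 * k + 8) * (‖x‖ * (‖x - y‖ ^ 2)⁻¹) := by
            gcongr <;> linarith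
          _ = _ := by rw [pow_one]; ring
      · have hx0 : 0 < ‖x‖ := by linarith
        have hp : 0 < ‖x - y‖ := by linarith
        have hxy : x ≠ y := fun h => by rw [h, sub_self, norm_zero] at hp; exact hp.false
        refine (hQle x y hx hxy).trans (mul_le_mul_of_nonneg_right ?_ (norm_nonneg _))
        have h1 : k * min 2 (2 * ‖y‖ * ‖x - y‖⁻¹) ≤ k * 2 :=
          mul_le_mul_of_nonneg_left (min_le_left _ _) hk
        have h2 : ‖x‖ * ‖x - y‖⁻¹ ≤ 2 := by
          rw [← div_eq_mul_inv, div_le_iff₀ hp]; linarith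
        have h3 : ‖x - y‖⁻¹ ≤ 2 := by rw [inv_le_comm₀ hp (by norm_num)]; linarith
        calc _ ≤ 2 * (k * 2 + 2) := by gcongr
          _ ≤ _ := by linarith
      · have hx0 : 0 < ‖x‖ := by linarith
        have hp : 0 < ‖x - y‖ := by linarith
        have hxy : x ≠ y := fun h => by rw [h, sub_self, norm_zero] at hp; exact hp.false
        refine (hQle x y hx hxy).trans ?_
        have h2 : ‖x‖ * ‖x - y‖⁻¹ ≤ 2 := by
          rw [← div_eq_mul_inv, div_le_iff₀ hp]; linarith
        have h3 : ‖x - y‖⁻¹ ≤ 2 * ‖x‖⁻¹ := by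
          rw [← div_eq_mul_inv, inv_le_comm₀ hp (by positivity), inv_div]; exact hy
        have h1 : k * min 2 (2 * ‖y‖ * ‖x - y‖⁻¹) ≤ k * (2 * ‖y‖ * (2 * ‖x‖⁻¹)) :=
          mul_le_mul_of_nonneg_left ((min_le_right _ _).trans (by gcongr)) hk
        calc _ ≤ 2 * (k * (2 * ‖y‖ * (2 * ‖x‖⁻¹)) + 2 * ‖x‖⁻¹) * ‖f y‖ := by gcongr
          _ = (8 * k * ‖y‖ + 4) * ‖f y‖ * ‖x‖⁻¹ := by ring
          _ ≤ _ := by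
            refine mul_le_mul_of_nonneg_right (mul_le_mul_of_nonneg_right ?_ (norm_nonneg _))
              (by positivity)
            nlinarith [norm_nonneg y, hk]
    refine key.congr' ?_
    filter_upwards [eventually_le_norm_cocompact (max R 2)] with x hx
    obtain ⟨hgi, hd⟩ := hderiv x hx
    have hgi' : Integrable (fun y => f y * greenGrad (k : ℂ) (x - y) (‖x‖⁻¹ • x)) :=
      (ContinuousLinearMap.apply ℝ ℂ (‖x‖⁻¹ • x)).integrable_comp hgi
    have e1 : (∫ y, f y • greenGrad (k : ℂ) (x - y)) (‖x‖⁻¹ • x) =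
        ∫ y, f y * greenGrad (k : ℂ) (x - y) (‖x‖⁻¹ • x) :=
      ContinuousLinearMap.integral_apply hgi _
    rw [hd.fderiv, e1, greenPotential, ← integral_const_mul (Complex.I * (k : ℂ)),
      ← integral_sub hgi' ((hC₀.integrable_greenFn_mul him x).const_mul _), ← integral_const_mul]


/-! ### Uniqueness of outgoing solutions -/

/-- The norm is taken only after the radial integration, so cancellation along rays is preserved. -/
theorem norm_integral_le_of_rays {F : E3 → ℂ} (hF : Integrable F) {B : ℝ}
    (hB : ∀ η : E3, ‖η‖ = 1 → ‖∫ r in Set.Ioi (0 : ℝ), ((r : ℂ) ^ 2) * F (r • η)‖ ≤ B) :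
    ‖∫ y, F y‖ ≤ B * (volume : Measure E3).toSphere.real Set.univ := by
  have hmp := (volume : Measure E3).measurePreserving_homeomorphUnitSphereProd
  have hemb := (homeomorphUnitSphereProd E3).measurableEmbedding
  set g : Metric.sphere (0 : E3) 1 × Set.Ioi (0 : ℝ) → ℂ := fun p => F (p.2.1 • p.1.1)
  have hg : ∀ x : ({0}ᶜ : Set E3), F x.1 = g (homeomorphUnitSphereProd E3 x) := by
    intro x
    have hx : ‖x.1‖ ≠ 0 := norm_ne_zero_iff.2 x.2
    simp only [g]
    congr 1
    simp [smul_smul, hx]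
  have e1 : ∫ y, F y = ∫ p, g p ∂((volume : Measure E3).toSphere.prod
      (.volumeIoiPow (Module.finrank ℝ E3 - 1))) := by
    rw [← hmp.integral_comp hemb g]
    simp_rw [← hg]
    rw [integral_subtype_comap (measurableSet_singleton _).compl F, restrict_compl_singleton]
  have hgi : Integrable g ((volume : Measure E3).toSphere.prod
      (.volumeIoiPow (Module.finrank ℝ E3 - 1))) := by
    rw [← hmp.integrable_comp_emb hemb]
    have h1 : Integrable (fun x : ({0}ᶜ : Set E3) => F x.1) (Measure.comap (Subtype.val : ({0}ᶜ : Set E3) → E3) volume) :=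
      (integrableOn_iff_comap_subtypeVal (measurableSet_singleton (0 : E3)).compl).1
        hF.integrableOn
    exact h1.congr (Eventually.of_forall hg)
  rw [e1, integral_prod _ hgi]
  have hin : ∀ η : Metric.sphere (0 : E3) 1,
      ‖∫ r, g (η, r) ∂(Measure.volumeIoiPow (Module.finrank ℝ E3 - 1))‖ ≤ B := by
    intro η
    refine le_of_eq_of_le ?_ (hB η.1 (by simp))
    congr 1
    simp only [Measure.volumeIoiPow, ENNReal.ofReal, g]
    rw [integral_withDensity_eq_integral_smul (by fun_prop),
      integral_subtype_comap measurableSet_Ioi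
        (fun a => Real.toNNReal (a ^ (Module.finrank ℝ E3 - 1)) • F (a • η.1)), finrank_E3]
    refine setIntegral_congr_fun measurableSet_Ioi fun r hr => ?_
    rw [NNReal.smul_def, Real.coe_toNNReal _ (pow_nonneg (Set.mem_Ioi.1 hr).le _),
      Complex.real_smul]
    push_cast; rfl
  exact norm_integral_le_of_norm_le_const (Eventually.of_forall hin)

theorem norm_add_I_mul_le {k ε : ℝ} (hk : 0 < k) (hε : 0 < ε) (hε1 : ε ≤ 1) :
    ‖(k : ℂ) + Complex.I * (ε : ℂ)‖ ≤ k + 1 := by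
  refine (norm_add_le _ _).trans ?_
  rw [norm_mul, Complex.norm_I, one_mul, Complex.norm_real, Complex.norm_real,
    Real.norm_of_nonneg hk.le, Real.norm_of_nonneg hε.le]
  linarith

/-- Geometry of the Green's function centred at `x₀` along a ray from the origin. -/
theorem norm_greenFn_ray_le {k ε : ℝ} (hε : 0 < ε) (hε1 : ε ≤ 1) {x₀ y : E3}
    (hy : 2 * ‖x₀‖ + 1 ≤ ‖y‖) : ‖greenFn ((k : ℂ) + Complex.I * (ε : ℂ)) ‖x₀ - y‖‖ ≤
      2 * Real.exp ‖x₀‖ * (Real.exp (-ε * ‖y‖) * ‖y‖⁻¹) := by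
  have h1 : ‖y‖ - ‖x₀‖ ≤ ‖x₀ - y‖ := by rw [norm_sub_rev]; exact norm_sub_norm_le y x₀
  have h2 : ‖y‖ / 2 ≤ ‖x₀ - y‖ := by linarith
  have hy0 : 0 < ‖y‖ := by linarith [norm_nonneg x₀]
  have hp : 0 < ‖x₀ - y‖ := by linarith
  have him : ((k : ℂ) + Complex.I * (ε : ℂ)).im = ε := by simp
  rw [norm_greenFn _ hp.le, him]
  have h3 : Real.exp (-ε * ‖x₀ - y‖) ≤ Real.exp ‖x₀‖ * Real.exp (-ε * ‖y‖) := by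
    rw [← Real.exp_add, Real.exp_le_exp]
    nlinarith [norm_nonneg x₀]
  have h4 : (4 * Real.pi * ‖x₀ - y‖)⁻¹ ≤ 2 * ‖y‖⁻¹ := by
    rw [← div_eq_mul_inv, inv_le_comm₀ (by positivity) (by positivity), inv_div]
    nlinarith [Real.pi_gt_three]
  rw [div_eq_mul_inv]
  calc _ ≤ Real.exp ‖x₀‖ * Real.exp (-ε * ‖y‖) * (2 * ‖y‖⁻¹) := by gcongr
    _ = _ := by ring

theorem integrableOn_mul_exp_neg {ε : ℝ} (hε : 0 < ε) :
    IntegrableOn (fun r : ℝ => r * Real.exp (-ε * r)) (Set.Ioi 0) := by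
  have h := integrableOn_rpow_mul_exp_neg_mul_rpow (p := 1) (s := 1) (by norm_num) one_pos hε
  simpa using h

theorem integral_exp_neg_mul_Ioi_le {ε : ℝ} (hε : 0 < ε) {R : ℝ} (hR : 0 ≤ R) :
    ∫ r in Set.Ioi R, Real.exp (-ε * r) ≤ ε⁻¹ := by
  rw [integral_exp_mul_Ioi (by linarith) R, neg_div_neg_eq, div_eq_mul_inv]
  exact mul_le_of_le_one_left (by positivity) (Real.exp_le_one_iff.2 (by nlinarith))

/-- The contribution of one ray to `∫ h G`: oscillation makes it smaller than the trivial bound. -/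
theorem norm_ray_integral_le {k ε δ R M : ℝ} (hk : 0 < k) (hε : 0 < ε) (hε1 : ε ≤ 1) (hδ : 0 ≤ δ)
    {h : E3 → ℂ} (hM : ∀ x, ‖h x‖ ≤ M) {x₀ : E3} (hR : 2 * ‖x₀‖ + 1 ≤ R)
    (hsmall : ∀ y, R ≤ ‖y‖ → ‖h y‖ ≤ δ) (hdiff : ∀ y, R ≤ ‖y‖ → DifferentiableAt ℝ h y)
    (hrad : ∀ y, R ≤ ‖y‖ → ‖(‖y‖ : ℂ) * (fderiv ℝ h y (‖y‖⁻¹ • y) - Complex.I * (k : ℂ) * h y)‖ ≤ δ)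
    {η : E3} (hη : ‖η‖ = 1) :
    ‖∫ r in Set.Ioi R, ((r : ℂ) ^ 2) *
        (greenFn ((k : ℂ) + Complex.I * (ε : ℂ)) ‖x₀ - r • η‖ * h (r • η))‖ ≤
      (2 * Real.exp ‖x₀‖ * M * R +
        δ * (2 * Real.exp ‖x₀‖ * (5 + 4 * ‖x₀‖ * (k + 1))) * ε⁻¹) / (2 * k) := by
  set κ : ℂ := (k : ℂ) + Complex.I * (ε : ℂ) with hκ
  set X := ‖x₀‖ with hX
  have hX0 : 0 ≤ X := norm_nonneg _
  have hR0 : 0 < R := by linarith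
  have hM0 : 0 ≤ M := (norm_nonneg _).trans (hM 0)
  have hnr : ∀ r : ℝ, 0 ≤ r → ‖r • η‖ = r := fun r hr => by
    rw [norm_smul, hη, mul_one, Real.norm_of_nonneg hr]
  have hG : ∀ r : ℝ, R ≤ r → ‖greenFn κ ‖x₀ - r • η‖‖ ≤
      2 * Real.exp X * (Real.exp (-ε * r) * r⁻¹) := by
    intro r hr
    have hr' := hnr r (hR0.le.trans hr)
    have := norm_greenFn_ray_le (k := k) hε hε1 (x₀ := x₀) (y := r • η) (by rw [hr']; linarith)
    rwa [hr'] at this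
  have hρ : ∀ r : ℝ, R ≤ r → r / 2 ≤ ‖x₀ - r • η‖ := by
    intro r hr
    have h1 := norm_sub_norm_le (r • η) x₀
    rw [hnr r (hR0.le.trans hr), norm_sub_rev] at h1
    linarith
  have hz : ∀ r : ℝ, R ≤ r → x₀ - r • η ≠ 0 := fun r hr h0 => by
    have := hρ r hr
    rw [h0, norm_zero] at this; linarith
  -- By the radiation condition `h` contributes a logarithmic derivative close to `ik`, and the
  -- Green's function one close to `iκ`. Hence `q'` is nearly `i (k + κ) q`, and integrating this
  -- relation expresses `∫ q` through a boundary value and a small error.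
  set q : ℝ → ℂ := fun r => ((r : ℂ) ^ 2) * (greenFn κ ‖x₀ - r • η‖ * h (r • η))
  set q' : ℝ → ℂ := fun r => 2 * (r : ℂ) * (greenFn κ ‖x₀ - r • η‖ * h (r • η)) +
    ((r : ℂ) ^ 2) * (greenGrad κ (x₀ - r • η) (-η) * h (r • η) +
      greenFn κ ‖x₀ - r • η‖ * fderiv ℝ h (r • η) η)
  have hq : ∀ r : ℝ, R ≤ r → HasDerivAt q (q' r) r := by
    intro r hr
    have hl : HasDerivAt (fun r : ℝ => r • η) η r := by
      simpa using (hasDerivAt_id r).smul_const η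
    have h1 : HasDerivAt (fun r : ℝ => ((r : ℂ) ^ 2)) (2 * (r : ℂ)) r := by
      simpa using (hasDerivAt_id r).ofReal_comp.fun_pow 2
    have h2 : HasDerivAt (fun r : ℝ => greenFn κ ‖x₀ - r • η‖) (greenGrad κ (x₀ - r • η) (-η)) r :=
      HasFDerivAt.comp_hasDerivAt (f := fun r : ℝ => x₀ - r • η) r
        (hasFDerivAt_greenFn_norm κ (hz r hr)) (hl.const_sub x₀)
    have h3 : HasDerivAt (fun r : ℝ => h (r • η)) (fderiv ℝ h (r • η) η) r :=
      (hdiff (r • η) (by rw [hnr r (hR0.le.trans hr)]; exact hr)).hasFDerivAt.comp_hasDerivAt r hl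
    exact h1.fun_mul (h2.fun_mul h3)
  -- In the constant, 1 comes from the radiation condition, 2 from differentiating `r ^ 2`, and 2
  -- from the `1/ρ` term of the gradient since `r ≤ 2ρ`. The term `4 X (k + 1)` measures the angle
  -- between the ray and the direction from `x₀`.
  have herr : ∀ r : ℝ, R ≤ r → ‖q' r - Complex.I * (k + κ) * q r‖ ≤
      δ * (2 * Real.exp X * (5 + 4 * X * (k + 1))) * Real.exp (-ε * r) := by
    intro r hr
    have hr0 : 0 < r := hR0.trans_le hr
    set ρ := ‖x₀ - r • η‖ with hρd
    have hρr := hρ r hr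
    have hρ0 : 0 < ρ := by linarith
    set ct : ℝ := ρ⁻¹ * inner ℝ (x₀ - r • η) (-η)
    have hin : inner ℝ (x₀ - r • η) (-η) = r - inner ℝ x₀ η := by
      rw [inner_neg_right, inner_sub_left, real_inner_smul_left, real_inner_self_eq_norm_sq, hη]
      ring
    have hct : |ct| ≤ 1 := by
      simp only [ct]
      rw [abs_mul, abs_of_pos (inv_pos.2 hρ0), inv_mul_le_iff₀ hρ0]
      refine (abs_real_inner_le_norm _ _).trans ?_
      rw [norm_neg, hη]
    have hct2 : 1 - ct ≤ 2 * X * ρ⁻¹ := by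
      have e2 : inner ℝ x₀ η ≤ X := by
        have := real_inner_le_norm x₀ η
        rwa [hη, mul_one] at this
      have e3 : ρ ≤ X + r := by
        have := norm_sub_le x₀ (r • η)
        rwa [hnr r hr0.le] at this
      have e4 : 1 - ct = (ρ - r + inner ℝ x₀ η) * ρ⁻¹ := by
        simp only [ct]; rw [hin]; field_simp; ring
      rw [e4]
      exact mul_le_mul_of_nonneg_right (by linarith) (by positivity)
    have hρinv : ρ⁻¹ ≤ 2 * r⁻¹ := by
      rw [← div_eq_mul_inv, inv_le_comm₀ hρ0 (by positivity), inv_div]; exact hρr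
    have hrad' : ‖(r : ℂ) * (fderiv ℝ h (r • η) η - Complex.I * (k : ℂ) * h (r • η))‖ ≤ δ := by
      have := hrad (r • η) (by rw [hnr r hr0.le]; exact hr)
      rwa [hnr r hr0.le, smul_smul, inv_mul_cancel₀ hr0.ne', one_smul] at this
    have hh := hsmall (r • η) (by rw [hnr r hr0.le]; exact hr)
    have e : q' r - Complex.I * (k + κ) * q r =
        ((r : ℂ) * greenFn κ ρ) *
          ((r : ℂ) * (fderiv ℝ h (r • η) η - Complex.I * (k : ℂ) * h (r • η)) +
           h (r • η) * (2 - (r : ℂ) * (Complex.I * κ * ((1 - ct : ℝ) : ℂ) + ((ρ⁻¹ * ct : ℝ) : ℂ)))) := by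
      simp only [q, q']
      rw [greenGrad_apply, ← hρd]
      simp only [ct]
      push_cast; ring
    have hb : ‖2 - (r : ℂ) * (Complex.I * κ * ((1 - ct : ℝ) : ℂ) + ((ρ⁻¹ * ct : ℝ) : ℂ))‖ ≤
        4 + 4 * X * (k + 1) := by
      have h1 : ‖Complex.I * κ * ((1 - ct : ℝ) : ℂ) + ((ρ⁻¹ * ct : ℝ) : ℂ)‖ ≤
          (k + 1) * (2 * X * ρ⁻¹) + ρ⁻¹ := by
        refine (norm_add_le _ _).trans (add_le_add ?_ ?_)
        · rw [norm_mul, norm_mul, Complex.norm_I, one_mul, Complex.norm_real,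
            Real.norm_of_nonneg (by linarith [(abs_le.1 hct).2])]
          exact mul_le_mul (norm_add_I_mul_le hk hε hε1) hct2
            (by linarith [(abs_le.1 hct).2]) (by linarith)
        · rw [Complex.norm_real, norm_mul, norm_inv, Real.norm_of_nonneg hρ0.le]
          exact mul_le_of_le_one_right (by positivity) hct
      have h2 : (k + 1) * (2 * X * ρ⁻¹) + ρ⁻¹ ≤ (4 * X * (k + 1) + 2) * r⁻¹ := by
        calc _ ≤ (k + 1) * (2 * X * (2 * r⁻¹)) + 2 * r⁻¹ := by gcongr
          _ = _ := by ring
      refine (norm_sub_le _ _).trans ?_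
      rw [norm_mul, Complex.norm_real, Real.norm_of_nonneg hr0.le]
      have h3 : r * ‖Complex.I * κ * ((1 - ct : ℝ) : ℂ) + ((ρ⁻¹ * ct : ℝ) : ℂ)‖ ≤
          4 * X * (k + 1) + 2 := by
        calc _ ≤ r * ((4 * X * (k + 1) + 2) * r⁻¹) :=
              mul_le_mul_of_nonneg_left (h1.trans h2) hr0.le
          _ = _ := by field_simp
      have h4 : ‖(2 : ℂ)‖ = 2 := by simp
      rw [h4]; linarith
    rw [e, norm_mul, norm_mul, Complex.norm_real, Real.norm_of_nonneg hr0.le]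
    have hsum : ‖(r : ℂ) * (fderiv ℝ h (r • η) η - Complex.I * (k : ℂ) * h (r • η)) +
           h (r • η) * (2 - (r : ℂ) * (Complex.I * κ * ((1 - ct : ℝ) : ℂ) + ((ρ⁻¹ * ct : ℝ) : ℂ)))‖ ≤
        δ + δ * (4 + 4 * X * (k + 1)) := by
      refine (norm_add_le _ _).trans (add_le_add hrad' ?_)
      rw [norm_mul]
      exact mul_le_mul hh hb (norm_nonneg _) hδ
    calc _ ≤ r * (2 * Real.exp X * (Real.exp (-ε * r) * r⁻¹)) * (δ + δ * (4 + 4 * X * (k + 1))) :=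
          mul_le_mul (mul_le_mul_of_nonneg_left (hG r hr) hr0.le) hsum (norm_nonneg _)
            (by positivity)
      _ = _ := by field_simp; ring
  have hqle : ∀ r : ℝ, R ≤ r → ‖q r‖ ≤ 2 * Real.exp X * M * (r * Real.exp (-ε * r)) := by
    intro r hr
    have hr0 : 0 < r := hR0.trans_le hr
    simp only [q]
    rw [norm_mul, norm_mul, norm_pow, Complex.norm_real, Real.norm_of_nonneg hr0.le]
    calc _ ≤ r ^ 2 * (2 * Real.exp X * (Real.exp (-ε * r) * r⁻¹) * M) := by
          gcongr
          · exact hG r hr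
          · exact hM _
      _ = _ := by field_simp
  have hqc : ContinuousOn q (Set.Ici R) := fun r hr =>
    (hq r hr).continuousAt.continuousWithinAt
  have hqi : IntegrableOn q (Set.Ioi R) := by
    have h0 : IntegrableOn (fun r : ℝ => 2 * Real.exp X * M * (r * Real.exp (-ε * r))) (Set.Ioi R) :=
      ((integrableOn_mul_exp_neg hε).mono_set (Set.Ioi_subset_Ioi hR0.le)).const_mul _
    refine Integrable.mono' h0 ((hqc.mono Set.Ioi_subset_Ici_self).aestronglyMeasurable
      measurableSet_Ioi) ?_
    filter_upwards [ae_restrict_mem measurableSet_Ioi] with r hr using hqle r (Set.mem_Ioi.1 hr).le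
  have hexpi : IntegrableOn (fun r : ℝ => Real.exp (-ε * r)) (Set.Ioi R) :=
    exp_neg_integrableOn_Ioi R hε
  have hq'm : AEStronglyMeasurable q' (volume.restrict (Set.Ioi R)) := by
    refine (measurable_deriv q).aestronglyMeasurable.congr ?_
    filter_upwards [ae_restrict_mem measurableSet_Ioi] with r hr
    exact (hq r (Set.mem_Ioi.1 hr).le).deriv
  have herri : IntegrableOn (fun r => q' r - Complex.I * (k + κ) * q r) (Set.Ioi R) := by
    refine Integrable.mono' (hexpi.const_mul (δ * (2 * Real.exp X * (5 + 4 * X * (k + 1)))))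
      (hq'm.sub (hqi.aestronglyMeasurable.const_mul _)) ?_
    filter_upwards [ae_restrict_mem measurableSet_Ioi] with r hr using herr r (Set.mem_Ioi.1 hr).le
  have hq'i : IntegrableOn q' (Set.Ioi R) := by
    have := herri.add (hqi.const_mul (Complex.I * (k + κ)))
    refine this.congr_fun (fun r _ => ?_) measurableSet_Ioi
    simp
  have hqlim : Tendsto q atTop (𝓝 0) := by
    have h0 : Tendsto (fun r : ℝ => 2 * Real.exp X * M * (r * Real.exp (-ε * r))) atTop (𝓝 0) := by
      have h1 := (tendsto_rpow_mul_exp_neg_mul_atTop_nhds_zero 1 ε hε).const_mul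
        (2 * Real.exp X * M)
      simpa using h1
    refine squeeze_zero_norm' ?_ h0
    filter_upwards [eventually_ge_atTop R] with r hr using hqle r hr
  have hFTC := integral_Ioi_of_hasDerivAt_of_tendsto
    (hq R le_rfl).continuousAt.continuousWithinAt (fun r hr => hq r (Set.mem_Ioi.1 hr).le) hq'i hqlim
  have hid : Complex.I * (k + κ) * ∫ r in Set.Ioi R, q r =
      -q R - ∫ r in Set.Ioi R, (q' r - Complex.I * (k + κ) * q r) := by
    rw [integral_sub hq'i (hqi.const_mul _), hFTC, integral_const_mul]; ring
  -- The divisor stays away from zero uniformly in `ε`, because `k` and `κ` have equal real parts of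
  -- the same sign.
  have hkκ : 2 * k ≤ ‖Complex.I * (k + κ)‖ := by
    rw [norm_mul, Complex.norm_I, one_mul]
    refine le_trans ?_ (Complex.abs_re_le_norm _)
    have : ((k : ℂ) + κ).re = 2 * k := by simp [hκ]; ring
    rw [this]; exact le_abs_self _
  have hqR : ‖q R‖ ≤ 2 * Real.exp X * M * R := by
    refine (hqle R le_rfl).trans ?_
    refine mul_le_mul_of_nonneg_left ?_ (by positivity)
    exact mul_le_of_le_one_right hR0.le (Real.exp_le_one_iff.2 (by nlinarith))
  have herrI : ‖∫ r in Set.Ioi R, (q' r - Complex.I * (k + κ) * q r)‖ ≤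
      δ * (2 * Real.exp X * (5 + 4 * X * (k + 1))) * ε⁻¹ := by
    have h1 := norm_integral_le_of_norm_le
      (hexpi.const_mul (δ * (2 * Real.exp X * (5 + 4 * X * (k + 1)))))
      (f := fun r => q' r - Complex.I * (k + κ) * q r) (by
        filter_upwards [ae_restrict_mem measurableSet_Ioi] with r hr
          using herr r (Set.mem_Ioi.1 hr).le)
    refine h1.trans ?_
    rw [integral_const_mul]
    exact mul_le_mul_of_nonneg_left (integral_exp_neg_mul_Ioi_le hε hR0.le) (by positivity)
  rw [le_div_iff₀ (by positivity)]
  calc ‖∫ r in Set.Ioi R, q r‖ * (2 * k) ≤ ‖∫ r in Set.Ioi R, q r‖ * ‖Complex.I * (k + κ)‖ :=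
        mul_le_mul_of_nonneg_left hkκ (norm_nonneg _)
    _ = ‖-q R - ∫ r in Set.Ioi R, (q' r - Complex.I * (k + κ) * q r)‖ := by
        rw [mul_comm, ← norm_mul, hid]
    _ ≤ ‖q R‖ + ‖∫ r in Set.Ioi R, (q' r - Complex.I * (k + κ) * q r)‖ := by
        rw [← norm_neg (q R)]; exact norm_sub_le _ _
    _ ≤ _ := add_le_add hqR herrI

theorem IsOutgoing.sub {k : ℝ} {w₁ w₂ : E3 → ℂ} (h₁ : IsOutgoing k w₁) (h₂ : IsOutgoing k w₂) :
    IsOutgoing k (fun x => w₁ x - w₂ x) := by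
  refine ⟨by simpa using h₁.1.sub h₂.1, ?_, ?_⟩
  · filter_upwards [h₁.2.1, h₂.2.1] with x hx hx' using hx.sub hx'
  · have h := h₁.2.2.sub h₂.2.2
    rw [sub_zero] at h
    refine h.congr' ?_
    filter_upwards [h₁.2.1, h₂.2.1] with x hx hx'
    rw [fderiv_fun_sub hx hx']
    simp only [sub_apply]
    ring

/-- An outgoing bounded function which solves the Helmholtz equation on all of space vanishes. -/
theorem IsOutgoing.eq_zero {k M : ℝ} (hk : 0 < k) {h : E3 → ℂ} (hout : IsOutgoing k h)
    (hc : Continuous h) (hM : ∀ x, ‖h x‖ ≤ M)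
    (hrep : ∀ ε : ℝ, 0 < ε → ∀ x, h x = (((k : ℂ) + Complex.I * (ε : ℂ)) ^ 2 - (k : ℂ) ^ 2) *
      greenPotential ((k : ℂ) + Complex.I * (ε : ℂ)) h x) (x₀ : E3) : h x₀ = 0 := by
  have hM0 : 0 ≤ M := (norm_nonneg _).trans (hM 0)
  set σ : ℝ := (volume : Measure E3).toSphere.real Set.univ
  have hσ : 0 ≤ σ := measureReal_nonneg
  set A : ℝ := 2 * Real.exp ‖x₀‖ * (5 + 4 * ‖x₀‖ * (k + 1))
  have hA : 0 ≤ A := by positivity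
  obtain ⟨c, hc0, hcb⟩ := exists_integral_norm_pow_inv_le
  -- Beyond the radius `R`, chosen from `δ` alone, `h` and its radiation defect are at most `δ`.
  -- Multiplied by `κ² - k² = O(ε)`, the ball and the boundary values disappear as `ε → 0`, and the
  -- error `δ A / ε` leaves a fixed multiple of `δ`.
  have main : ∀ δ : ℝ, 0 < δ → ‖h x₀‖ ≤ δ * ((2 * k + 1) * (A / (2 * k) * σ)) := by
    intro δ hδ
    have ev1 : ∀ᶠ y in cocompact E3, ‖h y‖ ≤ δ := by
      filter_upwards [hout.1.eventually (Metric.closedBall_mem_nhds 0 hδ)] with y hy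
      simpa using hy
    have ev3 : ∀ᶠ y in cocompact E3,
        ‖(‖y‖ : ℂ) * (fderiv ℝ h y (‖y‖⁻¹ • y) - Complex.I * (k : ℂ) * h y)‖ ≤ δ := by
      filter_upwards [hout.2.2.eventually (Metric.closedBall_mem_nhds 0 hδ)] with y hy
      simpa using hy
    have ev := (ev1.and (hout.2.1.and ev3))
    rw [← Metric.cobounded_eq_cocompact, ← comap_norm_atTop, eventually_comap] at ev
    obtain ⟨R₀, hR₀⟩ := eventually_atTop.1 ev
    set R : ℝ := max R₀ (2 * ‖x₀‖ + 1)
    have hR : 2 * ‖x₀‖ + 1 ≤ R := le_max_right _ _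
    have hR0 : 0 < R := by linarith [norm_nonneg x₀]
    have hfar : ∀ y, R ≤ ‖y‖ → _ := fun y hy => hR₀ ‖y‖ ((le_max_left _ _).trans hy) y rfl
    set P : ℝ := 2 * Real.exp ‖x₀‖ * M * R
    set N : ℝ := c * (R + ‖x₀‖ + 1) ^ (3 - 1) * M
    have hbound : ∀ ε : ℝ, 0 < ε → ε ≤ 1 →
        ‖h x₀‖ ≤ ε * ((2 * k + 1) * (N + P / (2 * k) * σ)) + δ * ((2 * k + 1) * (A / (2 * k) * σ)) := by
      intro ε hε hε1
      set κ : ℂ := (k : ℂ) + Complex.I * (ε : ℂ) with hκd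
      have him : κ.im = ε := by simp [hκd]
      have hκ : 0 < κ.im := by rw [him]; exact hε
      obtain ⟨C, hC⟩ := HasPotentialBound.of_bounded hκ hc.aestronglyMeasurable hM
      have hi := hC.integrable_greenFn_mul le_rfl x₀
      set S : Set E3 := Metric.closedBall 0 R
      have hS : MeasurableSet S := Metric.isClosed_closedBall.measurableSet
      have hin : ‖∫ y in S, greenFn κ ‖x₀ - y‖ * h y‖ ≤ N := by
        have hball := hcb x₀ (R + ‖x₀‖ + 1) (by positivity) 1 (by norm_num)
        have hsub : S ⊆ Metric.ball x₀ (R + ‖x₀‖ + 1) := by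
          intro y hy
          have hy' : ‖y‖ ≤ R := by simpa [S] using hy
          rw [Metric.mem_ball, dist_eq_norm]
          linarith [norm_sub_le y x₀]
        have hle : ‖∫ y in S, greenFn κ ‖x₀ - y‖ * h y‖ ≤ ∫ y in S, (‖x₀ - y‖ ^ 1)⁻¹ * M := by
          refine norm_integral_le_of_norm_le ((hball.1.mono_set hsub).mul_const M) ?_
          filter_upwards [ae_restrict_of_ae (ae_ne_point x₀)] with y hy
          rw [norm_mul, pow_one]
          exact mul_le_mul (norm_greenFn_le_inv hκ.le (norm_pos_iff.2 (sub_ne_zero.2 hy.symm)))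
            (hM y) (norm_nonneg _) (by positivity)
        refine hle.trans ?_
        rw [integral_mul_const]
        refine mul_le_mul_of_nonneg_right ?_ hM0
        exact (setIntegral_mono_set hball.1 (Eventually.of_forall fun y => by positivity)
          (Eventually.of_forall fun y hy => hsub hy)).trans hball.2
      have hout' : ‖∫ y in Sᶜ, greenFn κ ‖x₀ - y‖ * h y‖ ≤ (P + δ * A * ε⁻¹) / (2 * k) * σ := by
        rw [← integral_indicator hS.compl]
        refine norm_integral_le_of_rays (hi.indicator hS.compl) fun η hη => ?_
        have hray := norm_ray_integral_le hk hε hε1 hδ.le hM hR (fun y hy => (hfar y hy).1)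
          (fun y hy => (hfar y hy).2.1) (fun y hy => (hfar y hy).2.2) hη
        refine le_of_eq_of_le ?_ hray
        congr 1
        have e : ∀ r ∈ Set.Ioi (0 : ℝ), (r : ℂ) ^ 2 *
            Sᶜ.indicator (fun y => greenFn κ ‖x₀ - y‖ * h y) (r • η) =
            (Set.Ioi R).indicator (fun r : ℝ => (r : ℂ) ^ 2 *
              (greenFn κ ‖x₀ - r • η‖ * h (r • η))) r := by
          intro r hr
          have hmem : r • η ∈ Sᶜ ↔ r ∈ Set.Ioi R := by
            simp only [S, Set.mem_compl_iff, Metric.mem_closedBall, dist_zero_right, norm_smul, hη,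
              mul_one, Real.norm_of_nonneg (Set.mem_Ioi.1 hr).le, not_le, Set.mem_Ioi]
          by_cases hrR : r ∈ Set.Ioi R
          · rw [Set.indicator_of_mem hrR, Set.indicator_of_mem (hmem.2 hrR)]
          · rw [Set.indicator_of_notMem hrR, Set.indicator_of_notMem (fun h => hrR (hmem.1 h)),
              mul_zero]
        rw [setIntegral_congr_fun measurableSet_Ioi e, setIntegral_indicator measurableSet_Ioi,
          Set.inter_eq_self_of_subset_right (Set.Ioi_subset_Ioi hR0.le)]
      have hκk : ‖κ ^ 2 - (k : ℂ) ^ 2‖ ≤ (2 * k + 1) * ε := by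
        have e : κ ^ 2 - (k : ℂ) ^ 2 = (Complex.I * (ε : ℂ)) * (κ + k) := by simp only [hκd]; ring
        rw [e, norm_mul, norm_mul, Complex.norm_I, one_mul, Complex.norm_real,
          Real.norm_of_nonneg hε.le, mul_comm]
        refine mul_le_mul_of_nonneg_right ?_ hε.le
        refine (norm_add_le _ _).trans ?_
        rw [Complex.norm_real, Real.norm_of_nonneg hk.le]
        linarith [norm_add_I_mul_le hk hε hε1]
      rw [hrep ε hε x₀, norm_mul, greenPotential, ← integral_add_compl hS hi]
      calc _ ≤ (2 * k + 1) * ε * (N + (P + δ * A * ε⁻¹) / (2 * k) * σ) :=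
            mul_le_mul hκk ((norm_add_le _ _).trans (add_le_add hin hout')) (norm_nonneg _)
              (by positivity)
        _ = _ := by field_simp; ring
    have hlim : Tendsto (fun ε : ℝ => ε * ((2 * k + 1) * (N + P / (2 * k) * σ)) +
        δ * ((2 * k + 1) * (A / (2 * k) * σ))) (𝓝[>] 0)
        (𝓝 (δ * ((2 * k + 1) * (A / (2 * k) * σ)))) := by
      have h1 : Tendsto (fun ε : ℝ => ε * ((2 * k + 1) * (N + P / (2 * k) * σ)) +
        δ * ((2 * k + 1) * (A / (2 * k) * σ))) (𝓝 0)
        (𝓝 (0 * ((2 * k + 1) * (N + P / (2 * k) * σ)) + δ * ((2 * k + 1) * (A / (2 * k) * σ)))) :=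
        (by fun_prop : Continuous fun ε : ℝ => ε * ((2 * k + 1) * (N + P / (2 * k) * σ)) +
          δ * ((2 * k + 1) * (A / (2 * k) * σ))).tendsto 0
      rw [zero_mul, zero_add] at h1
      exact h1.mono_left nhdsWithin_le_nhds
    refine ge_of_tendsto hlim ?_
    filter_upwards [Ioc_mem_nhdsGT (zero_lt_one' ℝ)] with ε hε using hbound ε hε.1 hε.2
  have hlim : Tendsto (fun δ : ℝ => δ * ((2 * k + 1) * (A / (2 * k) * σ))) (𝓝[>] 0) (𝓝 0) := by
    have h1 : Tendsto (fun δ : ℝ => δ * ((2 * k + 1) * (A / (2 * k) * σ))) (𝓝 0)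
        (𝓝 (0 * ((2 * k + 1) * (A / (2 * k) * σ)))) :=
      (by fun_prop : Continuous fun δ : ℝ => δ * ((2 * k + 1) * (A / (2 * k) * σ))).tendsto 0
    rw [zero_mul] at h1
    exact h1.mono_left nhdsWithin_le_nhds
  have h0 : ‖h x₀‖ ≤ 0 := ge_of_tendsto hlim (by
    filter_upwards [self_mem_nhdsWithin] with δ hδ using main δ hδ)
  exact norm_le_zero_iff.1 h0


/-! ### The Fourier transform on test functions -/

theorem fourier3_eq_fourier (g : E3 → ℂ) (K : E3) :
    fourier3 g K = (((2 * Real.pi) ^ 3 : ℝ) : ℂ)⁻¹ * 𝓕 g ((2 * Real.pi)⁻¹ • K) := by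
  rw [fourier3, Real.fourier_eq']
  congr 2; funext r
  rw [smul_eq_mul]
  congr 2
  rw [real_inner_smul_right, real_inner_comm]
  have := Real.pi_ne_zero
  push_cast
  have : (Real.pi : ℂ) ≠ 0 := by exact_mod_cast this
  field_simp

theorem exists_schwartz_eq_fourier3 (φ : 𝓢(E3, ℂ)) : ∃ χ : 𝓢(E3, ℂ), ⇑χ = fourier3 φ := by
  have hu : (2 * Real.pi)⁻¹ ≠ 0 := by positivity
  refine ⟨(((2 * Real.pi) ^ 3 : ℝ) : ℂ)⁻¹ • SchwartzMap.compCLMOfContinuousLinearEquiv ℂ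
    (ContinuousLinearEquiv.smulLeft (Units.mk0 _ hu)) (𝓕 φ), ?_⟩
  funext K
  rw [fourier3_eq_fourier]
  rfl

theorem exists_fourier3_eq_schwartz (χ : 𝓢(E3, ℂ)) : ∃ φ : 𝓢(E3, ℂ), fourier3 φ = ⇑χ := by
  have hu : 2 * Real.pi ≠ 0 := by positivity
  refine ⟨𝓕⁻ ((((2 * Real.pi) ^ 3 : ℝ) : ℂ) • SchwartzMap.compCLMOfContinuousLinearEquiv ℂ
    (ContinuousLinearEquiv.smulLeft (Units.mk0 _ hu)) χ), ?_⟩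
  funext K
  rw [fourier3_eq_fourier, ← SchwartzMap.fourier_coe, FourierTransform.fourier_fourierInv_eq]
  have : ((((2 * Real.pi) ^ 3 : ℝ) : ℂ)) ≠ 0 := by exact_mod_cast pow_ne_zero 3 hu
  simp only [smul_apply, SchwartzMap.compCLMOfContinuousLinearEquiv_apply,
    Function.comp_apply, smul_eq_mul]
  rw [inv_mul_cancel_left₀ this]
  congr 1
  exact smul_inv_smul₀ hu K

/-- This is `F(ψ_inc) = δ(K - k)`, obtained from Fourier inversion after rescaling by `2π`. -/
theorem integral_incidentWave_mul_fourier3 (k : E3) (φ : 𝓢(E3, ℂ)) :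
    ∫ r, incidentWave k r * fourier3 φ r = φ k := by
  have hp : 0 < 2 * Real.pi := by positivity
  have h1 : (𝓕⁻ (𝓕 φ) : 𝓢(E3, ℂ)) k = φ k := by rw [FourierTransform.fourierInv_fourier_eq]
  rw [← h1, SchwartzMap.fourierInv_coe, Real.fourierInv_eq']
  have h2 := Measure.integral_comp_inv_smul (volume : Measure E3)
    (fun s : E3 => Complex.exp (((2 * Real.pi * inner ℝ s k : ℝ) : ℂ) * Complex.I) • (𝓕 φ) s)
    (2 * Real.pi)
  rw [finrank_E3, abs_of_pos (by positivity)] at h2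
  have h3 : ((((2 * Real.pi) ^ 3 : ℝ) : ℂ)) ≠ 0 := by exact_mod_cast pow_ne_zero 3 hp.ne'
  calc _ = (((2 * Real.pi) ^ 3 : ℝ) : ℂ)⁻¹ * ∫ r : E3, Complex.exp (((2 * Real.pi *
        inner ℝ ((2 * Real.pi)⁻¹ • r) k : ℝ) : ℂ) * Complex.I) • (𝓕 φ) ((2 * Real.pi)⁻¹ • r) := by
        rw [← integral_const_mul]
        congr 1; funext r
        rw [fourier3_eq_fourier, ← SchwartzMap.fourier_coe, incidentWave, real_inner_smul_left,
          mul_inv_cancel_left₀ hp.ne', real_inner_comm, smul_eq_mul, mul_comm Complex.I]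
        ring
    _ = _ := by
        rw [h2, Complex.real_smul, inv_mul_cancel_left₀ h3]

theorem integral_fourier3_mul {f g : E3 → ℂ} (hf : Integrable f) (hg : Integrable g) :
    ∫ K, fourier3 f K * g K = ∫ r, f r * fourier3 g r := by
  have hi : Integrable (Function.uncurry fun K r : E3 =>
      Complex.exp (-Complex.I * ((inner ℝ K r : ℝ) : ℂ)) * (g K * f r)) (volume.prod volume) := by
    refine (hg.mul_prod hf).norm.mono' ?_ (Eventually.of_forall fun p => ?_)
    · exact (by fun_prop : Continuous fun p : E3 × E3 =>
        Complex.exp (-Complex.I * ((inner ℝ p.1 p.2 : ℝ) : ℂ))).aestronglyMeasurable.mul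
        (hg.mul_prod hf).aestronglyMeasurable
    · have e : -Complex.I * ((inner ℝ p.1 p.2 : ℝ) : ℂ) =
          Complex.I * ((-inner ℝ p.1 p.2 : ℝ) : ℂ) := by push_cast; ring
      simp only [Function.uncurry]
      rw [norm_mul, e, norm_exp_I_mul_ofReal, one_mul]
  have e1 : ∀ K, fourier3 f K * g K = (((2 * Real.pi) ^ 3 : ℝ) : ℂ)⁻¹ *
      ∫ r : E3, Complex.exp (-Complex.I * ((inner ℝ K r : ℝ) : ℂ)) * (g K * f r) := by
    intro K
    rw [fourier3, mul_assoc, ← integral_mul_const]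
    congr 2; funext r; ring
  have e2 : ∀ r, f r * fourier3 g r = (((2 * Real.pi) ^ 3 : ℝ) : ℂ)⁻¹ *
      ∫ K : E3, Complex.exp (-Complex.I * ((inner ℝ K r : ℝ) : ℂ)) * (g K * f r) := by
    intro r
    rw [fourier3, mul_left_comm, ← integral_const_mul]
    congr 2; funext K; rw [real_inner_comm]; ring
  simp_rw [e1, e2, integral_const_mul]
  rw [integral_integral_swap hi]

/-- Multiplication by the incident wave shifts the Fourier transform by `k`, so the two source terms
together are the transform of `v ψ`. -/
theorem sourceTransform_eq {k : E3} {v : E3 → ℝ} {ψ ψs : E3 → ℂ} (hv : Integrable v)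
    (hvs : Integrable fun r => (v r : ℂ) * ψs r) (hψ : ∀ r, ψ r = incidentWave k r + ψs r) (K : E3) :
    sourceTransform k v ψs K = fourier3 (fun r => (v r : ℂ) * ψ r) K := by
  have hb : ∀ t : ℝ, ‖Complex.exp (-Complex.I * (t : ℂ))‖ ≤ 1 := fun t => by
    have := norm_exp_I_mul_ofReal (-t)
    rw [Complex.ofReal_neg, mul_neg, ← neg_mul] at this
    exact this.le
  have h1 : Integrable fun r : E3 =>
      Complex.exp (-Complex.I * ((inner ℝ (K - k) r : ℝ) : ℂ)) * (v r : ℂ) :=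
    hv.ofReal.bdd_mul (c := 1) (by fun_prop) (Eventually.of_forall fun r => hb _)
  have h2 : Integrable fun r : E3 =>
      Complex.exp (-Complex.I * ((inner ℝ K r : ℝ) : ℂ)) * ((v r : ℂ) * ψs r) :=
    hvs.bdd_mul (c := 1) (by fun_prop) (Eventually.of_forall fun r => hb _)
  rw [sourceTransform, fourier3, fourier3, fourier3, ← mul_add, ← integral_add h1 h2]
  congr 2; funext r
  have e : Complex.exp (-Complex.I * ((inner ℝ (K - k) r : ℝ) : ℂ)) =
      Complex.exp (-Complex.I * ((inner ℝ K r : ℝ) : ℂ)) * incidentWave k r := by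
    rw [incidentWave, ← Complex.exp_add, inner_sub_left]
    congr 1; push_cast; ring
  rw [hψ, e]; ring

theorem propagator_eq (m hbar : ℝ) (κ : ℂ) (K : E3) : propagator m hbar κ K =
    ((2 * m / hbar ^ 2 : ℝ) : ℂ) * (κ ^ 2 - (‖K‖ : ℂ) ^ 2)⁻¹ := by
  rw [propagator, ← neg_sub (κ ^ 2), mul_neg, neg_div_neg_eq]
  push_cast
  rw [div_mul_eq_div_div, div_eq_mul_inv]

theorem fourier3_const_mul (c : ℂ) (g : E3 → ℂ) (x : E3) :
    fourier3 (fun K => c * g K) x = c * fourier3 g x := by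
  rw [fourier3, fourier3, mul_left_comm, ← integral_const_mul c]
  congr 2; funext r; ring

section propagator

variable (m hbar : ℝ) {κ : ℂ} (φ : 𝓢(E3, ℂ))

theorem exists_schwartz_eq_propagator_mul (hκ : 0 < κ.im) :
    ∃ χ : 𝓢(E3, ℂ), ∀ K, χ K = propagator m hbar κ K * φ K := by
  refine ⟨((2 * m / hbar ^ 2 : ℝ) : ℂ) • SchwartzMap.smulLeftCLM ℂ
    (fun ξ : E3 => (κ ^ 2 - ((1 * ‖ξ‖ : ℝ) : ℂ) ^ 2)⁻¹) φ, fun K => ?_⟩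
  rw [smul_apply, SchwartzMap.smulLeftCLM_apply_apply
    (hasTemperateGrowth_resolvent hκ _), propagator_eq, smul_eq_mul, smul_eq_mul, one_mul, mul_assoc]

theorem fourier3_propagator_mul (hκ : 0 < κ.im) (x : E3) :
    fourier3 (fun K => propagator m hbar κ K * φ K) x =
      ((2 * m / hbar ^ 2 : ℝ) : ℂ) * greenPotential κ (fourier3 φ) x := by
  rw [greenPotential_fourier3 hκ φ.integrable, ← fourier3_const_mul]
  congr 1; funext K; rw [propagator_eq, mul_assoc]

/-- The propagator is the Fourier multiplier of the Green's operator, which is its own transpose and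
can therefore be moved from the test function to `g`. -/
theorem integral_mul_fourier3_propagator_mul (hκ : 0 < κ.im) {b C : ℝ} {g : E3 → ℂ}
    (hg : HasPotentialBound b g C) (hb : b ≤ κ.im) :
    ∫ r, g r * fourier3 (fun K => propagator m hbar κ K * φ K) r =
      ((2 * m / hbar ^ 2 : ℝ) : ℂ) * ∫ r, greenPotential κ g r * fourier3 φ r := by
  obtain ⟨χ, hχ⟩ := exists_schwartz_eq_fourier3 φ
  rw [← hχ, hg.integral_greenPotential_mul hb χ.integrable, ← integral_const_mul]
  congr 1; funext r
  rw [fourier3_propagator_mul m hbar φ hκ, hχ]; ring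

theorem integral_propagator_mul_fourier3 (hκ : 0 < κ.im) {C : ℝ} {f : E3 → ℂ} (hfi : Integrable f)
    (hf : HasPotentialBound 0 f C) :
    ∫ K, propagator m hbar κ K * fourier3 f K * φ K =
      ((2 * m / hbar ^ 2 : ℝ) : ℂ) * ∫ r, greenPotential κ f r * fourier3 φ r := by
  obtain ⟨χ, hχ⟩ := exists_schwartz_eq_propagator_mul m hbar φ hκ
  have h : (fun K => propagator m hbar κ K * φ K) = χ := funext fun K => (hχ K).symm
  rw [← integral_mul_fourier3_propagator_mul m hbar φ hκ hf hκ.le, h,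
    ← integral_fourier3_mul hfi χ.integrable]
  congr 1; funext K; rw [hχ]; ring

theorem propagator_mul_eq_integral (hκ : 0 < κ.im) (k : E3) :
    propagator m hbar κ k * φ k =
      ((2 * m / hbar ^ 2 : ℝ) : ℂ) * ∫ r, greenPotential κ (incidentWave k) r * fourier3 φ r := by
  obtain ⟨χ, hχ⟩ := exists_schwartz_eq_propagator_mul m hbar φ hκ
  have h : (fun K => propagator m hbar κ K * φ K) = χ := funext fun K => (hχ K).symm
  obtain ⟨C, hC⟩ := HasPotentialBound.of_bounded hκ
    (continuous_incidentWave k).aestronglyMeasurable (fun y => (norm_incidentWave k y).le)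
  rw [← integral_mul_fourier3_propagator_mul m hbar φ hκ hC le_rfl, h,
    integral_incidentWave_mul_fourier3, hχ]

end propagator


/-! ### The equations for the wave function -/

theorem greenPotential_const_mul (κ c : ℂ) (g : E3 → ℂ) (x : E3) :
    greenPotential κ (fun y => c * g y) x = c * greenPotential κ g x := by
  rw [greenPotential, greenPotential, ← integral_const_mul]
  congr 1; funext y; ring

theorem HasPotentialBound.greenPotential_add {b C C' : ℝ} {g g' : E3 → ℂ}
    (h : HasPotentialBound b g C) (h' : HasPotentialBound b g' C') {κ : ℂ} (hb : b ≤ κ.im) (x : E3) :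
    greenPotential κ (fun y => g y + g' y) x = greenPotential κ g x + greenPotential κ g' x := by
  rw [greenPotential, greenPotential, greenPotential,
    ← integral_add (h.integrable_greenFn_mul hb x) (h'.integrable_greenFn_mul hb x)]
  congr 1; funext y; ring

theorem integrable_mul_helmholtz {u : E3 → ℂ} (hu : AEStronglyMeasurable u) {M : ℝ}
    (hM : ∀ x, ‖u x‖ ≤ M) (z : ℂ) (χ : 𝓢(E3, ℂ)) : Integrable (fun x => u x * helmholtz z χ x) :=
  integrable_mul_schwartz hu hM (helmholtz z χ)

theorem IsHelmholtzSolution.sub {z : ℂ} {u₁ u₂ g₁ g₂ : E3 → ℂ} {M₁ M₂ : ℝ}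
    (h₁ : IsHelmholtzSolution z u₁ g₁) (h₂ : IsHelmholtzSolution z u₂ g₂)
    (hu₁ : AEStronglyMeasurable u₁) (hM₁ : ∀ x, ‖u₁ x‖ ≤ M₁)
    (hu₂ : AEStronglyMeasurable u₂) (hM₂ : ∀ x, ‖u₂ x‖ ≤ M₂)
    (hg₁ : ∀ χ : 𝓢(E3, ℂ), Integrable fun x => g₁ x * χ x)
    (hg₂ : ∀ χ : 𝓢(E3, ℂ), Integrable fun x => g₂ x * χ x) :
    IsHelmholtzSolution z (fun x => u₁ x - u₂ x) (fun x => g₁ x - g₂ x) := by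
  intro χ
  simp_rw [sub_mul]
  rw [integral_sub (integrable_mul_helmholtz hu₁ hM₁ z χ) (integrable_mul_helmholtz hu₂ hM₂ z χ),
    integral_sub (hg₁ χ) (hg₂ χ), h₁ χ, h₂ χ]

theorem IsHelmholtzSolution.add {z : ℂ} {u₁ u₂ g₁ g₂ : E3 → ℂ} {M₁ M₂ : ℝ}
    (h₁ : IsHelmholtzSolution z u₁ g₁) (h₂ : IsHelmholtzSolution z u₂ g₂)
    (hu₁ : AEStronglyMeasurable u₁) (hM₁ : ∀ x, ‖u₁ x‖ ≤ M₁)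
    (hu₂ : AEStronglyMeasurable u₂) (hM₂ : ∀ x, ‖u₂ x‖ ≤ M₂)
    (hg₁ : ∀ χ : 𝓢(E3, ℂ), Integrable fun x => g₁ x * χ x)
    (hg₂ : ∀ χ : 𝓢(E3, ℂ), Integrable fun x => g₂ x * χ x) :
    IsHelmholtzSolution z (fun x => u₁ x + u₂ x) (fun x => g₁ x + g₂ x) := by
  intro χ
  simp_rw [add_mul]
  rw [integral_add (integrable_mul_helmholtz hu₁ hM₁ z χ) (integrable_mul_helmholtz hu₂ hM₂ z χ),
    integral_add (hg₁ χ) (hg₂ χ), h₁ χ, h₂ χ]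

/-- An interaction energy that is constant on all of space can be moved into the wave number. -/
theorem IsHelmholtzSolution.shift {z c : ℂ} {u g : E3 → ℂ} {M : ℝ}
    (h : IsHelmholtzSolution z u (fun x => g x + c * u x))
    (hu : AEStronglyMeasurable u) (hM : ∀ x, ‖u x‖ ≤ M)
    (hg : ∀ χ : 𝓢(E3, ℂ), Integrable fun x => g x * χ x) : IsHelmholtzSolution (z - c) u g := by
  intro χ
  have h1 := h χ
  have hui := integrable_mul_schwartz hu hM χ
  have e : (fun x => (g x + c * u x) * χ x) = fun x => g x * χ x + c * (u x * χ x) := by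
    funext x; ring
  rw [e, integral_add (hg χ) (hui.const_mul c), integral_const_mul,
    integral_mul_helmholtz hu hM] at h1
  rw [integral_mul_helmholtz hu hM]
  linear_combination h1

theorem IsHelmholtzSolution.eq_zero_of_isOutgoing {k M : ℝ} (hk : 0 < k) {h : E3 → ℂ}
    (hsol : IsHelmholtzSolution ((k : ℂ) ^ 2) h 0) (hout : IsOutgoing k h) (hc : Continuous h)
    (hM : ∀ x, ‖h x‖ ≤ M) (x : E3) : h x = 0 := by
  refine hout.eq_zero hk hc hM (fun ε hε x => ?_) x
  have hz : ∀ κ : ℂ, greenPotential κ 0 = 0 := fun κ => by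
    funext x; simp [greenPotential]
  have h0 : HasPotentialBound 0 (0 : E3 → ℂ) 0 :=
    ⟨aestronglyMeasurable_zero, fun x => by simp, fun x => by simp⟩
  have him : ((k : ℂ) + Complex.I * (ε : ℂ)).im = ε := by simp
  have := hsol.eq_greenPotential hc hM h0 (κ := (k : ℂ) + Complex.I * (ε : ℂ))
    (by rw [him]; exact hε.le) (by rw [him]; exact hε) (by rw [hz]; exact continuous_zero) x
  rwa [hz, Pi.zero_apply, zero_add] at this

/-- The two functions differ by the factor `exp (-ερ)`, and `|exp (-ερ) - 1| ≤ ερ` cancels the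
singularity. -/
theorem norm_greenFn_add_I_mul_sub_le (κ : ℂ) {ε ρ : ℝ} (hε : 0 ≤ ε) (hρ : 0 < ρ) :
    ‖greenFn (κ + Complex.I * (ε : ℂ)) ρ - greenFn κ ρ‖ ≤
      ε / (4 * Real.pi) * Real.exp (-κ.im * ρ) := by
  have e : greenFn (κ + Complex.I * (ε : ℂ)) ρ - greenFn κ ρ =
      greenFn κ ρ * ((Real.exp (-(ε * ρ)) - 1 : ℝ) : ℂ) := by
    have e1 : Complex.exp (Complex.I * (κ + Complex.I * (ε : ℂ)) * (ρ : ℂ)) =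
        Complex.exp (Complex.I * κ * (ρ : ℂ)) * Complex.exp (-((ε : ℂ) * ρ)) := by
      rw [← Complex.exp_add]
      congr 1
      linear_combination (ε : ℂ) * ρ * Complex.I_mul_I
    simp only [greenFn]
    rw [e1]; push_cast; ring
  have h1 : |Real.exp (-(ε * ρ)) - 1| ≤ ε * ρ := by
    rw [abs_le]
    constructor
    · linarith [Real.add_one_le_exp (-(ε * ρ))]
    · have : Real.exp (-(ε * ρ)) ≤ 1 := Real.exp_le_one_iff.2 (by nlinarith)
      nlinarith
  rw [e, norm_mul, norm_greenFn _ hρ.le, Complex.norm_real, Real.norm_eq_abs]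
  calc _ ≤ Real.exp (-κ.im * ρ) / (4 * Real.pi * ρ) * (ε * ρ) := by gcongr
    _ = _ := by field_simp

/-! ### Removing the regularization for densities `f + c ψ`. -/

section

variable {k M : ℝ} {κ : ℂ} {v : E3 → ℝ} {f ψ : E3 → ℂ} {c : ℂ}

theorem exists_hasPotentialBound_add (hv : IsShortRange v) (hfm : AEStronglyMeasurable f)
    (hf : ∀ y, ‖f y‖ ≤ M * |v y|) {N : ℝ} (hψ : Continuous ψ) (hN : ∀ y, ‖ψ y‖ ≤ N)
    (hκ : 0 < κ.im) : ∃ C, HasPotentialBound κ.im (fun y => f y + c * ψ y) C := by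
  obtain ⟨C, hC⟩ := hv.exists_hasPotentialBound hfm hf
  obtain ⟨C', hC'⟩ := HasPotentialBound.of_bounded hκ hψ.aestronglyMeasurable hN
  exact ⟨_, (hC.mono hκ.le).add (hC'.const_mul c)⟩

theorem continuous_greenPotential_add (hv : IsShortRange v) (hfm : AEStronglyMeasurable f)
    (hf : ∀ y, ‖f y‖ ≤ M * |v y|) {N : ℝ} (hψ : Continuous ψ) (hN : ∀ y, ‖ψ y‖ ≤ N)
    (hκ : 0 < κ.im) : Continuous (greenPotential κ fun y => f y + c * ψ y) := by
  obtain ⟨C, hC⟩ := hv.exists_hasPotentialBound hfm hf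
  obtain ⟨C', hC'⟩ := HasPotentialBound.of_bounded hκ hψ.aestronglyMeasurable hN
  have e : (greenPotential κ fun y => f y + c * ψ y) =
      fun x => greenPotential κ f x + c * greenPotential κ ψ x := by
    funext x
    rw [(hC.mono hκ.le).greenPotential_add (hC'.const_mul c) le_rfl, greenPotential_const_mul]
  rw [e]
  exact (hv.continuous_greenPotential hfm hf hκ.le).add
    (continuous_const.mul (continuous_greenPotential_of_bounded hκ hψ hN))

theorem eventually_continuous_greenPotential_add (hv : IsShortRange v)
    (hfm : AEStronglyMeasurable f) (hf : ∀ y, ‖f y‖ ≤ M * |v y|) {N : ℝ} (hψ : Continuous ψ)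
    (hN : ∀ y, ‖ψ y‖ ≤ N) (hκ : 0 ≤ κ.im) : ∀ᶠ ε : ℝ in 𝓝[>] 0,
      Continuous (greenPotential (κ + Complex.I * (ε : ℂ)) fun y => f y + c * ψ y) := by
  filter_upwards [self_mem_nhdsWithin] with ε hε
  exact continuous_greenPotential_add hv hfm hf hψ hN
    (by simpa using add_pos_of_nonneg_of_pos hκ (Set.mem_Ioi.1 hε))

/-- At complex wave numbers the potential of `f + c ψ`, where `(Δ + z) ψ = f`, is almost `ψ`
as soon as `κ² - z` is almost `c`. -/
theorem IsHelmholtzSolution.exists_norm_greenPotential_sub_le {z : ℂ}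
    (hsol : IsHelmholtzSolution z ψ f) (hv : IsShortRange v) (hfm : AEStronglyMeasurable f)
    (hf : ∀ y, ‖f y‖ ≤ M * |v y|) {N : ℝ} (hψ : Continuous ψ) (hN : ∀ y, ‖ψ y‖ ≤ N) :
    ∃ B : ℝ, ∀ κ : ℂ, 0 < κ.im → κ ^ 2 - z ≠ 0 → ∀ x,
      ‖greenPotential κ (fun y => f y + c * ψ y) x - ψ x‖ ≤ ‖1 - c / (κ ^ 2 - z)‖ * B := by
  obtain ⟨C, hC⟩ := hv.exists_hasPotentialBound hfm hf
  refine ⟨C / (4 * Real.pi) + N, fun κ hκ hz x => ?_⟩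
  obtain ⟨C', hC'⟩ := HasPotentialBound.of_bounded hκ hψ.aestronglyMeasurable hN
  have h1 := hsol.eq_greenPotential hψ hN hC hκ.le hκ (hv.continuous_greenPotential hfm hf hκ.le) x
  rw [(hC.mono hκ.le).greenPotential_add (hC'.const_mul c) le_rfl, greenPotential_const_mul]
  -- The representation formula determines `G_κ ψ` from `G_κ f` and `ψ`. The factor `G_κ f - ψ` has
  -- a bound free of `κ` because `f` admits the exponent `b = 0`.
  have e : greenPotential κ f x + c * greenPotential κ ψ x - ψ x =
      (1 - c / (κ ^ 2 - z)) * (greenPotential κ f x - ψ x) := by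
    have h2 : greenPotential κ ψ x = (ψ x - greenPotential κ f x) / (κ ^ 2 - z) := by
      rw [eq_div_iff hz]; linear_combination -h1
    rw [h2]; ring
  rw [e, norm_mul]
  refine mul_le_mul_of_nonneg_left ?_ (norm_nonneg _)
  exact (norm_sub_le _ _).trans (add_le_add (hC.norm_greenPotential_le hκ.le x) (hN x))

/-- The scalar `c / ((κ + iε)² - z)` tends to 1 precisely because `c ≠ 0`; for the scattering
problem this is `V∞ ≠ 0`. -/
theorem IsHelmholtzSolution.tendstoUniformly_greenPotential {z : ℂ}
    (hsol : IsHelmholtzSolution z ψ f) (hv : IsShortRange v) (hfm : AEStronglyMeasurable f)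
    (hf : ∀ y, ‖f y‖ ≤ M * |v y|) {N : ℝ} (hψ : Continuous ψ) (hN : ∀ y, ‖ψ y‖ ≤ N)
    (hκ : 0 ≤ κ.im) (hκz : κ ^ 2 - z = c) (hc : c ≠ 0) :
    TendstoUniformly (fun (ε : ℝ) x =>
      greenPotential (κ + Complex.I * (ε : ℂ)) (fun y => f y + c * ψ y) x) ψ (𝓝[>] 0) := by
  obtain ⟨B, hB⟩ := hsol.exists_norm_greenPotential_sub_le (c := c) hv hfm hf hψ hN
  have h1 : Tendsto (fun ε : ℝ => (κ + Complex.I * (ε : ℂ)) ^ 2 - z) (𝓝[>] 0) (𝓝 c) := by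
    rw [← hκz]; exact ((tendsto_add_I_mul κ).pow 2).sub_const z
  have h2 : Tendsto (fun ε : ℝ => ‖1 - c / ((κ + Complex.I * (ε : ℂ)) ^ 2 - z)‖ * B) (𝓝[>] 0)
      (𝓝 0) := by
    have := (((tendsto_const_nhds (x := c)).div h1 hc |>.const_sub 1).norm.mul_const B)
    rwa [div_self hc, sub_self, norm_zero, zero_mul] at this
  rw [Metric.tendstoUniformly_iff]
  intro δ hδ
  filter_upwards [h1.eventually_ne hc, h2.eventually_lt_const hδ, self_mem_nhdsWithin]
    with ε hε1 hε2 hε x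
  rw [dist_comm, dist_eq_norm]
  refine (hB _ ?_ hε1 x).trans_lt hε2
  have : (κ + Complex.I * (ε : ℂ)).im = κ.im + ε := by simp
  rw [this]; exact add_pos_of_nonneg_of_pos hκ hε

/-- When `κ` already has positive imaginary part, as for `E < 0`, the regularized potentials
converge to the unregularized one whether or not any equation holds. -/
theorem tendstoUniformly_greenPotential_of_im_pos (hfi : Integrable f)
    {C : ℝ} (hf : HasPotentialBound 0 f C) {N : ℝ} (hψ : Continuous ψ) (hN : ∀ y, ‖ψ y‖ ≤ N)
    (hκ : 0 < κ.im) : TendstoUniformly (fun (ε : ℝ) x =>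
      greenPotential (κ + Complex.I * (ε : ℂ)) (fun y => f y + c * ψ y) x)
      (greenPotential κ (fun y => f y + c * ψ y)) (𝓝[>] 0) := by
  obtain ⟨C', hC'⟩ := HasPotentialBound.of_bounded hκ hψ.aestronglyMeasurable hN
  have hg := (hf.mono hκ.le).add (hC'.const_mul c)
  have hexp : Integrable (fun y : E3 => Real.exp (-κ.im * ‖y‖)) := by
    simpa using integrable_exp_neg_mul_norm_div_pow hκ (j := 0) (by norm_num)
  set B : ℝ := (∫ y, ‖f y‖) + ‖c‖ * N * ∫ y : E3, Real.exp (-κ.im * ‖y‖)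
  have key : ∀ ε : ℝ, 0 < ε → ∀ x,
      ‖greenPotential (κ + Complex.I * (ε : ℂ)) (fun y => f y + c * ψ y) x -
        greenPotential κ (fun y => f y + c * ψ y) x‖ ≤ ε / (4 * Real.pi) * B := by
    intro ε hε x
    have him : κ.im ≤ (κ + Complex.I * (ε : ℂ)).im := by simp [hε.le]
    rw [greenPotential, greenPotential, ← integral_sub (hg.integrable_greenFn_mul him x)
      (hg.integrable_greenFn_mul le_rfl x)]
    have hi : Integrable fun y => ‖f y‖ + ‖c‖ * N * Real.exp (-κ.im * ‖x - y‖) :=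
      hfi.norm.add ((hexp.comp_sub_left x).const_mul _)
    have hB : ∫ y, (‖f y‖ + ‖c‖ * N * Real.exp (-κ.im * ‖x - y‖)) = B := by
      rw [integral_add hfi.norm ((hexp.comp_sub_left x).const_mul _), integral_const_mul,
        integral_sub_left_eq_self (fun y : E3 => Real.exp (-κ.im * ‖y‖))]
    rw [← hB, ← integral_const_mul]
    refine norm_integral_le_of_norm_le (hi.const_mul _) ?_
    filter_upwards [ae_ne_point x] with y hy
    have hρ : 0 < ‖x - y‖ := norm_pos_iff.2 (sub_ne_zero.2 hy.symm)
    rw [← sub_mul, norm_mul]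
    have hle1 : Real.exp (-κ.im * ‖x - y‖) ≤ 1 := Real.exp_le_one_iff.2 (by nlinarith)
    have h1 : ‖f y + c * ψ y‖ ≤ ‖f y‖ + ‖c‖ * N :=
      (norm_add_le _ _).trans (by rw [norm_mul]; gcongr; exact hN y)
    have hN0 : 0 ≤ ‖c‖ * N := mul_nonneg (norm_nonneg _) ((norm_nonneg _).trans (hN y))
    calc _ ≤ ε / (4 * Real.pi) * Real.exp (-κ.im * ‖x - y‖) * (‖f y‖ + ‖c‖ * N) :=
          mul_le_mul (norm_greenFn_add_I_mul_sub_le κ hε.le hρ) h1 (norm_nonneg _) (by positivity)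
      _ = ε / (4 * Real.pi) * (Real.exp (-κ.im * ‖x - y‖) * ‖f y‖ +
            ‖c‖ * N * Real.exp (-κ.im * ‖x - y‖)) := by ring
      _ ≤ _ := by
          gcongr
          exact mul_le_of_le_one_left (norm_nonneg _) hle1
  have hlim : Tendsto (fun ε : ℝ => ε / (4 * Real.pi) * B) (𝓝[>] 0) (𝓝 0) := by
    have h1 : Tendsto (fun ε : ℝ => ε / (4 * Real.pi) * B) (𝓝 0) (𝓝 (0 / (4 * Real.pi) * B)) :=
      (by fun_prop : Continuous fun ε : ℝ => ε / (4 * Real.pi) * B).tendsto 0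
    rw [zero_div, zero_mul] at h1
    exact h1.mono_left nhdsWithin_le_nhds
  rw [Metric.tendstoUniformly_iff]
  intro δ hδ
  filter_upwards [hlim.eventually_lt_const hδ, self_mem_nhdsWithin] with ε hε1 hε x
  rw [dist_comm, dist_eq_norm]
  exact (key ε hε x).trans_lt hε1

theorem tendsto_integral_mul_of_tendstoUniformly {u : ℝ → E3 → ℂ} {l : Filter ℝ}
    (h : TendstoUniformly u ψ l) (hu : ∀ᶠ ε in l, AEStronglyMeasurable (u ε))
    (hψ : AEStronglyMeasurable ψ) {N : ℝ} (hN : ∀ y, ‖ψ y‖ ≤ N) (χ : 𝓢(E3, ℂ)) :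
    Tendsto (fun ε => ∫ x, u ε x * χ x) l (𝓝 (∫ x, ψ x * χ x)) := by
  have hψi := integrable_mul_schwartz hψ hN χ
  rw [Metric.tendsto_nhds]
  intro δ hδ
  set I := ∫ x, ‖χ x‖
  have hI : 0 ≤ I := integral_nonneg fun _ => norm_nonneg _
  have hpos : 0 < δ / (I + 1) := by positivity
  filter_upwards [Metric.tendstoUniformly_iff.1 h _ hpos, hu] with ε hε hm
  have hd : ∀ x, ‖u ε x - ψ x‖ ≤ δ / (I + 1) := fun x => by
    rw [← dist_eq_norm, dist_comm]; exact (hε x).le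
  have hi := integrable_mul_schwartz (hm.sub hψ) hd χ
  have e : (∫ x, u ε x * χ x) = (∫ x, (u ε - ψ) x * χ x) + ∫ x, ψ x * χ x := by
    rw [← integral_add hi hψi]
    congr 1; funext x; simp only [Pi.sub_apply]; ring
  rw [dist_eq_norm, e, add_sub_cancel_right]
  calc _ ≤ ∫ x, δ / (I + 1) * ‖χ x‖ := by
        refine norm_integral_le_of_norm_le (χ.integrable.norm.const_mul _)
          (Eventually.of_forall fun x => ?_)
        rw [norm_mul]
        exact mul_le_mul_of_nonneg_right (hd x) (norm_nonneg _)
    _ = δ * (I / (I + 1)) := by rw [integral_const_mul]; ring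
    _ < δ := mul_lt_of_lt_one_right hδ ((div_lt_one (by positivity)).2 (by linarith))

/-- Convergence against compactly supported test functions is the common consequence of the locally
uniform and the distributional limit, so both homogeneous equations feed into this one statement. -/
theorem isHelmholtzSolution_of_tendsto_greenPotential (hv : IsShortRange v)
    (hfm : AEStronglyMeasurable f) (hf : ∀ y, ‖f y‖ ≤ M * |v y|) {N : ℝ} (hψ : Continuous ψ)
    (hN : ∀ y, ‖ψ y‖ ≤ N) (hκ : 0 ≤ κ.im)
    (h : ∀ χ : 𝓢(E3, ℂ), HasCompactSupport χ → Tendsto (fun ε : ℝ =>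
      ∫ x, greenPotential (κ + Complex.I * (ε : ℂ)) (fun y => f y + c * ψ y) x * χ x) (𝓝[>] 0)
      (𝓝 (∫ x, ψ x * χ x))) :
    IsHelmholtzSolution (κ ^ 2) ψ (fun y => f y + c * ψ y) := by
  have hfi := hv.integrable_of_le hfm hf
  have him : ∀ ε : ℝ, 0 < ε → 0 < (κ + Complex.I * (ε : ℂ)).im := fun ε hε => by
    have : (κ + Complex.I * (ε : ℂ)).im = κ.im + ε := by simp
    rw [this]; exact add_pos_of_nonneg_of_pos hκ hε
  refine IsHelmholtzSolution.of_hasCompactSupport hψ.aestronglyMeasurable hN (fun χ => ?_) ?_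
  · have e : (fun x => (f x + c * ψ x) * χ x) = fun x => f x * χ x + c * (ψ x * χ x) := by
      funext x; ring
    rw [e]
    exact (hfi.mul_schwartz χ).add
      ((integrable_mul_schwartz hψ.aestronglyMeasurable hN χ).const_mul c)
  intro χ hχ
  have hΔ : HasCompactSupport ⇑(Δ χ : 𝓢(E3, ℂ)) := by
    refine hχ.mono' fun x hx => support_iteratedFDeriv_subset (𝕜 := ℝ) 2 fun h0 => hx ?_
    have h1 := norm_laplacian_le χ x
    rw [h0, norm_zero, mul_zero] at h1
    exact norm_le_zero_iff.1 h1
  refine integral_mul_helmholtz_eq_of_tendsto (l := 𝓝[>] (0 : ℝ))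
    (u := fun ε => greenPotential (κ + Complex.I * (ε : ℂ)) (fun y => f y + c * ψ y))
    (z := fun ε => (κ + Complex.I * (ε : ℂ)) ^ 2) ?_ hψ.aestronglyMeasurable hN
    ((tendsto_add_I_mul κ).pow 2) ?_ (h _ hΔ) (h _ hχ)
  · filter_upwards [self_mem_nhdsWithin] with ε hε
    obtain ⟨C, hC⟩ := exists_hasPotentialBound_add (c := c) hv hfm hf hψ hN (him ε hε)
    exact ⟨hC.aestronglyMeasurable_greenPotential _, _, hC.norm_greenPotential_le le_rfl⟩
  · filter_upwards [self_mem_nhdsWithin] with ε hε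
    obtain ⟨C, hC⟩ := exists_hasPotentialBound_add (c := c) hv hfm hf hψ hN (him ε hε)
    exact hC.isHelmholtzSolution le_rfl (him ε hε) χ

theorem tendsto_integral_mul_of_tendstoLocallyUniformly {u : ℝ → E3 → ℂ} {l : Filter ℝ}
    (h : TendstoLocallyUniformly u ψ l) (hu : ∀ᶠ ε in l, Continuous (u ε))
    (hψ : Continuous ψ) {N : ℝ} (hN : ∀ y, ‖ψ y‖ ≤ N) (χ : 𝓢(E3, ℂ)) (hχ : HasCompactSupport χ) :
    Tendsto (fun ε => ∫ x, u ε x * χ x) l (𝓝 (∫ x, ψ x * χ x)) := by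
  set K := tsupport χ
  have hK : IsCompact K := hχ
  have hKm : MeasurableSet K := (isClosed_tsupport _).measurableSet
  have hun : TendstoUniformlyOn u ψ l K :=
    -- On the compact support of `χ` the convergence is uniform; cutting off by its indicator
    -- changes no integral against `χ`.
    (tendstoLocallyUniformlyOn_iff_tendstoUniformlyOn_of_compact hK).1 h.tendstoLocallyUniformlyOn
  have hun' : TendstoUniformly (fun ε => K.indicator (u ε)) (K.indicator ψ) l := by
    rw [Metric.tendstoUniformly_iff]
    intro δ hδ
    filter_upwards [Metric.tendstoUniformlyOn_iff.1 hun δ hδ] with ε hε x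
    by_cases hx : x ∈ K
    · simpa [hx] using hε x hx
    · simpa [hx] using hδ
  have e : ∀ w : E3 → ℂ, ∫ x, K.indicator w x * χ x = ∫ x, w x * χ x := by
    intro w
    congr 1; funext x
    by_cases hx : x ∈ K
    · rw [Set.indicator_of_mem hx]
    · rw [image_eq_zero_of_notMem_tsupport hx, mul_zero, mul_zero]
  have := tendsto_integral_mul_of_tendstoUniformly hun' (hu.mono fun ε h =>
    h.aestronglyMeasurable.indicator hKm) (hψ.aestronglyMeasurable.indicator hKm)
    (fun y => (norm_indicator_le_norm_self ψ y).trans (hN y)) χ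
  simpa only [e] using this



/-! ### Equivalence of the scattering equations -/

theorem waveNumberZero_sq (m hbar E : ℝ) (hm : 0 < m) :
    waveNumberZero m hbar E ^ 2 = ((2 * m / hbar ^ 2 : ℝ) : ℂ) * E := by
  unfold waveNumberZero
  split_ifs with h
  · rw [← Complex.ofReal_pow, Real.sq_sqrt (by positivity)]
    push_cast; ring
  · rw [mul_pow, Complex.I_sq, ← Complex.ofReal_pow, Real.sq_sqrt (by positivity),
      abs_of_neg (not_le.1 h)]
    push_cast; ring

theorem waveNumberZero_im_nonneg (m hbar E : ℝ) : 0 ≤ (waveNumberZero m hbar E).im := by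
  unfold waveNumberZero
  split_ifs
  · simp
  · simp

theorem waveNumberZero_im_pos {m hbar E : ℝ} (hm : 0 < m) (hhbar : 0 < hbar) (hE : E < 0) :
    0 < (waveNumberZero m hbar E).im := by
  rw [waveNumberZero, if_neg (not_le.2 hE)]
  have : 0 < |E| := abs_pos.2 hE.ne
  simp only [Complex.mul_im, Complex.I_re, Complex.I_im, Complex.ofReal_re, Complex.ofReal_im,
    zero_mul, one_mul, zero_add]
  positivity

section

variable {m hbar Vinf M : ℝ} {k : E3} {κ : ℂ} {V v : E3 → ℝ} {ψ ψs f : E3 → ℂ} {c : ℂ}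

theorem norm_density_le (hM : ∀ r, ‖ψ r‖ ≤ M) (a : ℂ) (y : E3) :
    ‖a * ((v y : ℂ) * ψ y)‖ ≤ ‖a‖ * M * |v y| := by
  rw [norm_mul, norm_mul, Complex.norm_real, Real.norm_eq_abs, mul_comm |v y|, mul_assoc]
  gcongr
  exact hM y

theorem aestronglyMeasurable_density (hv : IsShortRange v) (hψ : Continuous ψ) (a : ℂ) :
    AEStronglyMeasurable (fun y => a * ((v y : ℂ) * ψ y)) := by
  have := hv.1
  have := hψ.measurable
  exact Measurable.aestronglyMeasurable (by fun_prop)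

theorem mul_integral_eq_greenPotential (hV : ∀ r, V r = v r + Vinf) (a : ℂ) (r : E3) :
    a * ∫ r', greenFn κ ‖r - r'‖ * ((V r' : ℂ) * ψ r') =
      greenPotential κ (fun y => a * ((v y : ℂ) * ψ y) + a * Vinf * ψ y) r := by
  rw [greenPotential, ← integral_const_mul]
  congr 1; funext y; rw [hV]; push_cast; ring

theorem integrable_greenFn_mul_interaction (hv : IsShortRange v) (hV : ∀ r, V r = v r + Vinf)
    (hψ : Continuous ψ) (hM : ∀ r, ‖ψ r‖ ≤ M) (hκ : 0 < κ.im) (r : E3) :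
    Integrable fun r' => greenFn κ ‖r - r'‖ * ((V r' : ℂ) * ψ r') := by
  obtain ⟨C, hC⟩ := exists_hasPotentialBound_add (c := (Vinf : ℂ)) hv
    (aestronglyMeasurable_density hv hψ 1) (norm_density_le hM 1) hψ hM hκ
  refine (hC.integrable_greenFn_mul le_rfl r).congr (Eventually.of_forall fun y => ?_)
  simp only [hV]; push_cast; ring

theorem inhomogeneousEq_iff (hv : IsShortRange v) (hψ : Continuous ψ) (hM : ∀ r, ‖ψ r‖ ≤ M)
    (hdec : ∀ r, ψ r = incidentWave k r + ψs r) :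
    InhomogeneousEq m hbar k v ψ ↔ ∀ x, ψs x = greenPotential (‖k‖ : ℂ)
      (fun y => ((2 * m / hbar ^ 2 : ℝ) : ℂ) * ((v y : ℂ) * ψ y)) x := by
  obtain ⟨C, hC⟩ := hv.exists_hasPotentialBound (aestronglyMeasurable_density hv hψ 1)
    (norm_density_le hM 1)
  have hi : ∀ r, Integrable fun r' => greenFn (‖k‖ : ℂ) ‖r - r'‖ * ((v r' : ℂ) * ψ r') := fun r => by
    simpa using hC.integrable_greenFn_mul (κ := (‖k‖ : ℂ)) (by simp) r
  refine forall_congr' fun r => ?_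
  rw [and_iff_right (hi r), hdec, add_right_inj, greenPotential_const_mul]
  rfl

theorem homogeneousEq_iff (hv : IsShortRange v) (hV : ∀ r, V r = v r + Vinf)
    (hψ : Continuous ψ) (hM : ∀ r, ‖ψ r‖ ≤ M) (hκ : 0 ≤ κ.im) :
    HomogeneousEq m hbar κ V ψ ↔ TendstoLocallyUniformly (fun (ε : ℝ) x =>
      greenPotential (κ + Complex.I * (ε : ℂ)) (fun y => ((2 * m / hbar ^ 2 : ℝ) : ℂ) *
        ((v y : ℂ) * ψ y) + ((2 * m / hbar ^ 2 : ℝ) : ℂ) * Vinf * ψ y) x) ψ (𝓝[>] 0) := by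
  unfold HomogeneousEq
  simp_rw [mul_integral_eq_greenPotential hV]
  refine and_iff_right fun ε hε r => integrable_greenFn_mul_interaction hv hV hψ hM ?_ r
  simpa using add_pos_of_nonneg_of_pos hκ hε

theorem homogeneousEq_iff_homogeneousEqAbs (hv : IsShortRange v) (hV : ∀ r, V r = v r + Vinf)
    (hψ : Continuous ψ) (hM : ∀ r, ‖ψ r‖ ≤ M) (hκ : 0 < κ.im) :
    HomogeneousEq m hbar κ V ψ ↔ HomogeneousEqAbs m hbar κ V ψ := by
  have hfm := aestronglyMeasurable_density hv hψ ((2 * m / hbar ^ 2 : ℝ) : ℂ)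
  have hf := norm_density_le (v := v) hM ((2 * m / hbar ^ 2 : ℝ) : ℂ)
  obtain ⟨C, hC⟩ := hv.exists_hasPotentialBound hfm hf
  have hlim := tendstoUniformly_greenPotential_of_im_pos
    (c := ((2 * m / hbar ^ 2 : ℝ) : ℂ) * Vinf) (hv.integrable_of_le hfm hf) hC hψ hM hκ
  rw [homogeneousEq_iff hv hV hψ hM hκ.le]
  have h2 : HomogeneousEqAbs m hbar κ V ψ ↔ ∀ x, ψ x = greenPotential κ (fun y =>
      ((2 * m / hbar ^ 2 : ℝ) : ℂ) * ((v y : ℂ) * ψ y) +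
        ((2 * m / hbar ^ 2 : ℝ) : ℂ) * Vinf * ψ y) x := by
    refine forall_congr' fun r => ?_
    rw [and_iff_right (integrable_greenFn_mul_interaction hv hV hψ hM hκ r),
      mul_integral_eq_greenPotential hV]
  rw [h2]
  constructor
  · intro h x
    exact tendsto_nhds_unique
      ((tendstoLocallyUniformlyOn_univ.2 h).tendsto_at (Set.mem_univ x)) (hlim.tendsto_at x)
  · intro h
    have h3 := hlim.tendstoLocallyUniformly
    rwa [← funext h] at h3

/-- Every Schwartz function is some `fourier3 φ`, so these pairings separate continuous bounded
functions. -/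
theorem eq_of_fourierPairing_eq {u w : E3 → ℂ} (hu : Continuous u) (hw : Continuous w) {N N' : ℝ}
    (hN : ∀ x, ‖u x‖ ≤ N) (hN' : ∀ x, ‖w x‖ ≤ N')
    (h : ∀ φ : 𝓢(E3, ℂ), fourierPairing u φ = fourierPairing w φ) : u = w := by
  rw [← sub_eq_zero]
  refine (hu.sub hw).eq_zero_of_integral_schwartz fun χ => ?_
  obtain ⟨φ, hφ⟩ := exists_fourier3_eq_schwartz χ
  have := h φ
  simp only [fourierPairing, hφ] at this
  simp only [Pi.sub_apply, sub_mul]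
  rw [integral_sub (integrable_mul_schwartz hu.aestronglyMeasurable hN χ)
    (integrable_mul_schwartz hw.aestronglyMeasurable hN' χ), this, sub_self]

theorem integral_propagator_mul_sourceTransform (hv : IsShortRange v) (hψ : Continuous ψ)
    (hM : ∀ r, ‖ψ r‖ ≤ M) (hdec : ∀ r, ψ r = incidentWave k r + ψs r) (hκ : 0 < κ.im)
    (φ : 𝓢(E3, ℂ)) :
    ∫ K, propagator m hbar κ K * sourceTransform k v ψs K * φ K =
      fourierPairing (greenPotential κ
        (fun y => ((2 * m / hbar ^ 2 : ℝ) : ℂ) * ((v y : ℂ) * ψ y))) φ := by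
  have hfm : AEStronglyMeasurable fun y => (v y : ℂ) * ψ y := by
    simpa using aestronglyMeasurable_density hv hψ 1
  have hf : ∀ y, ‖(v y : ℂ) * ψ y‖ ≤ M * |v y| := by simpa using norm_density_le (v := v) hM 1
  have hfi := hv.integrable_of_le hfm hf
  obtain ⟨C, hC⟩ := hv.exists_hasPotentialBound hfm hf
  have hvs : Integrable fun r => (v r : ℂ) * ψs r := by
    have h1 : Integrable fun r => incidentWave k r * (v r : ℂ) :=
      hv.integrable.ofReal.bdd_mul (c := 1) (continuous_incidentWave k).aestronglyMeasurable
        (Eventually.of_forall fun r => (norm_incidentWave k r).le)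
    refine (hfi.sub h1).congr (Eventually.of_forall fun r => ?_)
    simp only [Pi.sub_apply, hdec]; ring
  simp_rw [sourceTransform_eq hv.integrable hvs hdec]
  rw [integral_propagator_mul_fourier3 m hbar φ hκ hfi hC, fourierPairing, ← integral_const_mul]
  congr 1; funext r
  rw [greenPotential_const_mul]; ring

/-- The regularized right side always converges, namely to the transform of `G_k f`. The equation
therefore only identifies `ψ_scatt` with that potential. -/
theorem momentumInhomogeneousEq_iff (hv : IsShortRange v) (hψ : Continuous ψ)
    (hM : ∀ r, ‖ψ r‖ ≤ M) (hdec : ∀ r, ψ r = incidentWave k r + ψs r) :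
    MomentumInhomogeneousEq m hbar k v ψs ↔ ∀ x, ψs x = greenPotential (‖k‖ : ℂ)
      (fun y => ((2 * m / hbar ^ 2 : ℝ) : ℂ) * ((v y : ℂ) * ψ y)) x := by
  have hfm := aestronglyMeasurable_density hv hψ ((2 * m / hbar ^ 2 : ℝ) : ℂ)
  have hf := norm_density_le (v := v) hM ((2 * m / hbar ^ 2 : ℝ) : ℂ)
  obtain ⟨C, hC⟩ := hv.exists_hasPotentialBound hfm hf
  have hkim : (0 : ℝ) ≤ ((‖k‖ : ℂ)).im := by simp
  have hψs : ψs = fun x => ψ x - incidentWave k x := by funext x; rw [hdec]; ring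
  have hψsc : Continuous ψs := by rw [hψs]; exact hψ.sub (continuous_incidentWave k)
  have hψsM : ∀ x, ‖ψs x‖ ≤ M + 1 := fun x => by
    rw [hψs]
    exact (norm_sub_le _ _).trans (add_le_add (hM x) (norm_incidentWave k x).le)
  have hlim : ∀ φ : 𝓢(E3, ℂ), Tendsto (fun ε : ℝ => ∫ K : E3,
      propagator m hbar ((‖k‖ : ℂ) + Complex.I * (ε : ℂ)) K * sourceTransform k v ψs K * φ K)
      (𝓝[>] 0) (𝓝 (fourierPairing (greenPotential (‖k‖ : ℂ)
        (fun y => ((2 * m / hbar ^ 2 : ℝ) : ℂ) * ((v y : ℂ) * ψ y))) φ)) := by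
    intro φ
    obtain ⟨χ, hχ⟩ := exists_schwartz_eq_fourier3 φ
    have h1 := tendsto_integral_greenPotential_mul hC (tendsto_add_I_mul (‖k‖ : ℂ))
      (by filter_upwards [self_mem_nhdsWithin] with ε hε; simpa using (Set.mem_Ioi.1 hε).le)
      χ.integrable
    rw [hχ] at h1
    refine h1.congr' ?_
    filter_upwards [self_mem_nhdsWithin] with ε hε
    rw [integral_propagator_mul_sourceTransform hv hψ hM hdec (by simpa using hε)]
    rfl
  constructor
  · intro h
    exact congrFun (eq_of_fourierPairing_eq hψsc (hv.continuous_greenPotential hfm hf hkim) hψsM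
      (hC.norm_greenPotential_le hkim) fun φ => tendsto_nhds_unique (h φ) (hlim φ))
  · intro h φ
    rw [funext h]
    have := hlim φ
    rw [funext h] at this
    exact this

/-- For each `ε > 0` the regularized right side is exactly the pairing of the potential of `f + c ψ`
with `fourier3 φ`; the delta term and `ψ_scatt` recombine into `ψ`. -/
theorem momentumHomogeneousEq_iff (hv : IsShortRange v) (hψ : Continuous ψ)
    (hM : ∀ r, ‖ψ r‖ ≤ M) (hdec : ∀ r, ψ r = incidentWave k r + ψs r) (hκ : 0 ≤ κ.im) :
    MomentumHomogeneousEq m hbar Vinf κ k v ψs ↔ ∀ χ : 𝓢(E3, ℂ), Tendsto (fun ε : ℝ => ∫ x,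
      greenPotential (κ + Complex.I * (ε : ℂ)) (fun y => ((2 * m / hbar ^ 2 : ℝ) : ℂ) *
        ((v y : ℂ) * ψ y) + ((2 * m / hbar ^ 2 : ℝ) : ℂ) * Vinf * ψ y) x * χ x) (𝓝[>] 0)
      (𝓝 (∫ x, ψ x * χ x)) := by
  have hfm := aestronglyMeasurable_density hv hψ ((2 * m / hbar ^ 2 : ℝ) : ℂ)
  have hf := norm_density_le (v := v) hM ((2 * m / hbar ^ 2 : ℝ) : ℂ)
  obtain ⟨C, hC⟩ := hv.exists_hasPotentialBound hfm hf
  have hψs : ψs = fun x => ψ x - incidentWave k x := by funext x; rw [hdec]; ring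
  have hψsc : Continuous ψs := by rw [hψs]; exact hψ.sub (continuous_incidentWave k)
  have hψsM : ∀ x, ‖ψs x‖ ≤ M + 1 := fun x => by
    rw [hψs]
    exact (norm_sub_le _ _).trans (add_le_add (hM x) (norm_incidentWave k x).le)
  have hinc : ∀ x, ‖incidentWave k x‖ ≤ 1 := fun x => (norm_incidentWave k x).le
  set a : ℂ := ((2 * m / hbar ^ 2 : ℝ) : ℂ) with ha
  have key : ∀ (φ χ : 𝓢(E3, ℂ)), fourier3 φ = ⇑χ →
      (Tendsto (fun ε : ℝ =>
        (∫ K : E3, propagator m hbar (κ + Complex.I * (ε : ℂ)) K * sourceTransform k v ψs K * φ K)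
        + (Vinf : ℂ) * (propagator m hbar (κ + Complex.I * (ε : ℂ)) k * φ k
            + fourierPairing ψs (fun K => propagator m hbar (κ + Complex.I * (ε : ℂ)) K * φ K)))
        (𝓝[>] 0) (𝓝 (φ k + fourierPairing ψs φ)) ↔
      Tendsto (fun ε : ℝ => ∫ x, greenPotential (κ + Complex.I * (ε : ℂ))
        (fun y => a * ((v y : ℂ) * ψ y) + a * Vinf * ψ y) x * χ x) (𝓝[>] 0)
        (𝓝 (∫ x, ψ x * χ x))) := by
    intro φ χ hφχ
    have e0 : φ k + fourierPairing ψs φ = ∫ x, ψ x * χ x := by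
      rw [← integral_incidentWave_mul_fourier3, fourierPairing, hφχ, ← integral_add
        (integrable_mul_schwartz (continuous_incidentWave k).aestronglyMeasurable hinc χ)
        (integrable_mul_schwartz hψsc.aestronglyMeasurable hψsM χ)]
      congr 1; funext x; rw [hdec]; ring
    rw [e0]
    refine tendsto_congr' ?_
    filter_upwards [self_mem_nhdsWithin] with ε hε
    have hε' : 0 < (κ + Complex.I * (ε : ℂ)).im := by
      simpa using add_pos_of_nonneg_of_pos hκ (Set.mem_Ioi.1 hε)
    set κ' := κ + Complex.I * (ε : ℂ)
    obtain ⟨C₁, hC₁⟩ := HasPotentialBound.of_bounded hε'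
      (continuous_incidentWave k).aestronglyMeasurable hinc
    obtain ⟨C₂, hC₂⟩ := HasPotentialBound.of_bounded hε' hψsc.aestronglyMeasurable hψsM
    rw [integral_propagator_mul_sourceTransform hv hψ hM hdec hε', propagator_mul_eq_integral m hbar
      φ hε', fourierPairing, fourierPairing, integral_mul_fourier3_propagator_mul m hbar φ hε' hC₂
      le_rfl, hφχ, ← ha]
    have i1 := integrable_mul_schwartz (hC.aestronglyMeasurable_greenPotential κ')
      (hC.norm_greenPotential_le hε'.le) χ
    have i2 := integrable_mul_schwartz (hC₁.aestronglyMeasurable_greenPotential κ')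
      (hC₁.norm_greenPotential_le le_rfl) χ
    have i3 := integrable_mul_schwartz (hC₂.aestronglyMeasurable_greenPotential κ')
      (hC₂.norm_greenPotential_le le_rfl) χ
    have i4 : Integrable fun x => (Vinf : ℂ) * a * (greenPotential κ' (incidentWave k) x * χ x +
        greenPotential κ' ψs x * χ x) := (i2.add i3).const_mul _
    rw [← mul_add, ← integral_add i2 i3, ← mul_assoc, ← integral_const_mul,
      ← integral_add i1 i4]
    congr 1; funext x
    have e1 : (fun y => a * Vinf * ψ y) = fun y => a * Vinf * (incidentWave k y + ψs y) := by
      funext y; rw [hdec]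
    have h2 := (hC.mono hε'.le).greenPotential_add ((hC₁.add hC₂).const_mul (a * Vinf)) le_rfl x
    rw [greenPotential_const_mul κ' (a * Vinf), hC₁.greenPotential_add hC₂ le_rfl] at h2
    simp_rw [← hdec] at h2
    rw [h2]; ring
  constructor
  · intro h χ
    obtain ⟨φ, hφ⟩ := exists_fourier3_eq_schwartz χ
    exact (key φ χ hφ).1 (h φ)
  · intro h φ
    obtain ⟨χ, hχ⟩ := exists_schwartz_eq_fourier3 φ
    exact (key φ χ hχ.symm).2 (h χ)

theorem isOutgoing_of_eq_greenPotential (hv : IsShortRange v) (hfm : AEStronglyMeasurable f)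
    (hf : ∀ y, ‖f y‖ ≤ M * |v y|) (h : ∀ x, ψs x = greenPotential (‖k‖ : ℂ) f x) :
    IsOutgoing ‖k‖ ψs := by
  rw [funext h]
  exact hv.isOutgoing_greenPotential hfm hf (norm_nonneg k)

theorem isHelmholtzSolution_of_eq_greenPotential (hv : IsShortRange v)
    (hfm : AEStronglyMeasurable f) (hf : ∀ y, ‖f y‖ ≤ M * |v y|)
    (hdec : ∀ r, ψ r = incidentWave k r + ψs r)
    (h : ∀ x, ψs x = greenPotential (‖k‖ : ℂ) f x) :
    IsHelmholtzSolution ((‖k‖ : ℂ) ^ 2) ψ f := by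
  obtain ⟨C, hC⟩ := hv.exists_hasPotentialBound hfm hf
  have hkim : (0 : ℝ) ≤ ((‖k‖ : ℂ)).im := by simp
  have hsol := (isHelmholtzSolution_incidentWave k).add (hC.isHelmholtzSolution_of_nonneg hkim)
    (continuous_incidentWave k).aestronglyMeasurable (fun x => (norm_incidentWave k x).le)
    (hC.aestronglyMeasurable_greenPotential _) (hC.norm_greenPotential_le hkim)
    (fun χ => by simp) (hv.integrable_of_le hfm hf).mul_schwartz
  have e : ψ = fun x => incidentWave k x + greenPotential (‖k‖ : ℂ) f x := by
    funext x; rw [hdec, h]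
  rw [e]
  simpa using hsol

/-- Both `ψ_scatt` and `G_k f` are bounded outgoing solutions of the same inhomogeneous equation, so
the uniqueness theorem applies to their difference. -/
theorem eq_greenPotential_of_isHelmholtzSolution (hv : IsShortRange v)
    (hfm : AEStronglyMeasurable f) {N : ℝ} (hf : ∀ y, ‖f y‖ ≤ N * |v y|) (hψ : Continuous ψ)
    (hM : ∀ r, ‖ψ r‖ ≤ M) (hdec : ∀ r, ψ r = incidentWave k r + ψs r) (hk : 0 < ‖k‖)
    (hsol : IsHelmholtzSolution ((‖k‖ : ℂ) ^ 2) ψ f) (hout : IsOutgoing ‖k‖ ψs) (x : E3) :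
    ψs x = greenPotential (‖k‖ : ℂ) f x := by
  obtain ⟨C, hC⟩ := hv.exists_hasPotentialBound hfm hf
  have hkim : (0 : ℝ) ≤ ((‖k‖ : ℂ)).im := by simp
  have hfi := hv.integrable_of_le hfm hf
  have hψs : ψs = fun x => ψ x - incidentWave k x := by funext x; rw [hdec]; ring
  have hψsc : Continuous ψs := by rw [hψs]; exact hψ.sub (continuous_incidentWave k)
  have hψsM : ∀ x, ‖ψs x‖ ≤ M + 1 := fun x => by
    rw [hψs]
    exact (norm_sub_le _ _).trans (add_le_add (hM x) (norm_incidentWave k x).le)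
  have h1 := hsol.sub (isHelmholtzSolution_incidentWave k) hψ.aestronglyMeasurable hM
    (continuous_incidentWave k).aestronglyMeasurable (fun x => (norm_incidentWave k x).le)
    hfi.mul_schwartz (fun χ => by simp)
  rw [← hψs] at h1
  simp only [Pi.zero_apply, sub_zero] at h1
  have h2 := h1.sub (hC.isHelmholtzSolution_of_nonneg hkim) hψsc.aestronglyMeasurable hψsM
    (hC.aestronglyMeasurable_greenPotential _) (hC.norm_greenPotential_le hkim)
    hfi.mul_schwartz hfi.mul_schwartz
  simp only [sub_self] at h2
  refine sub_eq_zero.1 (IsHelmholtzSolution.eq_zero_of_isOutgoing hk h2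
    (hout.sub (hv.isOutgoing_greenPotential hfm hf hk.le))
    (hψsc.sub (hv.continuous_greenPotential hfm hf hkim))
    (fun x => (norm_sub_le _ _).trans (add_le_add (hψsM x) (hC.norm_greenPotential_le hkim x))) x)


end

theorem mainTheorem1
    (m hbar E Vinf : ℝ) (hm : 0 < m) (hhbar : 0 < hbar) (hVinf : Vinf ≠ 0) (hE : Vinf < E)
    (k : E3) (hk : ‖k‖ ^ 2 = 2 * m / hbar ^ 2 * (E - Vinf))
    (V v : E3 → ℝ) (hV : ∀ r, V r = v r + Vinf) (hv : IsShortRange v)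
    (ψ : E3 → ℂ) (hψcont : Continuous ψ) (hψbdd : ∃ M : ℝ, ∀ r, ‖ψ r‖ ≤ M)
    (ψscatt : E3 → ℂ) (hψ : ∀ r, ψ r = incidentWave k r + ψscatt r) :
    ((2 * m * Vinf : ℝ) : ℂ) /
        (((hbar ^ 2 : ℝ) : ℂ) * ((‖k‖ : ℂ) ^ 2 - waveNumberZero m hbar E ^ 2)) = -1 ∧
    List.TFAE
      [ InhomogeneousEq m hbar k v ψ,
        MomentumInhomogeneousEq m hbar k v ψscatt,
        HomogeneousEq m hbar (waveNumberZero m hbar E) V ψ ∧ IsOutgoing ‖k‖ ψscatt,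
        MomentumHomogeneousEq m hbar Vinf (waveNumberZero m hbar E) k v ψscatt ∧
          IsOutgoing ‖k‖ ψscatt ] ∧
    (E < 0 →
      (HomogeneousEq m hbar (waveNumberZero m hbar E) V ψ ↔
        HomogeneousEqAbs m hbar (waveNumberZero m hbar E) V ψ)) := by
  obtain ⟨M, hM⟩ := hψbdd
  have ha0 : (0 : ℝ) < 2 * m / hbar ^ 2 := by positivity
  have hdiff : waveNumberZero m hbar E ^ 2 - (‖k‖ : ℂ) ^ 2 =
      ((2 * m / hbar ^ 2 : ℝ) : ℂ) * Vinf := by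
    rw [waveNumberZero_sq m hbar E hm, ← Complex.ofReal_pow, hk]
    push_cast; ring
  have hne : ((2 * m / hbar ^ 2 : ℝ) : ℂ) * Vinf ≠ 0 :=
    mul_ne_zero (by exact_mod_cast ha0.ne') (by exact_mod_cast hVinf)
  -- Positivity comes from `E > V∞`; the oscillation argument for uniqueness divides by `2k`.
  have hkpos : 0 < ‖k‖ := by
    refine (norm_nonneg k).lt_of_ne fun h0 => ?_
    rw [← h0] at hk
    nlinarith [mul_pos ha0 (sub_pos.2 hE)]
  have hκ := waveNumberZero_im_nonneg m hbar E
  have hfm := aestronglyMeasurable_density hv hψcont ((2 * m / hbar ^ 2 : ℝ) : ℂ)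
  have hf := norm_density_le (v := v) hM ((2 * m / hbar ^ 2 : ℝ) : ℂ)
  -- Since `k₀² - k² = a V∞`, the constant part of the interaction is absorbed in passing from `k₀`
  -- to `k`.
  have hshift : ∀ hsol : IsHelmholtzSolution (waveNumberZero m hbar E ^ 2) ψ (fun y =>
      ((2 * m / hbar ^ 2 : ℝ) : ℂ) * ((v y : ℂ) * ψ y) +
        ((2 * m / hbar ^ 2 : ℝ) : ℂ) * Vinf * ψ y),
      IsHelmholtzSolution ((‖k‖ : ℂ) ^ 2) ψ
        (fun y => ((2 * m / hbar ^ 2 : ℝ) : ℂ) * ((v y : ℂ) * ψ y)) := fun hsol => by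
    have h := hsol.shift hψcont.aestronglyMeasurable hM (hv.integrable_of_le hfm hf).mul_schwartz
    rwa [← hdiff, sub_sub_cancel] at h
  refine ⟨?_, ?_, fun hE0 => homogeneousEq_iff_homogeneousEqAbs hv hV hψcont hM
    (waveNumberZero_im_pos hm hhbar hE0)⟩
  · have h2 : ((hbar : ℂ)) ≠ 0 := by exact_mod_cast hhbar.ne'
    have h3 : (m : ℂ) ≠ 0 := by exact_mod_cast hm.ne'
    have h4 : (Vinf : ℂ) ≠ 0 := by exact_mod_cast hVinf
    rw [← neg_sub, hdiff]
    push_cast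
    field_simp
  · rw [inhomogeneousEq_iff hv hψcont hM hψ, momentumInhomogeneousEq_iff hv hψcont hM hψ,
      homogeneousEq_iff hv hV hψcont hM hκ, momentumHomogeneousEq_iff hv hψcont hM hψ hκ]
    -- After the rewriting both statements are literally `ψ_scatt = G_k f`.
    tfae_have 1 ↔ 2 := Iff.rfl
    tfae_have 1 → 3 := fun h =>
      ⟨((isHelmholtzSolution_of_eq_greenPotential hv hfm hf hψ h).tendstoUniformly_greenPotential
        hv hfm hf hψcont hM hκ hdiff hne).tendstoLocallyUniformly,
        isOutgoing_of_eq_greenPotential hv hfm hf h⟩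
    tfae_have 1 → 4 := fun h =>
      ⟨tendsto_integral_mul_of_tendstoUniformly
        ((isHelmholtzSolution_of_eq_greenPotential hv hfm hf hψ h).tendstoUniformly_greenPotential
          hv hfm hf hψcont hM hκ hdiff hne)
        (eventually_continuous_greenPotential_add hv hfm hf hψcont hM hκ |>.mono
          fun ε h => h.aestronglyMeasurable) hψcont.aestronglyMeasurable hM,
        isOutgoing_of_eq_greenPotential hv hfm hf h⟩
    tfae_have 3 → 1 := fun ⟨h, hout⟩ =>
      eq_greenPotential_of_isHelmholtzSolution hv hfm hf hψcont hM hψ hkpos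
        (hshift (isHelmholtzSolution_of_tendsto_greenPotential hv hfm hf hψcont hM hκ
          (tendsto_integral_mul_of_tendstoLocallyUniformly h
            (eventually_continuous_greenPotential_add hv hfm hf hψcont hM hκ) hψcont hM))) hout
    tfae_have 4 → 1 := fun ⟨h, hout⟩ =>
      eq_greenPotential_of_isHelmholtzSolution hv hfm hf hψcont hM hψ hkpos
        (hshift (isHelmholtzSolution_of_tendsto_greenPotential hv hfm hf hψcont hM hκ
          fun χ _ => h χ)) hout
    tfae_finish
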